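/- **Model.** Sources $1,\dots,N$ share a channel. A pattern $P=[P_0,\dots,P_{K-1}]$, $K\ge 1$, of sources is repeated cyclically and without idling: the $k$-th transmission ($k=0,1,\dots$) serves source $P_{k \bmod K}$, its packet is generated when the transmission starts, and it is delivered at the end of the transmission unless it is dropped. Service times are non-negative and independent, those of source $m$ being identically distributed with mean $s_m>0$ and finite variance $v_m$; a packet of source $m$ is dropped with probability $p_m$, independently of all other drops and of all service times. Source $m$ appears $\alpha_m$ times in $P$. Fix a source $n$ with $\alpha_n\ge 1$ and $p_n<1$. Its age of information is $\Delta_n(t)=t-g_n(t)$, where $g_n(t)$ is the generation time of the freshest update of source $n$ delivered by time $t$ (with an arbitrary non-negative initial age). Its mean AoI $\mathbb E[\Delta_n]$ is the time average $\lim_{T\to\infty}\frac1T\int_0^T\Delta_n(t)\,dt$. **Cycles.** A cycle runs from one successful delivery of source $n$ to the next. It is in state $(i,j)$, $i,j\in\{1,\dots,\alpha_n\}$, if it starts at the $i$-th and ends at the $j$-th scheduling instance of source $n$ in $P$. Let $A_{i,j}$ be the area under $\Delta_n$ over a cycle in state $(i,j)$ and $T_{i,j}$ its duration. Let $Z_{i,j}$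 be the total service time of the transmissions from just after the $i$-th instance of source $n$ up to and including the next following occurrence of its $j$-th instance (a whole round of $K$ transmissions if $i=j$), with $\overline z_{i,j}=\mathbb E[Z_{i,j}]$ and $\tilde z_{i,j}=\mathbb E[Z_{i,j}^2]$. Put $\hat s=\sum_m\alpha_m s_m$ and $\hat v=\sum_m\alpha_m v_m$. Let $\overline m=\mathbb E[M]$ and $\tilde m=\mathbb E[M^2]$, where $\Pr(M=m)=(1-p_n^{\alpha_n})\,(p_n^{\alpha_n})^m$, $m=0,1,2,\dots$. Put $$p_{i,j}=\frac{(1-p_n)\,p_n^{\,j-i-1}}{1-p_n^{\alpha_n}}\ \ (j>i),\qquad p_{i,j}=\frac{(1-p_n)\,p_n^{\,j+\alpha_n-i-1}}{1-p_n^{\alpha_n}}\ \ (i\ge j),\qquad \pi_{i,j}=\frac{p_{i,j}}{\alpha_n},$$ with $0^0=1$. **Claim.** 1. Almost surely source $n$ has infinitely many successes. The states of the successive cycles form a Markov chain on the $\alpha_n^2$ pairs, in which $(i,j)$ is accessible only from the states $(k,i)$, from each of them with probability $p_{i,j}$. If $p_n>0$, this chain is ergodic (irreducible and aperiodic). Its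 unique stationary distribution is $(\pi_{i,j})$. 2. Any $K$ consecutive transmissions (a round) have total duration with mean $\hat s$ and variance $\hat v$. Given that a cycle is in state $(i,j)$ (when this has positive probability), the number of complete rounds that elapse in it before the round of the next success has the law of $M$, the time from the end of these rounds to the end of the cycle has first two moments $\overline z_{i,j}$ and $\tilde z_{i,j}$, and the expected area and duration of the cycle are finite and equal to $$\mathbb E[A_{i,j}]=\frac{\tilde m\hat s^2+\overline m(2s_n\hat s+\hat v)+\tilde z_{i,j}+2\overline z_{i,j}(\overline m\hat s+s_n)}{2},\qquad \mathbb E[T_{i,j}]=\overline m\hat s+\overline z_{i,j}.$$ 3. With these expressions for all $i,j$, $\sum_{i,j}\pi_{i,j}\mathbb E[T_{i,j}]>0$, and almost surely the time average of $\Delta_n$ exists and equals $$\mathbb E[\Delta_n]=\frac{\sum_{i,j}\pi_{i,j}\mathbb E[A_{i,j}]}{\sum_{i,j}\pi_{i,j}\mathbb E[T_{i,j}]}=\frac{\tilde m\hat s^2+\overline m(2s_n\hat s+\hat v)+\sum_{i,j}\pi_{i,j}\tilde z_{i,j}}{2\left(\overline m\hat s+\sum_{i,j}\pi_{i,j}\overline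 z_{i,j}\right)}+\frac{(\overline m\hat s+s_n)\sum_{i,j}\pi_{i,j}\overline z_{i,j}}{\overline m\hat s+\sum_{i,j}\pi_{i,j}\overline z_{i,j}}.$$ -/

import Mathlib

open MeasureTheory ProbabilityTheory Filter Topology Matrix

namespace CyclicAoI

noncomputable section

/-! ### The pattern -/

/-- The source served by the `k`-th transmission (`k = 0, 1, …`) when the pattern `P` is repeated
cyclically. -/
def src {N K : ℕ} [NeZero K] (P : Fin K → Fin N) (k : ℕ) : Fin N :=
  P (Fin.ofNat K k)

/-- The places of source `n` in the pattern. -/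
def slots {N K : ℕ} (P : Fin K → Fin N) (n : Fin N) : Finset (Fin K) :=
  Finset.univ.filter fun k => P k = n

/-- The number of times that source `n` appears in the pattern. -/
def alpha {N K : ℕ} (P : Fin K → Fin N) (n : Fin N) : ℕ :=
  (slots P n).card

/-- The place in the pattern of the `i`-th scheduling instance of source `n`
(instances are listed in increasing order and numbered from `0`). -/
def inst {N K : ℕ} (P : Fin K → Fin N) (n : Fin N) (i : Fin (alpha P n)) : ℕ :=
  ((slots P n).orderEmbOfFin rfl i : Fin K)

/-- The number of transmissions, in `{1, …, K}`, that lead from just after the `i`-th instance of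
source `n` up to and including the first following occurrence of its `j`-th instance. -/
def windowLength {N K : ℕ} (P : Fin K → Fin N) (n : Fin N) (i j : Fin (alpha P n)) : ℕ :=
  if i < j then inst P n j - inst P n i else inst P n j + K - inst P n i

/-! ### The transmission process -/

/-- `S k` is the service time of the `k`-th transmission and `X k` tells whether it succeeds.
The service times are independent, those of source `m` having law `ν m`; a packet of source `m`
is dropped with probability `p m`, independently of all other drops and of all service times. -/
structure IsTransmissionProcess {N K : ℕ} [NeZero K] {Ω : Type*} [MeasurableSpace Ω]
    (P : Fin K → Fin N) (ν : Fin N → Measure ℝ) (p : Fin N → ℝ) (μ : Measure Ω)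
    (S : ℕ → Ω → ℝ) (X : ℕ → Ω → Bool) : Prop where
  measurable_service : ∀ k, Measurable (S k)
  measurable_success : ∀ k, Measurable (X k)
  law_service : ∀ k, μ.map (S k) = ν (src P k)
  prob_drop : ∀ k, μ.real {ω | X k ω = false} = p (src P k)
  indep_service : iIndepFun S μ
  indep_success : iIndepFun X μ
  indep_service_success : IndepFun (fun ω k => S k ω) (fun ω k => X k ω) μ

/-- The time at which the `k`-th transmission starts (there is no idling); its packet is generated
at that time, and it is delivered, if not dropped, at time `startTime S (k + 1)`. -/
def startTime {Ω : Type*} (S : ℕ → Ω → ℝ) (k : ℕ) (ω : Ω) : ℝ :=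
  ∑ l ∈ Finset.range k, S l ω

/-- The `k`-th transmission is a successful transmission of source `n`. -/
def Received {N K : ℕ} [NeZero K] {Ω : Type*} (P : Fin K → Fin N) (n : Fin N)
    (X : ℕ → Ω → Bool) (ω : Ω) (k : ℕ) : Prop :=
  src P k = n ∧ X k ω = true

/-- The generation time of the freshest update of source `n` that is available at time `t`;
`δ₀` is the age at time `0`. -/
def freshest {N K : ℕ} [NeZero K] {Ω : Type*} (P : Fin K → Fin N) (n : Fin N)
    (S : ℕ → Ω → ℝ) (X : ℕ → Ω → Bool) (δ₀ : Ω → ℝ) (ω : Ω) (t : ℝ) : ℝ :=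
  sSup {g | g = -δ₀ ω ∨
    ∃ k, Received P n X ω k ∧ startTime S (k + 1) ω ≤ t ∧ g = startTime S k ω}

/-- The age of information of source `n` at time `t`. -/
def age {N K : ℕ} [NeZero K] {Ω : Type*} (P : Fin K → Fin N) (n : Fin N)
    (S : ℕ → Ω → ℝ) (X : ℕ → Ω → Bool) (δ₀ : Ω → ℝ) (ω : Ω) (t : ℝ) : ℝ :=
  t - freshest P n S X δ₀ ω t

/-- `x` is the mean of the age path `f`: the long-run time average of `f` exists and equals `x`. -/
def HasTimeAverage (f : ℝ → ℝ) (x : ℝ) : Prop :=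
  (∀ T : ℝ, 0 ≤ T → IntervalIntegrable f volume 0 T) ∧
    Tendsto (fun T : ℝ => (∫ t in (0 : ℝ)..T, f t) / T) atTop (𝓝 x)

/-! ### The cycles between consecutive successes -/

/-- The number of the transmission that is the `k`-th success of source `n` (`k = 0, 1, …`). -/
def successIndex {N K : ℕ} [NeZero K] {Ω : Type*} (P : Fin K → Fin N) (n : Fin N)
    (X : ℕ → Ω → Bool) (k : ℕ) (ω : Ω) : ℕ :=
  Nat.nth (Received P n X ω) k

/-- The `k`-th cycle is in state `(i, j)`: it starts with a success at the `i`-th and ends with a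
success at the `j`-th scheduling instance of source `n` relative to the pattern. -/
def InState {N K : ℕ} [NeZero K] {Ω : Type*} (P : Fin K → Fin N) (n : Fin N)
    (X : ℕ → Ω → Bool) (k : ℕ) (y : Fin (alpha P n) × Fin (alpha P n)) (ω : Ω) : Prop :=
  successIndex P n X k ω % K = inst P n y.1 ∧ successIndex P n X (k + 1) ω % K = inst P n y.2

/-- The number `M` of complete rounds of the pattern that elapse in the `k`-th cycle before the
round in which the next success occurs. -/
def cycleRounds {N K : ℕ} [NeZero K] {Ω : Type*} (P : Fin K → Fin N) (n : Fin N)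
    (X : ℕ → Ω → Bool) (k : ℕ) (ω : Ω) : ℕ :=
  (successIndex P n X (k + 1) ω - successIndex P n X k ω - 1) / K

/-- The time from the end of the `M` complete rounds of the `k`-th cycle to the age drop that ends
the cycle. -/
def cyclePartial {N K : ℕ} [NeZero K] {Ω : Type*} (P : Fin K → Fin N) (n : Fin N)
    (S : ℕ → Ω → ℝ) (X : ℕ → Ω → Bool) (k : ℕ) (ω : Ω) : ℝ :=
  startTime S (successIndex P n X (k + 1) ω + 1) ω -
    startTime S (successIndex P n X k ω + 1 + cycleRounds P n X k ω * K) ω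

/-- The duration of the `k`-th cycle. -/
def cycleTime {N K : ℕ} [NeZero K] {Ω : Type*} (P : Fin K → Fin N) (n : Fin N)
    (S : ℕ → Ω → ℝ) (X : ℕ → Ω → Bool) (k : ℕ) (ω : Ω) : ℝ :=
  startTime S (successIndex P n X (k + 1) ω + 1) ω -
    startTime S (successIndex P n X k ω + 1) ω

/-- The area under the age curve over the `k`-th cycle. -/
def cycleArea {N K : ℕ} [NeZero K] {Ω : Type*} (P : Fin K → Fin N) (n : Fin N)
    (S : ℕ → Ω → ℝ) (X : ℕ → Ω → Bool) (δ₀ : Ω → ℝ) (k : ℕ) (ω : Ω) : ℝ :=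
  ∫ t in (startTime S (successIndex P n X k ω + 1) ω)..
    (startTime S (successIndex P n X (k + 1) ω + 1) ω), age P n S X δ₀ ω t

/-! ### The Markov chain -/

/-- `p_{i,j}`: the probability that a success at instance `i` is followed by one at instance `j`,
where `a` is the number of instances and `p` the drop probability. -/
def transProb (a : ℕ) (p : ℝ) (i j : Fin a) : ℝ :=
  if i < j then (1 - p) * p ^ ((j : ℕ) - i - 1) / (1 - p ^ a)
  else (1 - p) * p ^ ((j : ℕ) + a - i - 1) / (1 - p ^ a)

/-- The transition matrix on the `a ^ 2` states: `(i, j)` is accessible only from the states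
`(k, i)`, with probability `p_{i,j}`. -/
def chainMatrix (a : ℕ) (p : ℝ) : Matrix (Fin a × Fin a) (Fin a × Fin a) ℝ :=
  fun x y => if y.1 = x.2 then transProb a p y.1 y.2 else 0

/-- `π_{i,j} = p_{i,j} / a`, as a vector indexed by the states. -/
def statDist (a : ℕ) (p : ℝ) (y : Fin a × Fin a) : ℝ :=
  transProb a p y.1 y.2 / a

/-! ### Moments -/

/-- The probability that `M = m`, where `M + 1` is geometric with failure probability `p ^ a`. -/
def roundsProb (a : ℕ) (p : ℝ) (m : ℕ) : ℝ :=
  (1 - p ^ a) * (p ^ a) ^ m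

/-- `E[M]`. -/
def roundsMean (a : ℕ) (p : ℝ) : ℝ :=
  ∑' m : ℕ, (m : ℝ) * roundsProb a p m

/-- `E[M ^ 2]`. -/
def roundsSecond (a : ℕ) (p : ℝ) : ℝ :=
  ∑' m : ℕ, (m : ℝ) ^ 2 * roundsProb a p m

/-- The mean service time `s_m` of source `m`. -/
def serviceMean {N : ℕ} (ν : Fin N → Measure ℝ) (m : Fin N) : ℝ :=
  ∫ x, x ∂(ν m)

/-- The variance `v_m` of the service time of source `m`. -/
def serviceVar {N : ℕ} (ν : Fin N → Measure ℝ) (m : Fin N) : ℝ :=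
  (∫ x, x ^ 2 ∂(ν m)) - serviceMean ν m ^ 2

/-- The mean `∑ α_m s_m` of the duration of a round. -/
def patternMean {N K : ℕ} (P : Fin K → Fin N) (ν : Fin N → Measure ℝ) : ℝ :=
  ∑ m, (alpha P m : ℝ) * serviceMean ν m

/-- The variance `∑ α_m v_m` of the duration of a round. -/
def patternVar {N K : ℕ} (P : Fin K → Fin N) (ν : Fin N → Measure ℝ) : ℝ :=
  ∑ m, (alpha P m : ℝ) * serviceVar ν m

/-- `Z_{i,j}`: the total service time of the transmissions from just after the `i`-th instance of
source `n` up to and including the next occurrence of its `j`-th instance. -/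
def partialDuration {N K : ℕ} {Ω : Type*} (P : Fin K → Fin N) (n : Fin N) (S : ℕ → Ω → ℝ)
    (i j : Fin (alpha P n)) (ω : Ω) : ℝ :=
  ∑ l ∈ Finset.Ioc (inst P n i) (inst P n i + windowLength P n i j), S l ω

/-- `E[Z_{i,j}]`. -/
def partialMean {N K : ℕ} {Ω : Type*} [MeasurableSpace Ω] (P : Fin K → Fin N) (n : Fin N)
    (μ : Measure Ω) (S : ℕ → Ω → ℝ) (i j : Fin (alpha P n)) : ℝ :=
  ∫ ω, partialDuration P n S i j ω ∂μ

/-- `E[Z_{i,j} ^ 2]`. -/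
def partialSecond {N K : ℕ} {Ω : Type*} [MeasurableSpace Ω] (P : Fin K → Fin N) (n : Fin N)
    (μ : Measure Ω) (S : ℕ → Ω → ℝ) (i j : Fin (alpha P n)) : ℝ :=
  ∫ ω, partialDuration P n S i j ω ^ 2 ∂μ

end

end CyclicAoI

set_option linter.unusedSectionVars false

namespace CyclicAoI

/-! ### Positions in the cyclic pattern and the law of the first reception -/

section Pattern

variable {N K : ℕ} [NeZero K] (P : Fin K → Fin N) (n : Fin N)

/-! The drops alone decide where the successes of source `n` fall, and the service times are
independent of the drops. From a success at instance i, the number of instances up to the next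
success is geometric. Write it as d + αM with 1 ≤ d ≤ α: the weight (1 - p) p^(d - 1 + αM) factors
into p_{i,j} times Pr(M), where j is the instance at distance d. So the final instance and the
number of complete rounds are independent of each other (`hitProb_window`) and, given i, of the
history (`prob_history_window`). This yields the Markov chain and the law of M. The matrix (p_{i,j})
is circulant, hence doubly stochastic, which explains the uniform first marginal of the stationary
law.

Conditioning on the state of a cycle concerns the drops only and leaves the law of the service times
unchanged (`map_cond_inState`). The moments of a cycle then follow from Fubini. A cycle of duration
T that starts with a success of service time s has area T²/2 + T s (`cycleArea_eq`), and T and s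
come from disjoint sets of transmissions.

The time average does not pass through an ergodic theorem for the chain. Let τ_l and a_l be the
expected time and area (with age 0 at the start) from transmission l to the end of the next
reception; both are periodic in l. If A_l is the age at the start of transmission l, then a_l + A_l
τ_l is the expected area up to that reception. One-step analysis writes the accumulated area as a
sum of martingale differences, plus fluctuations of squared service times, plus a telescoping
boundary term, plus a periodic drift that is the expected area of a fresh cycle times the
probability of a reception (`sum_area_eq`). The martingale part is negligible by Rajchman's strong
law (`ae_tendsto_average_of_uncorrelated`), since the second moment of the age stays bounded
(`exists_bound_of_recursion`). The squared service times obey the classical strong law on each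
residue class modulo K. The drift averages to its mean over one period. Dividing by the mean time
per transmission gives the mean age (`ae_hasTimeAverage_age`).

The value is identified by summing the first-reception series over pairs (j, M): after a slot of
source `n`, τ is ∑_j p_{i,j} E[T_{i,j}], and a + s_n τ is ∑_j p_{i,j} E[A_{i,j}]. Summing the
recursion of τ over a period evaluates the denominator (`sum_timePotential`). -/

theorem src_mod (k : ℕ) : src P (k % K) = src P k := by
  simp [src, Fin.ofNat]

theorem src_add_period (k : ℕ) : src P (k + K) = src P k := by
  simp [src, Fin.ofNat]

theorem src_add_mul_period (k x : ℕ) : src P (k + K * x) = src P k := by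
  simp [src, Fin.ofNat]

theorem inst_lt (i : Fin (alpha P n)) : inst P n i < K :=
  ((slots P n).orderEmbOfFin rfl i).2

theorem inst_mod (i : Fin (alpha P n)) : inst P n i % K = inst P n i :=
  Nat.mod_eq_of_lt (inst_lt P n i)

theorem src_inst (i : Fin (alpha P n)) : src P (inst P n i) = n := by
  have h : (slots P n).orderEmbOfFin rfl i ∈ Finset.univ.filter fun k => P k = n :=
    (slots P n).orderEmbOfFin_mem rfl i
  have h' := (Finset.mem_filter.1 h).2
  unfold src inst
  rw [Fin.ofNat_val_eq_self]
  exact h'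

theorem inst_lt_inst {i j : Fin (alpha P n)} : inst P n i < inst P n j ↔ i < j := by
  exact ((slots P n).orderEmbOfFin rfl).lt_iff_lt (a := i) (b := j)

theorem inst_injective : Function.Injective (inst P n) := by
  intro i j h
  by_contra hij
  rcases lt_or_gt_of_ne hij with h' | h' <;> have := (inst_lt_inst P n).2 h' <;> omega

variable {P n}

theorem exists_inst {k : ℕ} (hk : src P k = n) : ∃ i, k % K = inst P n i := by
  have hmem : Fin.ofNat K k ∈ slots P n := by
    simpa [slots, src] using hk
  have : Fin.ofNat K k ∈ Set.range ((slots P n).orderEmbOfFin rfl) := by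
    rw [Finset.range_orderEmbOfFin]; exact hmem
  obtain ⟨i, hi⟩ := this
  exact ⟨i, by unfold inst; rw [hi]; simp [Fin.ofNat]⟩

theorem src_eq_of_mod {k : ℕ} {i : Fin (alpha P n)} (hk : k % K = inst P n i) : src P k = n := by
  rw [← src_mod, hk, src_inst]

theorem alpha_pos (hn : ∃ k, P k = n) : 0 < alpha P n := by
  obtain ⟨k, hk⟩ := hn
  exact Finset.card_pos.2 ⟨k, by simp [slots, hk]⟩

theorem exists_src (hn : ∃ k, P k = n) : ∃ k < K, src P k = n := by
  obtain ⟨k, hk⟩ := hn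
  exact ⟨k, k.2, by simpa [src] using hk⟩

variable (P n)

theorem sum_range_src {M : Type*} [AddCommMonoid M] (f : Fin N → M) :
    ∑ l ∈ Finset.range K, f (src P l) = ∑ m, alpha P m • f m := by
  have h1 : ∑ l ∈ Finset.range K, f (src P l) = ∑ k : Fin K, f (P k) := by
    rw [Finset.sum_range]
    refine Finset.sum_congr rfl fun k _ => ?_
    simp [src]
  rw [h1, ← Finset.sum_fiberwise_of_maps_to (t := Finset.univ) (g := P) (by simp)]
  refine Finset.sum_congr rfl fun m _ => ?_
  rw [Finset.sum_congr rfl (g := fun _ => f m) (by simp +contextual)]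
  simp [alpha, slots]

/-- Sliding the window by one place replaces the term at q by the equal term at q + K. -/
theorem sum_range_period {M : Type*} [AddCommGroup M] (f : ℕ → M) (hf : ∀ l, f (l + K) = f l)
    (q : ℕ) : ∑ l ∈ Finset.range K, f (q + l) = ∑ l ∈ Finset.range K, f l := by
  induction q with
  | zero => simp
  | succ q ih =>
    rw [← ih]
    have h1 := Finset.sum_range_succ (fun l => f (q + l)) K
    have h2 := Finset.sum_range_succ' (fun l => f (q + l)) K
    rw [h1] at h2
    have h3 : f (q + K) = f (q + 0) := by rw [hf, add_zero]
    rw [h3] at h2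
    have h4 := add_right_cancel h2
    rw [h4]
    exact Finset.sum_congr rfl fun l _ => by congr 1; omega

/-- The number of transmissions of source `n` among the first `k` transmissions. -/
def slotCount (k : ℕ) : ℕ := Nat.count (fun l => src P l = n) k

theorem slotCount_inst (i : Fin (alpha P n)) : slotCount P n (inst P n i) = i := by
  unfold slotCount
  rw [Nat.count_eq_card_filter_range]
  have : (Finset.range (inst P n i)).filter (fun l => src P l = n) =
      (Finset.Iio i).image (inst P n) := by
    ext l
    simp only [Finset.mem_filter, Finset.mem_range, Finset.mem_image, Finset.mem_Iio]
    constructor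
    · rintro ⟨hl, hs⟩
      obtain ⟨j, hj⟩ := exists_inst hs
      have := inst_lt P n i
      rw [Nat.mod_eq_of_lt (by omega)] at hj
      exact ⟨j, (inst_lt_inst P n).1 (by omega), hj.symm⟩
    · rintro ⟨j, hj, rfl⟩
      exact ⟨(inst_lt_inst P n).2 hj, src_inst P n j⟩
  rw [this, Finset.card_image_of_injective _ (inst_injective P n), Fin.card_Iio]

theorem slotCount_period : slotCount P n K = alpha P n := by
  unfold slotCount
  rw [Nat.count_eq_card_filter_range, Finset.card_filter,
    sum_range_src P (fun m => if m = n then 1 else 0)]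
  simp

theorem slotCount_add_period (k : ℕ) :
    slotCount P n (k + K) = slotCount P n k + alpha P n := by
  rw [← slotCount_period P n, add_comm k K, add_comm (slotCount P n k)]
  unfold slotCount
  rw [Nat.count_add]
  congr 2
  funext l
  rw [add_comm K l, src_add_period]

theorem slotCount_add_mul_period (k x : ℕ) :
    slotCount P n (k + K * x) = slotCount P n k + alpha P n * x := by
  induction x with
  | zero => simp
  | succ x ih => rw [mul_add, mul_one, ← add_assoc, slotCount_add_period, ih]; ring

variable {P n}

theorem slotCount_of_mod {a : ℕ} {i : Fin (alpha P n)} (ha : a % K = inst P n i) :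
    slotCount P n a = i + alpha P n * (a / K) := by
  conv_lhs => rw [← Nat.mod_add_div a K, ha]
  rw [slotCount_add_mul_period, slotCount_inst]

theorem windowLength_pos (i j : Fin (alpha P n)) : 0 < windowLength P n i j := by
  unfold windowLength
  have := inst_lt P n i
  split_ifs with h
  · have := (inst_lt_inst P n).2 h; omega
  · omega

theorem windowLength_le (i j : Fin (alpha P n)) : windowLength P n i j ≤ K := by
  unfold windowLength
  have := inst_lt P n i
  have := inst_lt P n j
  split_ifs with h
  · omega
  · have : inst P n j ≤ inst P n i := by
      by_contra h'; exact h ((inst_lt_inst P n).1 (by omega))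
    omega

/-- The number of instances of source `n` from just after instance `i` up to and including the
next occurrence of instance `j`. -/
def instDist {a : ℕ} (i j : Fin a) : ℕ := if i < j then (j : ℕ) - i else j + a - i

theorem instDist_pos {a : ℕ} (i j : Fin a) : 0 < instDist i j := by
  unfold instDist
  split_ifs with h
  · have : (i : ℕ) < j := h
    omega
  · omega

theorem transProb_eq {a : ℕ} (p : ℝ) (i j : Fin a) :
    transProb a p i j = (1 - p) * p ^ (instDist i j - 1) / (1 - p ^ a) := by
  unfold transProb instDist
  split_ifs <;> rfl

/-- Position of the next occurrences of instance `j` after an occurrence of instance `i`. -/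
theorem add_window_mod {a : ℕ} {i : Fin (alpha P n)} (ha : a % K = inst P n i)
    (j : Fin (alpha P n)) (M : ℕ) :
    (a + windowLength P n i j + M * K) % K = inst P n j := by
  have hi := inst_lt P n i
  have hj := inst_lt P n j
  rw [Nat.add_mul_mod_self_right]
  have h1 : a = inst P n i + K * (a / K) := by rw [← ha, Nat.mod_add_div]
  unfold windowLength
  split_ifs with h
  · have := (inst_lt_inst P n).2 h
    have : a + (inst P n j - inst P n i) = inst P n j + K * (a / K) := by omega
    rw [this, Nat.add_mul_mod_self_left, inst_mod]
  · have : a + (inst P n j + K - inst P n i) = inst P n j + K * (a / K + 1) := by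
      rw [mul_add]; omega
    rw [this, Nat.add_mul_mod_self_left, inst_mod]

/-- The division is applied to b - a - 1 because window lengths run through 1, …, K and not 0, …, K
- 1: when i = j the last whole round belongs to the window and is not counted among the complete
rounds. -/
theorem exists_rounds {a b : ℕ} {i j : Fin (alpha P n)} (ha : a % K = inst P n i)
    (hb : b % K = inst P n j) (hab : a < b) :
    b = a + windowLength P n i j + (b - a - 1) / K * K := by
  have hK : 0 < K := Nat.pos_of_ne_zero (NeZero.ne K)
  have hw := windowLength_pos i j
  have hw' := windowLength_le i j
  have hmod := add_window_mod ha j 0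
  simp only [zero_mul, add_zero] at hmod
  have h1 : (b - a - 1) % K = windowLength P n i j - 1 := by
    have e : (a + 1 + (b - a - 1)) ≡ (a + 1 + (windowLength P n i j - 1)) [MOD K] := by
      unfold Nat.ModEq
      rw [show a + 1 + (b - a - 1) = b by omega,
        show a + 1 + (windowLength P n i j - 1) = a + windowLength P n i j by omega, hb, hmod]
    have := Nat.ModEq.add_left_cancel' _ e
    unfold Nat.ModEq at this
    rw [this, Nat.mod_eq_of_lt (by omega)]
  have h2 := Nat.mod_add_div (b - a - 1) K
  rw [h1, mul_comm] at h2
  omega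

theorem rounds_eq (i j : Fin (alpha P n)) (a M : ℕ) :
    (a + windowLength P n i j + M * K - a - 1) / K = M := by
  have hK : 0 < K := Nat.pos_of_ne_zero (NeZero.ne K)
  have hw := windowLength_pos i j
  have hw' := windowLength_le i j
  rw [show a + windowLength P n i j + M * K - a - 1 = (windowLength P n i j - 1) + M * K by omega,
    Nat.add_mul_div_right _ _ hK, Nat.div_eq_of_lt (by omega), zero_add]

/-- Converts distances counted in transmissions into distances counted in instances of source `n`.
The exponent of the drop probability in the law of the next success is read off from it. -/
theorem slotCount_window {a : ℕ} {i : Fin (alpha P n)} (ha : a % K = inst P n i)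
    (j : Fin (alpha P n)) (M : ℕ) :
    slotCount P n (a + windowLength P n i j + M * K) =
      slotCount P n a + instDist i j + alpha P n * M := by
  have hi := inst_lt P n i
  have hai := slotCount_of_mod ha
  have h1 : a = inst P n i + K * (a / K) := by rw [← ha, Nat.mod_add_div]
  rw [mul_comm M K, slotCount_add_mul_period, hai]
  congr 1
  unfold windowLength instDist
  split_ifs with h
  · have h2 := (inst_lt_inst P n).2 h
    have h3 : (i : ℕ) < j := h
    rw [show a + (inst P n j - inst P n i) = inst P n j + K * (a / K) by omega,
      slotCount_add_mul_period, slotCount_inst]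
    omega
  · rw [show a + (inst P n j + K - inst P n i) = inst P n j + K * (a / K + 1) by
      rw [mul_add]; omega, slotCount_add_mul_period, slotCount_inst, mul_add]
    omega

/-! ### Weights of the first reception -/

variable (P n)

/-- The probability that transmission `l` does not deliver an update of source `n`. -/
noncomputable def failProb (p : ℝ) (l : ℕ) : ℝ := if src P l = n then p else 1

/-- The probability that the first reception from transmission `l` on is at `l + m`. -/
noncomputable def hitProb (p : ℝ) (l m : ℕ) : ℝ :=
  (∏ j ∈ Finset.range m, failProb P n p (l + j)) * (1 - failProb P n p (l + m))

variable {P n} {p : ℝ}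

theorem failProb_period (l : ℕ) : failProb P n p (l + K) = failProb P n p l := by
  simp [failProb, src_add_period]

theorem failProb_nonneg (hp : 0 ≤ p) (l : ℕ) : 0 ≤ failProb P n p l := by
  unfold failProb; split_ifs <;> simp [hp]

theorem failProb_le_one (hp : p ≤ 1) (l : ℕ) : failProb P n p l ≤ 1 := by
  unfold failProb; split_ifs <;> simp [hp]

theorem hitProb_zero (l : ℕ) : hitProb P n p l 0 = 1 - failProb P n p l := by
  simp [hitProb]

theorem hitProb_succ (l m : ℕ) :
    hitProb P n p l (m + 1) = failProb P n p l * hitProb P n p (l + 1) m := by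
  unfold hitProb
  rw [Finset.prod_range_succ']
  simp only [add_zero, add_assoc, add_comm 1]
  ring

theorem hitProb_period (l m : ℕ) : hitProb P n p (l + K) m = hitProb P n p l m := by
  unfold hitProb
  have (j : ℕ) : failProb P n p (l + K + j) = failProb P n p (l + j) := by
    rw [add_right_comm, failProb_period]
  simp only [this]

theorem hitProb_nonneg (hp : 0 ≤ p) (hp' : p ≤ 1) (l m : ℕ) : 0 ≤ hitProb P n p l m :=
  mul_nonneg (Finset.prod_nonneg fun _ _ => failProb_nonneg hp _)
    (sub_nonneg.2 (failProb_le_one hp' _))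

theorem hitProb_eq_zero {l m : ℕ} (h : src P (l + m) ≠ n) : hitProb P n p l m = 0 := by
  simp [hitProb, failProb, h]

theorem prod_failProb (l m : ℕ) : ∏ j ∈ Finset.range m, failProb P n p (l + j) =
    p ^ (slotCount P n (l + m) - slotCount P n l) := by
  have h : slotCount P n (l + m) - slotCount P n l = Nat.count (fun j => src P (l + j) = n) m := by
    unfold slotCount
    rw [Nat.count_add, add_tsub_cancel_left]
  rw [h, Nat.count_eq_card_filter_range, ← Finset.prod_const, Finset.prod_filter]
  rfl

/-- The central factorization. Between the two successes there are d - 1 + αM failed instances,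
where d = `instDist i j`, and p^(d - 1 + αM) (1 - p) splits into a factor in d and a factor in M.
The normalization 1 - p^α cancels between the two. -/
theorem hitProb_window (ha : p ^ alpha P n ≠ 1) {a : ℕ} {i : Fin (alpha P n)}
    (hai : a % K = inst P n i) (j : Fin (alpha P n)) (M : ℕ) :
    hitProb P n p (a + 1) (windowLength P n i j - 1 + M * K) =
      transProb (alpha P n) p i j * roundsProb (alpha P n) p M := by
  have hw := windowLength_pos i j
  have hd := instDist_pos i j
  have hb : src P (a + 1 + (windowLength P n i j - 1 + M * K)) = n := by
    rw [show a + 1 + (windowLength P n i j - 1 + M * K) = a + windowLength P n i j + M * K by omega]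
    exact src_eq_of_mod (add_window_mod hai j M)
  have h1 : slotCount P n (a + 1) = slotCount P n a + 1 := by
    unfold slotCount
    rw [Nat.count_succ, if_pos (src_eq_of_mod hai)]
  unfold hitProb
  rw [prod_failProb, failProb, if_pos hb, h1,
    show a + 1 + (windowLength P n i j - 1 + M * K) = a + windowLength P n i j + M * K by omega,
    slotCount_window hai, transProb_eq, roundsProb,
    show slotCount P n a + instDist i j + alpha P n * M - (slotCount P n a + 1) =
      (instDist i j - 1) + alpha P n * M by omega, pow_add, pow_mul]
  have : 1 - p ^ alpha P n ≠ 0 := sub_ne_zero.2 (Ne.symm ha)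
  field_simp

/-- Regrouping a sum over the first reception by the instance and the number of rounds. -/
theorem hasSum_hitProb_iff (ha : p ^ alpha P n ≠ 1) {a : ℕ} {i : Fin (alpha P n)}
    (hai : a % K = inst P n i) (f : ℕ → ℝ) (c : ℝ) :
    HasSum (fun x : Fin (alpha P n) × ℕ => transProb (alpha P n) p i x.1 *
      roundsProb (alpha P n) p x.2 * f (windowLength P n i x.1 - 1 + x.2 * K)) c ↔
    HasSum (fun m => hitProb P n p (a + 1) m * f m) c := by
  have hK : 0 < K := Nat.pos_of_ne_zero (NeZero.ne K)
  -- Offsets are counted from transmission a + 1, the first after the success at a; hence the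
  -- subtraction of 1.
  let g : Fin (alpha P n) × ℕ → ℕ := fun x => windowLength P n i x.1 - 1 + x.2 * K
  have hg1 (x : Fin (alpha P n) × ℕ) : a + 1 + g x = a + windowLength P n i x.1 + x.2 * K := by
    have := windowLength_pos i x.1
    simp only [g]; omega
  have hg : Function.Injective g := by
    intro x y hxy
    have h1 := add_window_mod hai x.1 x.2
    have h2 := add_window_mod hai y.1 y.2
    have h3 := rounds_eq i x.1 a x.2
    have h4 := rounds_eq i y.1 a y.2
    rw [← hg1, hxy] at h1 h3
    rw [← hg1] at h2 h4
    exact Prod.ext (inst_injective P n (h1.symm.trans h2)) (h3.symm.trans h4)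
  rw [← hg.hasSum_iff]
  · refine iff_of_eq ?_
    congr 1
    funext x
    simp only [Function.comp, g]
    rw [hitProb_window ha hai]
  -- An offset outside the range of `g` does not hit a slot of source `n`, so its weight vanishes.
  · intro m hm
    rw [hitProb_eq_zero, zero_mul]
    intro hs
    obtain ⟨j, hj⟩ := exists_inst hs
    refine hm ⟨(j, (a + 1 + m - a - 1) / K), ?_⟩
    have h1 := exists_rounds hai hj (by omega)
    have h2 := hg1 (j, (a + 1 + m - a - 1) / K)
    simp only at h2
    omega

end Pattern

theorem hasSum_of_eq {ι : Type*} {f g : ι → ℝ} {a b : ℝ} (h : HasSum f a)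
    (hfg : ∀ m, g m = f m) (hab : b = a) : HasSum g b := by
  rw [funext hfg, hab]; exact h

theorem hasSum_of_succ {f : ℕ → ℝ} {c : ℝ} (h : HasSum (fun m => f (m + 1)) c) :
    HasSum f (f 0 + c) := by
  rw [← hasSum_nat_add_iff' 1]
  simpa using h

/-! ### The transition matrix, its stationary law and the moments of the number of rounds -/

section Chain

variable {a : ℕ} {p : ℝ}

theorem instDist_le (i j : Fin a) : instDist i j ≤ a := by
  unfold instDist
  split_ifs with h
  · omega
  · have : (j : ℕ) ≤ i := not_lt.1 h
    omega

theorem mod_eq_or {x a : ℕ} (h : x < 2 * a) : (x < a ∧ x % a = x) ∨ (a ≤ x ∧ x % a = x - a) := by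
  rcases lt_or_ge x a with h' | h'
  · exact Or.inl ⟨h', Nat.mod_eq_of_lt h'⟩
  · refine Or.inr ⟨h', ?_⟩
    rw [Nat.mod_eq_sub_mod h', Nat.mod_eq_of_lt (by omega)]

/-- For fixed i the map from j to `instDist i j - 1` is a bijection onto {0, …, a - 1}, with inverse
e ↦ i + 1 + e modulo a. This is the circulant structure of the transition probabilities, along rows.
-/
theorem sum_instDist_right (g : ℕ → ℝ) (f : ℕ → ℝ) (i : Fin a) :
    ∑ j : Fin a, g (instDist i j - 1) * f j =
      ∑ e ∈ Finset.range a, g e * f ((i + 1 + e) % a) := by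
  have ha : 0 < a := i.pos
  refine Finset.sum_bij' (fun j _ => instDist i j - 1)
    (fun e _ => ⟨(i + 1 + e) % a, Nat.mod_lt _ ha⟩) ?_ ?_ ?_ ?_ ?_
  · intro j _
    have := instDist_le i j
    have := instDist_pos i j
    simp only [Finset.mem_range]; omega
  · simp
  · intro j _
    refine Fin.ext ?_
    have hi := i.2
    have hj := j.2
    simp only [instDist, Fin.lt_def]
    split_ifs with h
    · rw [show (i : ℕ) + 1 + (j - i - 1) = j by omega, Nat.mod_eq_of_lt hj]
    · rw [show (i : ℕ) + 1 + (j + a - i - 1) = j + a by omega, Nat.add_mod_right,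
        Nat.mod_eq_of_lt hj]
  · intro e he
    rw [Finset.mem_range] at he
    have hi := i.2
    simp only [instDist, Fin.lt_def]
    rcases mod_eq_or (x := (i : ℕ) + 1 + e) (a := a) (by omega) with h | h <;>
      rw [h.2] <;> split_ifs <;> omega
  · intro j _
    congr 2
    have hi := i.2
    have hj := j.2
    simp only [instDist, Fin.lt_def]
    split_ifs with h
    · rw [show (i : ℕ) + 1 + (j - i - 1) = j by omega, Nat.mod_eq_of_lt hj]
    · rw [show (i : ℕ) + 1 + (j + a - i - 1) = j + a by omega, Nat.add_mod_right,
        Nat.mod_eq_of_lt hj]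

/-- The circulant structure along columns: the inverse is e ↦ j - 1 - e modulo a, with a added so
that the natural subtraction does not truncate. Together with the row version it makes the
transition probabilities doubly stochastic. -/
theorem sum_instDist_left (g : ℕ → ℝ) (f : ℕ → ℝ) (j : Fin a) :
    ∑ i : Fin a, g (instDist i j - 1) * f i =
      ∑ e ∈ Finset.range a, g e * f ((j + a - 1 - e) % a) := by
  have ha : 0 < a := j.pos
  have key (i : Fin a) : (j + a - 1 - (instDist i j - 1)) % a = i := by
    have hi := i.2
    have hj := j.2
    simp only [instDist, Fin.lt_def]
    split_ifs with h
    · rw [show (j : ℕ) + a - 1 - (j - i - 1) = i + a by omega, Nat.add_mod_right,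
        Nat.mod_eq_of_lt hi]
    · rw [show (j : ℕ) + a - 1 - (j + a - i - 1) = i by omega, Nat.mod_eq_of_lt hi]
  refine Finset.sum_bij' (fun i _ => instDist i j - 1)
    (fun e _ => ⟨(j + a - 1 - e) % a, Nat.mod_lt _ ha⟩) ?_ ?_ ?_ ?_ ?_
  · intro i _
    have := instDist_le i j
    have := instDist_pos i j
    simp only [Finset.mem_range]; omega
  · simp
  · exact fun i _ => Fin.ext (key i)
  · intro e he
    rw [Finset.mem_range] at he
    have hj := j.2
    simp only [instDist, Fin.lt_def]
    rcases mod_eq_or (x := (j : ℕ) + a - 1 - e) (a := a) (by omega) with h | h <;>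
      rw [h.2] <;> split_ifs <;> omega
  · intro i _
    rw [key]

theorem one_sub_pow_pos (hp : 0 ≤ p) (hp' : p < 1) (ha : 0 < a) : 0 < 1 - p ^ a :=
  sub_pos.2 (pow_lt_one₀ hp hp' ha.ne')

theorem transProb_nonneg (hp : 0 ≤ p) (hp' : p < 1) (i j : Fin a) : 0 ≤ transProb a p i j := by
  rw [transProb_eq]
  have := one_sub_pow_pos hp hp' i.pos
  have : 0 < 1 - p := by linarith
  positivity

theorem transProb_pos (hp : 0 < p) (hp' : p < 1) (i j : Fin a) : 0 < transProb a p i j := by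
  rw [transProb_eq]
  have := one_sub_pow_pos hp.le hp' i.pos
  have : 0 < 1 - p := by linarith
  positivity

theorem sum_geom_weights (hp : 0 ≤ p) (hp' : p < 1) (ha : 0 < a) :
    ∑ e ∈ Finset.range a, (1 - p) * p ^ e / (1 - p ^ a) = 1 := by
  have h := one_sub_pow_pos hp hp' ha
  rw [← Finset.sum_div, ← Finset.mul_sum, mul_neg_geom_sum, div_self h.ne']

theorem sum_transProb (hp : 0 ≤ p) (hp' : p < 1) (i : Fin a) :
    ∑ j, transProb a p i j = 1 := by
  have h := sum_instDist_right (fun e => (1 - p) * p ^ e / (1 - p ^ a)) (fun _ => 1) i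
  simp only [mul_one] at h
  simp only [transProb_eq]
  rw [h, sum_geom_weights hp hp' i.pos]

theorem sum_transProb_left (hp : 0 ≤ p) (hp' : p < 1) (j : Fin a) :
    ∑ i, transProb a p i j = 1 := by
  have h := sum_instDist_left (fun e => (1 - p) * p ^ e / (1 - p ^ a)) (fun _ => 1) j
  simp only [mul_one] at h
  simp only [transProb_eq]
  rw [h, sum_geom_weights hp hp' j.pos]

theorem sum_chainMatrix (x : Fin a × Fin a) (f : Fin a × Fin a → ℝ) :
    ∑ y, chainMatrix a p x y * f y = ∑ j, transProb a p x.2 j * f (x.2, j) := by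
  simp [chainMatrix, Fintype.sum_prod_type, ite_mul]

theorem chainMatrix_nonneg (hp : 0 ≤ p) (hp' : p < 1) (x y : Fin a × Fin a) :
    0 ≤ chainMatrix a p x y := by
  unfold chainMatrix
  split_ifs
  · exact transProb_nonneg hp hp' _ _
  · exact le_rfl

theorem chainMatrix_mem_rowStochastic (hp : 0 ≤ p) (hp' : p < 1) :
    chainMatrix a p ∈ rowStochastic ℝ (Fin a × Fin a) := by
  rw [mem_rowStochastic]
  refine ⟨chainMatrix_nonneg hp hp', ?_⟩
  funext x
  have := sum_chainMatrix (p := p) x (fun _ => 1)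
  simp only [mul_one, sum_transProb hp hp'] at this
  simpa [mulVec, dotProduct] using this

/-- Two steps suffice: from x the chain can pass through (x.2, y.1) to y, and all transition
probabilities are positive. -/
theorem chainMatrix_isPrimitive (hp : 0 < p) (hp' : p < 1) : (chainMatrix a p).IsPrimitive := by
  refine ⟨chainMatrix_nonneg hp.le hp', 2, by norm_num, fun x y => ?_⟩
  rw [pow_two, mul_apply]
  refine Finset.sum_pos' (fun z _ => mul_nonneg (chainMatrix_nonneg hp.le hp' _ _)
    (chainMatrix_nonneg hp.le hp' _ _)) ⟨(x.2, y.1), Finset.mem_univ _, ?_⟩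
  simp [chainMatrix, transProb_pos hp hp']

theorem statDist_nonneg (hp : 0 ≤ p) (hp' : p < 1) (y : Fin a × Fin a) : 0 ≤ statDist a p y :=
  div_nonneg (transProb_nonneg hp hp' _ _) (Nat.cast_nonneg _)

theorem sum_statDist_mul (f : Fin a → Fin a → ℝ) :
    ∑ i, ∑ j, statDist a p (i, j) * f i j = (∑ i, ∑ j, transProb a p i j * f i j) / a := by
  simp only [statDist, Finset.sum_div]
  exact Finset.sum_congr rfl fun i _ => Finset.sum_congr rfl fun j _ => by ring

theorem sum_statDist (hp : 0 ≤ p) (hp' : p < 1) (ha : 0 < a) : ∑ y, statDist a p y = 1 := by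
  rw [Fintype.sum_prod_type]
  have := sum_statDist_mul (a := a) (p := p) (fun _ _ => 1)
  simp only [mul_one, sum_transProb hp hp'] at this
  rw [this]
  have : (a : ℝ) ≠ 0 := by positivity
  simp [this]

theorem vecMul_chainMatrix (ρ : Fin a × Fin a → ℝ) (y : Fin a × Fin a) :
    (ρ ᵥ* chainMatrix a p) y = (∑ k, ρ (k, y.1)) * transProb a p y.1 y.2 := by
  simp only [vecMul, dotProduct, chainMatrix, Fintype.sum_prod_type, Finset.sum_mul]
  refine Finset.sum_congr rfl fun k _ => ?_
  simp

theorem statDist_vecMul (hp : 0 ≤ p) (hp' : p < 1) :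
    statDist a p ᵥ* chainMatrix a p = statDist a p := by
  funext y
  rw [vecMul_chainMatrix]
  simp only [statDist]
  rw [← Finset.sum_div, sum_transProb_left hp hp']
  ring

/-- A stationary vector of the circulant matrix of the transition probabilities is constant. -/
theorem const_of_stationary (hp : 0 ≤ p) (hp' : p < 1) (q : Fin a → ℝ)
    (hq : ∀ j, q j = ∑ i, q i * transProb a p i j) (i j : Fin a) : q i = q j := by
  obtain ⟨b, rfl⟩ : ∃ b, a = b + 1 := ⟨a - 1, by have := i.pos; omega⟩
  set c : ℝ := (1 - p) / (1 - p ^ (b + 1)) with hc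
  have hpos := one_sub_pow_pos hp hp' (Nat.succ_pos b)
  -- The vector is extended periodically to ℕ, so that stationarity becomes a linear recurrence with
  -- geometric weights.
  let r : ℕ → ℝ := fun k => q ⟨k % (b + 1), Nat.mod_lt _ (Nat.succ_pos b)⟩
  have hr (k : ℕ) : r (k % (b + 1)) = r k := by simp [r]
  have hr1 (k : ℕ) : r (k + (b + 1)) = r k := by simp [r]
  have hrq (i : Fin (b + 1)) : r i = q i := by
    simp only [r]; congr 1; exact Fin.ext (Nat.mod_eq_of_lt i.2)
  -- Modulo b + 1 the index k + b - e is k - 1 - e, the place at distance e + 1 before k.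
  have hrec (k : ℕ) : r k = ∑ e ∈ Finset.range (b + 1), c * p ^ e * r (k + b - e) := by
    have h1 := hq ⟨k % (b + 1), Nat.mod_lt _ (Nat.succ_pos b)⟩
    have h2 := sum_instDist_left (fun e => c * p ^ e) r ⟨k % (b + 1), Nat.mod_lt _ (Nat.succ_pos b)⟩
    have h3 : r k = ∑ i : Fin (b + 1), c * p ^ (instDist i
        (⟨k % (b + 1), Nat.mod_lt _ (Nat.succ_pos b)⟩ : Fin (b + 1)) - 1) * r i := by
      simp only [r] at h1 ⊢
      rw [h1]
      refine Finset.sum_congr rfl fun i _ => ?_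
      have := hrq i
      simp only [r] at this
      rw [this, transProb_eq, hc]
      ring
    rw [h3, h2]
    refine Finset.sum_congr rfl fun e he => ?_
    have he' : e < b + 1 := Finset.mem_range.1 he
    congr 1
    simp only [hr]
    have h4 : k + b - e = k % (b + 1) + (b + 1) - 1 - e + (b + 1) * (k / (b + 1)) := by
      have := Nat.mod_add_div k (b + 1)
      omega
    rw [h4]
    simp only [r, Nat.add_mul_mod_self_left]
  -- Comparing the recurrence at k + 1 and at k: shifting geometric weights multiplies by p, apart
  -- from the first and the last term, which by periodicity are both multiples of `r k`. The
  -- resulting coefficient p + c (1 - p^(b+1)) equals 1.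
  have hstep (k : ℕ) : r (k + 1) = r k := by
    have h1 := hrec (k + 1)
    have h2 := hrec k
    rw [Finset.sum_range_succ'] at h1
    rw [Finset.sum_range_succ] at h2
    have h3 : ∑ e ∈ Finset.range b, c * p ^ (e + 1) * r (k + 1 + b - (e + 1)) =
        p * ∑ e ∈ Finset.range b, c * p ^ e * r (k + b - e) := by
      rw [Finset.mul_sum]
      refine Finset.sum_congr rfl fun e _ => ?_
      rw [show k + 1 + b - (e + 1) = k + b - e by omega]
      ring
    rw [h3, show k + 1 + b - 0 = k + (b + 1) by omega, hr1] at h1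
    rw [show k + b - b = k by omega] at h2
    have h4 : c * (1 - p ^ (b + 1)) = 1 - p := by rw [hc]; field_simp
    have h5 : ∑ e ∈ Finset.range b, c * p ^ e * r (k + b - e) = r k - c * p ^ b * r k := by
      linarith
    rw [h1, h5]
    have : p * (r k - c * p ^ b * r k) + c * p ^ 0 * r k =
        (p + c * (1 - p ^ (b + 1))) * r k := by ring
    rw [this, h4]
    ring
  have hconst (k : ℕ) : r k = r 0 := by
    induction k with
    | zero => rfl
    | succ k ih => rw [hstep, ih]
  rw [← hrq i, ← hrq j, hconst, hconst j]

/-- The second marginal of a stationary vector is stationary for the circulant matrix, hence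
constant, and the total mass fixes the constant as 1/a. The vector is recovered from this marginal
by one transition. Neither positivity of p nor ergodicity enters, so the case p = 0 is covered. -/
theorem statDist_unique (hp : 0 ≤ p) (hp' : p < 1) (ρ : Fin a × Fin a → ℝ) (h1 : ∑ y, ρ y = 1)
    (h2 : ρ ᵥ* chainMatrix a p = ρ) : ρ = statDist a p := by
  have h3 (y : Fin a × Fin a) : ρ y = (∑ k, ρ (k, y.1)) * transProb a p y.1 y.2 := by
    conv_lhs => rw [← h2]
    exact vecMul_chainMatrix ρ y
  have h4 : ∀ j, (∑ k, ρ (k, j)) = ∑ i, (∑ k, ρ (k, i)) * transProb a p i j := by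
    intro j
    exact Finset.sum_congr rfl fun k _ => h3 (k, j)
  funext y
  have h5 : ∑ i, ∑ k, ρ (k, i) = 1 := by
    rw [Finset.sum_comm, ← Fintype.sum_prod_type]; exact h1
  have h6 : ∀ i, (∑ k, ρ (k, i)) = ∑ k, ρ (k, y.1) := fun i =>
    const_of_stationary hp hp' (fun j => ∑ k, ρ (k, j)) h4 i y.1
  rw [Finset.sum_congr rfl fun i _ => h6 i] at h5
  simp only [Finset.sum_const, Finset.card_univ, Fintype.card_fin, nsmul_eq_mul] at h5
  have ha : (a : ℝ) ≠ 0 := by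
    intro h; rw [h] at h5; simp at h5
  rw [h3, statDist, eq_div_iff ha]
  linear_combination transProb a p y.1 y.2 * h5

/-! ### The law of the number of rounds -/

theorem hasSum_roundsProb (hp : 0 ≤ p) (hp' : p < 1) (ha : 0 < a) :
    HasSum (roundsProb a p) 1 := by
  have h := one_sub_pow_pos hp hp' ha
  have := (hasSum_geometric_of_lt_one (pow_nonneg hp a) (by linarith)).mul_left (1 - p ^ a)
  rwa [mul_inv_cancel₀ h.ne'] at this

theorem summable_pow_mul_roundsProb (hp : 0 ≤ p) (hp' : p < 1) (ha : 0 < a) (k : ℕ) :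
    Summable fun m : ℕ => (m : ℝ) ^ k * roundsProb a p m := by
  have h := one_sub_pow_pos hp hp' ha
  have h1 : ‖p ^ a‖ < 1 := by
    rw [Real.norm_of_nonneg (pow_nonneg hp a)]; linarith
  refine ((summable_pow_mul_geometric_of_norm_lt_one k h1).mul_left (1 - p ^ a)).congr fun m => ?_
  rw [roundsProb]; ring

/-- The expectation of a quadratic polynomial in the number of rounds. -/
theorem hasSum_roundsProb_quadratic (hp : 0 ≤ p) (hp' : p < 1) (ha : 0 < a) (x y z : ℝ) :
    HasSum (fun m : ℕ => roundsProb a p m * (x + y * m + z * (m : ℝ) ^ 2))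
      (x + y * roundsMean a p + z * roundsSecond a p) := by
  have h0 := (hasSum_roundsProb hp hp' ha).mul_left x
  have h1 : HasSum (fun m : ℕ => (m : ℝ) * roundsProb a p m) (roundsMean a p) := by
    have := (summable_pow_mul_roundsProb hp hp' ha 1).hasSum
    simp only [pow_one] at this
    exact this
  have h2 : HasSum (fun m : ℕ => (m : ℝ) ^ 2 * roundsProb a p m) (roundsSecond a p) :=
    (summable_pow_mul_roundsProb hp hp' ha 2).hasSum
  have := (h0.add (h1.mul_left y)).add (h2.mul_left z)
  rw [mul_one] at this
  exact hasSum_of_eq this (fun m => by ring) rfl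

end Chain

/-! ### Regrouping of series and sums over windows -/

theorem hasSum_prod_of_fintype {ι κ : Type*} [Fintype ι] [DecidableEq ι] {g : ι × κ → ℝ}
    {c : ι → ℝ} (h : ∀ j, HasSum (fun M => g (j, M)) (c j)) : HasSum g (∑ j, c j) := by
  have h1 (j : ι) : HasSum (fun x : ι × κ => if x.1 = j then g x else 0) (c j) := by
    have hinj : Function.Injective (fun M : κ => (j, M)) := fun x y hxy => (Prod.ext_iff.1 hxy).2
    rw [← hinj.hasSum_iff]
    · simpa [Function.comp_def] using h j
    · rintro ⟨k, M⟩ hx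
      refine if_neg fun hk => hx ⟨M, ?_⟩
      simp only at hk
      rw [hk]
  have h2 := hasSum_sum (s := Finset.univ) fun j _ => h1 j
  simpa using h2

/-- The sum of `k` consecutive values of `f` from `l` on. -/
def windowSum (f : ℕ → ℝ) (l k : ℕ) : ℝ := ∑ j ∈ Finset.range k, f (l + j)

theorem windowSum_succ (f : ℕ → ℝ) (l k : ℕ) :
    windowSum f l (k + 1) = f l + windowSum f (l + 1) k := by
  unfold windowSum
  rw [Finset.sum_range_succ', add_comm]
  congr 1
  exact Finset.sum_congr rfl fun j _ => by congr 1; omega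

theorem windowSum_one (f : ℕ → ℝ) (l : ℕ) : windowSum f l 1 = f l := by
  simp [windowSum]

theorem sum_Ico_eq_windowSum (f : ℕ → ℝ) (l k : ℕ) :
    ∑ j ∈ Finset.Ico l (l + k), f j = windowSum f l k := by
  rw [Finset.sum_Ico_eq_sum_range, add_tsub_cancel_left]; rfl

theorem windowSum_add_period {K : ℕ} [NeZero K] {f : ℕ → ℝ} (hf : ∀ l, f (l + K) = f l) (l k M : ℕ) :
    windowSum f l (k + M * K) = windowSum f l k + M * ∑ j ∈ Finset.range K, f j := by
  induction M with
  | zero => simp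
  | succ M ih =>
    have h : windowSum f l (k + (M + 1) * K) =
        windowSum f l (k + M * K) + ∑ j ∈ Finset.range K, f (l + (k + M * K) + j) := by
      unfold windowSum
      rw [show k + (M + 1) * K = (k + M * K) + K by ring, Finset.sum_range_add]
      congr 1
      exact Finset.sum_congr rfl fun j _ => by congr 1; omega
    rw [h, ih, sum_range_period f hf]
    push_cast
    ring

theorem windowSum_shift {K : ℕ} {f : ℕ → ℝ} (hf : ∀ l, f (l + K) = f l) (l k : ℕ) :
    windowSum f (l + K) k = windowSum f l k := by
  unfold windowSum
  exact Finset.sum_congr rfl fun j _ => by rw [add_right_comm, hf]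

theorem windowSum_mod {K : ℕ} {f : ℕ → ℝ} (hf : ∀ l, f (l + K) = f l) (a k : ℕ) :
    windowSum f (a + 1) k = windowSum f (a % K + 1) k := by
  have h (x c : ℕ) : windowSum f (c + K * x + 1) k = windowSum f (c + 1) k := by
    induction x with
    | zero => simp
    | succ x ih =>
      rw [← ih, show c + K * (x + 1) + 1 = (c + K * x + 1) + K by ring, windowSum_shift hf]
  conv_lhs => rw [← Nat.mod_add_div a K]
  exact h _ _

/-! ### Potentials: expected time and area up to the next reception -/

section Potential

variable {N K : ℕ} [NeZero K] {P : Fin K → Fin N} {n : Fin N} {p : ℝ}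

/-- Over a window followed by M rounds, means and variances are affine in M and squared means are
quadratic. Every series over the next reception therefore reduces to the first two moments of M. -/
theorem hasSum_hitProb_quadratic (hp : 0 ≤ p) (hp' : p < 1) {a : ℕ} {i : Fin (alpha P n)}
    (hai : a % K = inst P n i) (f : ℕ → ℝ) (x y z : Fin (alpha P n) → ℝ)
    (hf : ∀ j (M : ℕ), f (windowLength P n i j - 1 + M * K) = x j + y j * M + z j * (M : ℝ) ^ 2) :
    HasSum (fun m => hitProb P n p (a + 1) m * f m)
      (∑ j, transProb (alpha P n) p i j *
        (x j + y j * roundsMean (alpha P n) p + z j * roundsSecond (alpha P n) p)) := by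
  have ha := one_sub_pow_pos hp hp' i.pos
  rw [← hasSum_hitProb_iff (by intro h; rw [h] at ha; simp at ha) hai]
  refine hasSum_prod_of_fintype fun j => ?_
  have := (hasSum_roundsProb_quadratic hp hp' i.pos (x j) (y j) (z j)).mul_left
    (transProb (alpha P n) p i j)
  exact hasSum_of_eq this (fun M => by simp only [hf]; ring) rfl

variable (P n p)

/-- Expected time, from the start of transmission `l`, to the end of the next reception. -/
noncomputable def timePotential (s : ℕ → ℝ) (l : ℕ) : ℝ :=
  ∑' m, hitProb P n p l m * windowSum s l (m + 1)

/-- Expected area under the age, from the start of transmission `l` with age `0` to the end of the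
next reception. -/
noncomputable def areaPotential (s v : ℕ → ℝ) (l : ℕ) : ℝ :=
  ∑' m, hitProb P n p l m * ((windowSum v l (m + 1) + windowSum s l (m + 1) ^ 2) / 2)

variable {P n p} {s v : ℕ → ℝ}

theorem hasSum_time_of_slot (hp : 0 ≤ p) (hp' : p < 1) (hs : ∀ l, s (l + K) = s l) {a : ℕ}
    {i : Fin (alpha P n)} (hai : a % K = inst P n i) :
    HasSum (fun m => hitProb P n p (a + 1) m * windowSum s (a + 1) (m + 1))
      (∑ j, transProb (alpha P n) p i j * (roundsMean (alpha P n) p * ∑ l ∈ Finset.range K, s l +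
        windowSum s (inst P n i + 1) (windowLength P n i j))) := by
  have := hasSum_hitProb_quadratic hp hp' hai (fun m => windowSum s (a + 1) (m + 1))
    (fun j => windowSum s (inst P n i + 1) (windowLength P n i j))
    (fun _ => ∑ l ∈ Finset.range K, s l) (fun _ => 0) ?_
  · convert this using 3
    ring
  · intro j M
    have := windowLength_pos i j
    rw [show windowLength P n i j - 1 + M * K + 1 = windowLength P n i j + M * K by omega,
      windowSum_add_period hs, windowSum_mod hs, hai]
    ring

theorem hasSum_area_of_slot (hp : 0 ≤ p) (hp' : p < 1) (hs : ∀ l, s (l + K) = s l)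
    (hv : ∀ l, v (l + K) = v l) {a : ℕ} {i : Fin (alpha P n)} (hai : a % K = inst P n i) :
    HasSum (fun m => hitProb P n p (a + 1) m *
        ((windowSum v (a + 1) (m + 1) + windowSum s (a + 1) (m + 1) ^ 2) / 2))
      (∑ j, transProb (alpha P n) p i j * ((windowSum v (inst P n i + 1) (windowLength P n i j) +
        windowSum s (inst P n i + 1) (windowLength P n i j) ^ 2 +
        roundsMean (alpha P n) p * (∑ l ∈ Finset.range K, v l +
          2 * windowSum s (inst P n i + 1) (windowLength P n i j) * ∑ l ∈ Finset.range K, s l) +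
        roundsSecond (alpha P n) p * (∑ l ∈ Finset.range K, s l) ^ 2) / 2)) := by
  have := hasSum_hitProb_quadratic hp hp' hai
    (fun m => (windowSum v (a + 1) (m + 1) + windowSum s (a + 1) (m + 1) ^ 2) / 2)
    (fun j => (windowSum v (inst P n i + 1) (windowLength P n i j) +
        windowSum s (inst P n i + 1) (windowLength P n i j) ^ 2) / 2)
    (fun j => (∑ l ∈ Finset.range K, v l +
          2 * windowSum s (inst P n i + 1) (windowLength P n i j) * ∑ l ∈ Finset.range K, s l) / 2)
    (fun _ => (∑ l ∈ Finset.range K, s l) ^ 2 / 2) ?_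
  · convert this using 3
    ring
  · intro j M
    have := windowLength_pos i j
    rw [show windowLength P n i j - 1 + M * K + 1 = windowLength P n i j + M * K by omega,
      windowSum_add_period hs, windowSum_add_period hv, windowSum_mod hs, windowSum_mod hv, hai]
    ring

theorem hasSum_hitProb_of_slot (hp : 0 ≤ p) (hp' : p < 1) {a : ℕ} {i : Fin (alpha P n)}
    (hai : a % K = inst P n i) : HasSum (fun m => hitProb P n p (a + 1) m) 1 := by
  have := hasSum_hitProb_quadratic hp hp' hai (fun _ => 1) (fun _ => 1) (fun _ => 0) (fun _ => 0)
    (by simp)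
  simpa [sum_transProb hp hp'] using this

/-- Backward induction over the transmissions, from just after a transmission of source `n`. -/
theorem slot_induction (hn : ∃ k, P k = n) (Q : ℕ → Prop)
    (h0 : ∀ a i, a % K = inst P n i → Q (a + 1)) (h1 : ∀ l, Q (l + 1) → Q l) (l : ℕ) : Q l := by
  obtain ⟨i⟩ : Nonempty (Fin (alpha P n)) := ⟨⟨0, alpha_pos hn⟩⟩
  have hK : 0 < K := Nat.pos_of_ne_zero (NeZero.ne K)
  have h2 : ∀ d, Q (l + d) → Q l := by
    intro d
    induction d with
    | zero => exact id
    | succ d ih => exact fun h => ih (h1 _ h)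
  -- As K ≥ 1, this occurrence of instance i is late enough for its successor to be at or after l,
  -- and the backward step descends from there.
  have h3 : l ≤ inst P n i + K * l + 1 := by nlinarith
  refine h2 (inst P n i + K * l + 1 - l) ?_
  rw [Nat.add_sub_cancel' h3]
  refine h0 _ i ?_
  rw [Nat.add_mul_mod_self_left, inst_mod]

theorem hasSum_hitProb (hn : ∃ k, P k = n) (hp : 0 ≤ p) (hp' : p < 1) (l : ℕ) :
    HasSum (fun m => hitProb P n p l m) 1 := by
  refine slot_induction hn (fun l => HasSum (fun m => hitProb P n p l m) 1)
    (fun a i hai => hasSum_hitProb_of_slot hp hp' hai) (fun l hl => ?_) l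
  refine hasSum_of_eq (hasSum_of_succ (f := fun m => hitProb P n p l m)
    (hasSum_of_eq (hl.mul_left (failProb P n p l)) (fun m => hitProb_succ l m) rfl))
    (fun _ => rfl) ?_
  simp [hitProb_zero]

/-- One-step analysis: the service of transmission l is always spent, and with weight `failProb` the
search restarts at l + 1. In the series, the term m = 0 carries the weight of success, and the total
mass one of the shifted weights collects the remaining part of `s l`. -/
theorem hasSum_time_succ (hn : ∃ k, P k = n) (hp : 0 ≤ p) (hp' : p < 1) {l : ℕ} {c : ℝ}
    (h : HasSum (fun m => hitProb P n p (l + 1) m * windowSum s (l + 1) (m + 1)) c) :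
    HasSum (fun m => hitProb P n p l m * windowSum s l (m + 1)) (s l + failProb P n p l * c) := by
  have h1 := ((h.add ((hasSum_hitProb hn hp hp' (l + 1)).mul_right (s l))).mul_left
    (failProb P n p l))
  refine hasSum_of_eq (hasSum_of_succ (f := fun m => hitProb P n p l m * windowSum s l (m + 1))
    (hasSum_of_eq h1 (fun m => ?_) rfl)) (fun _ => rfl) ?_
  · rw [hitProb_succ, windowSum_succ s l]; ring
  · rw [hitProb_zero, zero_add, windowSum_one]; ring

/-- One-step analysis for the area. Expanding the square of s_l plus the later duration, the cross
term is the age s_l carried over the remaining time; this is why the time series appears in the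
recursion. -/
theorem hasSum_area_succ (hn : ∃ k, P k = n) (hp : 0 ≤ p) (hp' : p < 1) {l : ℕ} {c d : ℝ}
    (h : HasSum (fun m => hitProb P n p (l + 1) m * windowSum s (l + 1) (m + 1)) c)
    (h' : HasSum (fun m => hitProb P n p (l + 1) m *
      ((windowSum v (l + 1) (m + 1) + windowSum s (l + 1) (m + 1) ^ 2) / 2)) d) :
    HasSum (fun m => hitProb P n p l m *
      ((windowSum v l (m + 1) + windowSum s l (m + 1) ^ 2) / 2))
      ((v l + s l ^ 2) / 2 + failProb P n p l * (d + s l * c)) := by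
  have h1 := (((h'.add (h.mul_right (s l))).add
    ((hasSum_hitProb hn hp hp' (l + 1)).mul_right ((v l + s l ^ 2) / 2))).mul_left
    (failProb P n p l))
  refine hasSum_of_eq (hasSum_of_succ (f := fun m => hitProb P n p l m *
      ((windowSum v l (m + 1) + windowSum s l (m + 1) ^ 2) / 2))
    (hasSum_of_eq h1 (fun m => ?_) rfl)) (fun _ => rfl) ?_
  · rw [hitProb_succ, windowSum_succ s l, windowSum_succ v l]; ring
  · rw [hitProb_zero, zero_add, windowSum_one, windowSum_one]; ring

theorem hasSum_timePotential (hn : ∃ k, P k = n) (hp : 0 ≤ p) (hp' : p < 1)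
    (hs : ∀ l, s (l + K) = s l) (l : ℕ) :
    HasSum (fun m => hitProb P n p l m * windowSum s l (m + 1)) (timePotential P n p s l) := by
  refine Summable.hasSum ?_
  refine slot_induction hn
    (fun l => Summable (fun m => hitProb P n p l m * windowSum s l (m + 1)))
    (fun a i hai => (hasSum_time_of_slot hp hp' hs hai).summable)
    (fun l hl => (hasSum_time_succ hn hp hp' hl.hasSum).summable) l

theorem hasSum_areaPotential (hn : ∃ k, P k = n) (hp : 0 ≤ p) (hp' : p < 1)
    (hs : ∀ l, s (l + K) = s l) (hv : ∀ l, v (l + K) = v l) (l : ℕ) :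
    HasSum (fun m => hitProb P n p l m *
      ((windowSum v l (m + 1) + windowSum s l (m + 1) ^ 2) / 2)) (areaPotential P n p s v l) := by
  refine Summable.hasSum ?_
  refine slot_induction hn
    (fun l => Summable (fun m => hitProb P n p l m *
      ((windowSum v l (m + 1) + windowSum s l (m + 1) ^ 2) / 2)))
    (fun a i hai => (hasSum_area_of_slot hp hp' hs hv hai).summable)
    (fun l hl => (hasSum_area_succ hn hp hp' (hasSum_timePotential hn hp hp' hs (l + 1))
      hl.hasSum).summable) l

theorem timePotential_rec (hn : ∃ k, P k = n) (hp : 0 ≤ p) (hp' : p < 1)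
    (hs : ∀ l, s (l + K) = s l) (l : ℕ) :
    timePotential P n p s l = s l + failProb P n p l * timePotential P n p s (l + 1) :=
  (hasSum_time_succ hn hp hp' (hasSum_timePotential hn hp hp' hs (l + 1))).tsum_eq

theorem areaPotential_rec (hn : ∃ k, P k = n) (hp : 0 ≤ p) (hp' : p < 1)
    (hs : ∀ l, s (l + K) = s l) (hv : ∀ l, v (l + K) = v l) (l : ℕ) :
    areaPotential P n p s v l = (v l + s l ^ 2) / 2 + failProb P n p l *
      (areaPotential P n p s v (l + 1) + s l * timePotential P n p s (l + 1)) :=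
  (hasSum_area_succ hn hp hp' (hasSum_timePotential hn hp hp' hs (l + 1))
    (hasSum_areaPotential hn hp hp' hs hv (l + 1))).tsum_eq

theorem timePotential_period (hs : ∀ l, s (l + K) = s l) (l : ℕ) :
    timePotential P n p s (l + K) = timePotential P n p s l := by
  unfold timePotential
  simp only [hitProb_period, windowSum_shift hs]

theorem areaPotential_period (hs : ∀ l, s (l + K) = s l) (hv : ∀ l, v (l + K) = v l) (l : ℕ) :
    areaPotential P n p s v (l + K) = areaPotential P n p s v l := by
  unfold areaPotential
  simp only [hitProb_period, windowSum_shift hs, windowSum_shift hv]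

theorem exists_bound_of_period {f : ℕ → ℝ} (hf : ∀ l, f (l + K) = f l) :
    ∃ C, 0 ≤ C ∧ ∀ l, |f l| ≤ C := by
  refine ⟨∑ j ∈ Finset.range K, |f j|, Finset.sum_nonneg fun _ _ => abs_nonneg _, fun l => ?_⟩
  have h (x c : ℕ) : f (c + K * x) = f c := by
    induction x with
    | zero => simp
    | succ x ih => rw [← ih, mul_add, mul_one, ← add_assoc, hf]
  rw [← Nat.mod_add_div l K, h]
  exact Finset.single_le_sum (f := fun j => |f j|) (fun _ _ => abs_nonneg _)
    (Finset.mem_range.2 (Nat.mod_lt _ (Nat.pos_of_ne_zero (NeZero.ne K))))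

theorem sum_range_slots (g : ℕ → ℝ) :
    ∑ l ∈ Finset.range K, (1 - failProb P n p l) * g l = (1 - p) * ∑ i, g (inst P n i) := by
  have h1 : (Finset.range K).filter (fun l => src P l = n) =
      Finset.univ.image (inst P n) := by
    ext l
    simp only [Finset.mem_filter, Finset.mem_range, Finset.mem_image, Finset.mem_univ, true_and]
    constructor
    · rintro ⟨hl, hs⟩
      obtain ⟨j, hj⟩ := exists_inst hs
      rw [Nat.mod_eq_of_lt hl] at hj
      exact ⟨j, hj.symm⟩
    · rintro ⟨j, rfl⟩
      exact ⟨inst_lt P n j, src_inst P n j⟩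
  rw [← Finset.sum_image (f := g) (g := inst P n) fun x _ y _ h => inst_injective P n h, ← h1,
    Finset.sum_filter, Finset.mul_sum]
  refine Finset.sum_congr rfl fun l _ => ?_
  unfold failProb
  split_ifs <;> simp

/-- Summing the recursion of `timePotential` over one period, the two shifted sums agree by
periodicity. What survives is the weight of success, which is nonzero only at slots of source `n`.
In renewal terms, the mean cycle lengths must account for the mean duration of a round. -/
theorem sum_timePotential (hn : ∃ k, P k = n) (hp : 0 ≤ p) (hp' : p < 1)
    (hs : ∀ l, s (l + K) = s l) :
    (1 - p) * ∑ i, timePotential P n p s (inst P n i + 1) = ∑ l ∈ Finset.range K, s l := by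
  rw [← sum_range_slots fun l => timePotential P n p s (l + 1)]
  have h1 : ∑ l ∈ Finset.range K, timePotential P n p s (l + 1) =
      ∑ l ∈ Finset.range K, timePotential P n p s l := by
    rw [← sum_range_period _ (timePotential_period (P := P) (n := n) (p := p) hs) 1]
    exact Finset.sum_congr rfl fun l _ => by rw [add_comm]
  have h2 : ∑ l ∈ Finset.range K, timePotential P n p s l = ∑ l ∈ Finset.range K, s l +
      ∑ l ∈ Finset.range K, failProb P n p l * timePotential P n p s (l + 1) := by
    rw [← Finset.sum_add_distrib]
    exact Finset.sum_congr rfl fun l _ => timePotential_rec hn hp hp' hs l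
  have h3 : ∑ l ∈ Finset.range K, (1 - failProb P n p l) * timePotential P n p s (l + 1) =
      ∑ l ∈ Finset.range K, timePotential P n p s (l + 1) -
      ∑ l ∈ Finset.range K, failProb P n p l * timePotential P n p s (l + 1) := by
    rw [← Finset.sum_sub_distrib]
    exact Finset.sum_congr rfl fun l _ => by ring
  rw [h3, h1, h2]
  ring

end Potential

/-! ### Independence of past and present transmissions, and infinitely many successes -/

section Transmissions

variable {Ω : Type*} [mΩ : MeasurableSpace Ω]

/-- The σ-algebras generated by the single service times and the single drops. -/
@[reducible] def unitAlgebra (S : ℕ → Ω → ℝ) (X : ℕ → Ω → Bool) : ℕ ⊕ ℕ → MeasurableSpace Ω :=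
  Sum.elim (fun l => MeasurableSpace.comap (S l) inferInstance)
    (fun l => MeasurableSpace.comap (X l) inferInstance)

/-- The information about the transmissions before transmission `l`. -/
@[reducible] def past (S : ℕ → Ω → ℝ) (X : ℕ → Ω → Bool) (l : ℕ) : MeasurableSpace Ω :=
  ⨆ i ∈ {i : ℕ ⊕ ℕ | Sum.elim id id i < l}, unitAlgebra S X i

/-- The information about transmission `l`. -/
@[reducible] def present (S : ℕ → Ω → ℝ) (X : ℕ → Ω → Bool) (l : ℕ) : MeasurableSpace Ω :=
  ⨆ i ∈ {i : ℕ ⊕ ℕ | Sum.elim id id i = l}, unitAlgebra S X i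

variable {S : ℕ → Ω → ℝ} {X : ℕ → Ω → Bool}

theorem past_mono : Monotone (past S X) := by
  intro l m hlm
  exact biSup_mono fun i hi => lt_of_lt_of_le hi hlm

theorem measurable_past_service {j l : ℕ} (h : j < l) : Measurable[past S X l] (S j) :=
  measurable_iff_comap_le.2 (le_biSup (unitAlgebra S X) (i := Sum.inl j) h)

theorem measurable_past_success {j l : ℕ} (h : j < l) : Measurable[past S X l] (X j) :=
  measurable_iff_comap_le.2 (le_biSup (unitAlgebra S X) (i := Sum.inr j) h)

theorem measurable_present_service (l : ℕ) : Measurable[present S X l] (S l) :=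
  measurable_iff_comap_le.2 (le_biSup (unitAlgebra S X) (i := Sum.inl l) rfl)

theorem measurable_present_success (l : ℕ) : Measurable[present S X l] (X l) :=
  measurable_iff_comap_le.2 (le_biSup (unitAlgebra S X) (i := Sum.inr l) rfl)

variable {N K : ℕ} [NeZero K] {P : Fin K → Fin N} {ν : Fin N → Measure ℝ} {p : Fin N → ℝ}
  {μ : Measure Ω}

namespace IsTransmissionProcess

theorem unitAlgebra_le (h : IsTransmissionProcess P ν p μ S X) (i : ℕ ⊕ ℕ) :
    unitAlgebra S X i ≤ mΩ := by
  cases i with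
  | inl l => exact (h.measurable_service l).comap_le
  | inr l => exact (h.measurable_success l).comap_le

theorem past_le (h : IsTransmissionProcess P ν p μ S X) (l : ℕ) : past S X l ≤ mΩ :=
  iSup₂_le fun i _ => h.unitAlgebra_le i

theorem present_le (h : IsTransmissionProcess P ν p μ S X) (l : ℕ) : present S X l ≤ mΩ :=
  iSup₂_le fun i _ => h.unitAlgebra_le i

theorem measurable_services (h : IsTransmissionProcess P ν p μ S X) :
    Measurable fun ω k => S k ω := measurable_pi_lambda _ h.measurable_service

theorem measurable_successes (h : IsTransmissionProcess P ν p μ S X) :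
    Measurable fun ω k => X k ω := measurable_pi_lambda _ h.measurable_success

/-- Mutual independence within each of two families, together with independence between the
families, gives a single independent family indexed by the disjoint union. Past and present then
become disjoint sets of indices. -/
theorem iIndep_unitAlgebra (h : IsTransmissionProcess P ν p μ S X) :
    iIndep (unitAlgebra S X) μ := by
  rw [iIndep_iff]
  intro s f hf
  have hl : ∀ l ∈ s.toLeft, MeasurableSet[MeasurableSpace.comap (S l) inferInstance]
      (f (Sum.inl l)) := fun l hl => hf _ (Finset.mem_toLeft.1 hl)
  have hr : ∀ l ∈ s.toRight, MeasurableSet[MeasurableSpace.comap (X l) inferInstance]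
      (f (Sum.inr l)) := fun l hl => hf _ (Finset.mem_toRight.1 hl)
  have e1 : ⋂ i ∈ s, f i = (⋂ l ∈ s.toLeft, f (Sum.inl l)) ∩ ⋂ l ∈ s.toRight, f (Sum.inr l) := by
    ext ω
    simp only [Set.mem_iInter, Set.mem_inter_iff, Finset.mem_toLeft, Finset.mem_toRight]
    constructor
    · exact fun H => ⟨fun l hl => H _ hl, fun l hl => H _ hl⟩
    · rintro ⟨H1, H2⟩ (l | l) hl
      · exact H1 l hl
      · exact H2 l hl
  have m1 : MeasurableSet[MeasurableSpace.comap (fun ω k => S k ω) inferInstance]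
      (⋂ l ∈ s.toLeft, f (Sum.inl l)) := by
    refine Finset.measurableSet_biInter _ fun l hl' => ?_
    obtain ⟨A, hA, hA'⟩ := hl l hl'
    exact ⟨(fun x : ℕ → ℝ => x l) ⁻¹' A, measurable_pi_apply l hA, hA'⟩
  have m2 : MeasurableSet[MeasurableSpace.comap (fun ω k => X k ω) inferInstance]
      (⋂ l ∈ s.toRight, f (Sum.inr l)) := by
    refine Finset.measurableSet_biInter _ fun l hl' => ?_
    obtain ⟨A, hA, hA'⟩ := hr l hl'
    exact ⟨(fun x : ℕ → Bool => x l) ⁻¹' A, measurable_pi_apply l hA, hA'⟩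
  have i1 := (IndepFun_iff _ _ _).1 h.indep_service_success _ _ m1 m2
  have i2 := (iIndep_iff _ _).1 ((iIndepFun_iff_iIndep _ _ _).1 h.indep_service) s.toLeft hl
  have i3 := (iIndep_iff _ _).1 ((iIndepFun_iff_iIndep _ _ _).1 h.indep_success) s.toRight hr
  rw [e1, i1, i2, i3]
  conv_rhs => rw [← Finset.toLeft_disjSum_toRight (u := s)]
  rw [Finset.prod_disjSum]

theorem indep_past_present (h : IsTransmissionProcess P ν p μ S X) (l : ℕ) :
    Indep (past S X l) (present S X l) μ := by
  refine indep_iSup_of_disjoint h.unitAlgebra_le h.iIndep_unitAlgebra ?_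
  rw [Set.disjoint_left]
  intro i hi hi'
  simp only [Set.mem_ofPred_eq] at hi hi'
  omega

theorem indepFun_past_present (h : IsTransmissionProcess P ν p μ S X) {l : ℕ} {α β : Type*}
    [MeasurableSpace α] [MeasurableSpace β] {f : Ω → α} {g : Ω → β}
    (hf : Measurable[past S X l] f) (hg : Measurable[present S X l] g) : IndepFun f g μ :=
  (IndepFun_iff_Indep _ _ _).2 (indep_of_indep_of_le_left (indep_of_indep_of_le_right
    (h.indep_past_present l) hg.comap_le) hf.comap_le)

variable {n : Fin N} [IsProbabilityMeasure μ]

theorem measurableSet_received (_ : IsTransmissionProcess P ν p μ S X) (n : Fin N) (l : ℕ) :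
    MeasurableSet[present S X l] {ω | Received P n X ω l} := by
  unfold Received
  by_cases hs : src P l = n
  · simp only [hs, true_and]
    exact measurable_present_success l (measurableSet_singleton true)
  · simp [hs]

theorem measurableSet_past_received {j l : ℕ} (n : Fin N) (hj : j < l) :
    MeasurableSet[past S X l] {ω | Received P n X ω j} := by
  unfold Received
  by_cases hs : src P j = n
  · simp only [hs, true_and]
    exact measurable_past_success hj (measurableSet_singleton true)
  · simp [hs]

theorem prob_nonneg (h : IsTransmissionProcess P ν p μ S X) (hn : ∃ k, P k = n) : 0 ≤ p n := by
  obtain ⟨k, -, hk⟩ := exists_src hn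
  rw [← hk, ← h.prob_drop k]
  exact measureReal_nonneg

theorem prob_not_received (h : IsTransmissionProcess P ν p μ S X) (n : Fin N) (l : ℕ) :
    μ.real {ω | ¬ Received P n X ω l} = failProb P n (p n) l := by
  unfold Received failProb
  split_ifs with hs
  · simp only [hs, true_and, Bool.not_eq_true]
    rw [h.prob_drop, hs]
  · simp [hs]

theorem prob_received (h : IsTransmissionProcess P ν p μ S X) (n : Fin N) (l : ℕ) :
    μ.real {ω | Received P n X ω l} = 1 - failProb P n (p n) l := by
  have := probReal_compl_eq_one_sub (μ := μ) (h.present_le l _ (h.measurableSet_received n l))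
  have h2 := h.prob_not_received n l
  have h3 : {ω | ¬ Received P n X ω l} = {ω | Received P n X ω l}ᶜ := rfl
  rw [h3] at h2
  linarith

theorem prob_past_inter (h : IsTransmissionProcess P ν p μ S X) {l : ℕ} {E F : Set Ω}
    (hE : MeasurableSet[past S X l] E) (hF : MeasurableSet[present S X l] F) :
    μ.real (E ∩ F) = μ.real E * μ.real F := by
  have := (Indep_iff _ _ _).1 (h.indep_past_present l) E F hE hF
  rw [measureReal_def, this, ENNReal.toReal_mul]
  rfl

/-- Measurability and probability are proved in one induction, because each further factor is split
off by independence from an event of the past. -/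
theorem prob_no_reception (h : IsTransmissionProcess P ν p μ S X) (n : Fin N) {l : ℕ} {E : Set Ω}
    (hE : MeasurableSet[past S X l] E) (m : ℕ) :
    MeasurableSet[past S X (l + m)] (E ∩ {ω | ∀ j < m, ¬ Received P n X ω (l + j)}) ∧
    μ.real (E ∩ {ω | ∀ j < m, ¬ Received P n X ω (l + j)}) =
      μ.real E * ∏ j ∈ Finset.range m, failProb P n (p n) (l + j) := by
  induction m with
  | zero => simpa using hE
  | succ m ih =>
    have e : E ∩ {ω | ∀ j < m + 1, ¬ Received P n X ω (l + j)} =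
        (E ∩ {ω | ∀ j < m, ¬ Received P n X ω (l + j)}) ∩ {ω | ¬ Received P n X ω (l + m)} := by
      ext ω
      simp only [Set.mem_inter_iff, Set.mem_ofPred_eq, Nat.lt_succ_iff_lt_or_eq, and_assoc]
      refine and_congr_right fun _ => ⟨fun H => ⟨fun j hj => H j (Or.inl hj), H m (Or.inr rfl)⟩, ?_⟩
      rintro ⟨H1, H2⟩ j (hj | rfl)
      · exact H1 j hj
      · exact H2
    rw [e]
    refine ⟨?_, ?_⟩
    · exact (past_mono (Nat.le_succ _) _ ih.1).inter
        (measurableSet_past_received n (Nat.lt_succ_self _)).compl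
    · refine (h.prob_past_inter ih.1 (h.measurableSet_received n (l + m)).compl).trans ?_
      rw [ih.2, Finset.prod_range_succ, ← h.prob_not_received n (l + m), mul_assoc]
      rfl

theorem prob_first_reception (h : IsTransmissionProcess P ν p μ S X) (n : Fin N) {l : ℕ}
    {E : Set Ω} (hE : MeasurableSet[past S X l] E) (m : ℕ) :
    μ.real (E ∩ {ω | (∀ j < m, ¬ Received P n X ω (l + j)) ∧ Received P n X ω (l + m)}) =
      μ.real E * hitProb P n (p n) l m := by
  obtain ⟨h1, h2⟩ := h.prob_no_reception n hE m
  have := h.prob_past_inter h1 (h.measurableSet_received n (l + m))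
  rw [h2, h.prob_received] at this
  rw [hitProb, ← mul_assoc, ← this, Set.inter_assoc]
  rfl

/-- The events that the first reception from l on occurs at l + m are disjoint in m, and their
probabilities `hitProb` add up to one. -/
theorem ae_exists_received (h : IsTransmissionProcess P ν p μ S X) (hn : ∃ k, P k = n)
    (hp : p n < 1) (l : ℕ) : ∀ᵐ ω ∂μ, ∃ j ≥ l, Received P n X ω j := by
  have hp0 := h.prob_nonneg hn
  have h1 := hasSum_hitProb hn hp0 hp l
  let A : ℕ → Set Ω := fun m =>
    {ω | (∀ j < m, ¬ Received P n X ω (l + j)) ∧ Received P n X ω (l + m)}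
  have hA (m : ℕ) : MeasurableSet (A m) := by
    have hm := (h.prob_no_reception n (E := Set.univ) (l := l) MeasurableSet.univ m).1
    rw [Set.univ_inter] at hm
    exact (h.past_le _ _ hm).inter (h.present_le _ _ (h.measurableSet_received n (l + m)))
  have hdisj : Pairwise (Function.onFun Disjoint A) := by
    intro m m' hmm
    rw [Function.onFun, Set.disjoint_left]
    rintro ω ⟨ha, hb⟩ ⟨ha', hb'⟩
    rcases lt_or_gt_of_ne hmm with h' | h'
    · exact ha' _ h' hb
    · exact ha _ h' hb'
  have hAm (m : ℕ) : μ (A m) = ENNReal.ofReal (hitProb P n (p n) l m) := by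
    have := h.prob_first_reception n (l := l) (E := Set.univ) MeasurableSet.univ m
    rw [Set.univ_inter, probReal_univ, one_mul] at this
    rw [← this, ofReal_measureReal]
  have htot : μ (⋃ m, A m) = 1 := by
    rw [measure_iUnion hdisj hA]
    simp only [hAm]
    rw [← ENNReal.ofReal_tsum_of_nonneg (fun m => hitProb_nonneg hp0 hp.le l m) h1.summable,
      h1.tsum_eq, ENNReal.ofReal_one]
  have hae : ∀ᵐ ω ∂μ, ω ∈ ⋃ m, A m := by
    rw [← mem_ae_iff_prob_eq_one (MeasurableSet.iUnion hA)] at htot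
    exact htot
  filter_upwards [hae] with ω hω
  obtain ⟨m, hm⟩ := Set.mem_iUnion.1 hω
  exact ⟨l + m, by omega, hm.2⟩

theorem ae_infinite_received (h : IsTransmissionProcess P ν p μ S X) (hn : ∃ k, P k = n)
    (hp : p n < 1) : ∀ᵐ ω ∂μ, {k | Received P n X ω k}.Infinite := by
  filter_upwards [ae_all_iff.2 fun l => h.ae_exists_received hn hp l] with ω hω
  rw [Set.infinite_iff_exists_gt]
  intro a
  obtain ⟨j, hj, hj'⟩ := hω (a + 1)
  exact ⟨j, hj', by omega⟩

end IsTransmissionProcess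

end Transmissions

/-! ### Enumeration of the successes by `Nat.nth` -/

section Nth

variable {R : ℕ → Prop}

open scoped Classical in
theorem nth_eq_iff (hR : (Set.ofPred R).Infinite) {k a : ℕ} :
    Nat.nth R k = a ↔ R a ∧ Nat.count R a = k := by
  constructor
  · rintro rfl
    exact ⟨Nat.nth_mem_of_infinite hR k, Nat.count_nth_of_infinite hR k⟩
  · rintro ⟨h1, h2⟩
    rw [← h2, Nat.nth_count h1]

theorem nth_lt_nth_succ (hR : (Set.ofPred R).Infinite) (k : ℕ) :
    Nat.nth R k < Nat.nth R (k + 1) :=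
  Nat.nth_strictMono hR (Nat.lt_succ_self k)

theorem not_of_nth_lt_lt (hR : (Set.ofPred R).Infinite) {k x : ℕ} (h1 : Nat.nth R k < x)
    (h2 : x < Nat.nth R (k + 1)) : ¬ R x := by
  classical
  intro hx
  rw [← Nat.nth_count hx] at h1 h2
  rw [Nat.nth_lt_nth hR] at h1 h2
  omega

theorem nth_succ_eq_iff (hR : (Set.ofPred R).Infinite) {k m : ℕ} :
    Nat.nth R (k + 1) = Nat.nth R k + 1 + m ↔
      (∀ j < m, ¬ R (Nat.nth R k + 1 + j)) ∧ R (Nat.nth R k + 1 + m) := by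
  have hlt := nth_lt_nth_succ hR k
  constructor
  · intro h
    refine ⟨fun j hj => not_of_nth_lt_lt hR (k := k) (by omega) (by omega), ?_⟩
    rw [← h]
    exact Nat.nth_mem_of_infinite hR _
  · rintro ⟨h1, h2⟩
    rcases lt_trichotomy (Nat.nth R (k + 1)) (Nat.nth R k + 1 + m) with h | h | h
    · exfalso
      refine h1 (Nat.nth R (k + 1) - Nat.nth R k - 1) (by omega) ?_
      rw [show Nat.nth R k + 1 + (Nat.nth R (k + 1) - Nat.nth R k - 1) = Nat.nth R (k + 1) by omega]
      exact Nat.nth_mem_of_infinite hR _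
    · exact h
    · exact absurd h2 (not_of_nth_lt_lt hR (by omega) h)

open scoped Classical in
-- The second alternative is the default value 0 of `Nat.nth` when there is no k-th element.
-- Covering it gives measurability of the success numbers on the whole space, not only almost
-- everywhere.
theorem nth_eq_iff_or {k a : ℕ} : Nat.nth R k = a ↔
    (R a ∧ Nat.count R a = k) ∨ (a = 0 ∧ ∀ b, ¬ (R b ∧ Nat.count R b = k)) := by
  by_cases h : ∃ b, R b ∧ Nat.count R b = k
  · obtain ⟨b, hb, hk⟩ := h
    have h1 : Nat.nth R k = b := by rw [← hk, Nat.nth_count hb]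
    rw [h1]
    constructor
    · rintro rfl
      exact Or.inl ⟨hb, hk⟩
    · rintro (⟨ha, hk'⟩ | ⟨-, h'⟩)
      · rw [← h1, ← hk', Nat.nth_count ha]
      · exact absurd ⟨hb, hk⟩ (h' b)
  · push Not at h
    have h0 : Nat.nth R k = 0 := by
      by_cases hf : (Set.ofPred R).Finite
      · by_cases hc : k < hf.toFinset.card
        · exact absurd (Nat.count_nth_of_lt_card_finite hf hc)
            (h _ (Nat.nth_mem_of_lt_card hf hc))
        · exact Nat.nth_of_card_le hf (not_lt.1 hc)
      · exact absurd (Nat.count_nth_of_infinite hf k) (h _ (Nat.nth_mem_of_infinite hf k))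
    rw [h0]
    constructor
    · rintro rfl
      exact Or.inr ⟨rfl, fun b hb => h b hb.1 hb.2⟩
    · rintro (⟨ha, hk'⟩ | ⟨h', -⟩)
      · exact absurd hk' (h a ha)
      · exact h'.symm

variable {α : Type*} [MeasurableSpace α] {T : α → ℕ → Prop}

open scoped Classical in
-- Only the places l < a are assumed measurable, so that the lemma applies to the σ-algebra of the
-- past of a transmission.
theorem measurableSet_count_eq {a : ℕ} (hT : ∀ l < a, MeasurableSet {x | T x l}) (k : ℕ) :
    MeasurableSet {x | Nat.count (T x) a = k} := by
  induction a generalizing k with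
  | zero => simp
  | succ a ih =>
    have ih' := fun k => ih (fun l hl => hT l (by omega)) k
    have e : {x | Nat.count (T x) (a + 1) = k} =
        ({x | Nat.count (T x) a = k} ∩ {x | T x a}ᶜ) ∪
          ({x | T x a} ∩ ⋃ m ∈ {m | m + 1 = k}, {x | Nat.count (T x) a = m}) := by
      ext x
      simp only [Nat.count_succ, Set.mem_ofPred_eq, Set.mem_union, Set.mem_inter_iff,
        Set.mem_compl_iff, Set.mem_iUnion, exists_prop]
      by_cases h : T x a <;> simp [h]
    rw [e]
    exact ((ih' k).inter (hT a (by omega)).compl).union ((hT a (by omega)).inter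
      (MeasurableSet.biUnion (Set.to_countable _) fun m _ => ih' m))

theorem measurable_nth (hT : ∀ l, MeasurableSet {x | T x l}) (k : ℕ) :
    Measurable fun x => Nat.nth (T x) k := by
  classical
  refine measurable_to_countable' fun a => ?_
  have e : (fun x => Nat.nth (T x) k) ⁻¹' {a} = ({x | T x a} ∩ {x | Nat.count (T x) a = k}) ∪
      ({x | a = 0} ∩ ⋂ b, ({x | T x b} ∩ {x | Nat.count (T x) b = k})ᶜ) := by
    ext x
    simp only [Set.mem_preimage, Set.mem_singleton_iff, nth_eq_iff_or, Set.mem_union,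
      Set.mem_inter_iff, Set.mem_ofPred_eq, Set.mem_iInter, Set.mem_compl_iff]
  rw [e]
  have h (b : ℕ) := (hT b).inter (measurableSet_count_eq (fun l _ => hT l) (a := b) k)
  exact (h a).union ((MeasurableSet.const _).inter (MeasurableSet.iInter fun b => (h b).compl))

end Nth

theorem hasSum_measureReal_fiber {Ω : Type*} [MeasurableSpace Ω] {μ : Measure Ω}
    [IsFiniteMeasure μ] {E : Set Ω} (hE : MeasurableSet E) {D : Ω → ℕ} (hD : Measurable D) :
    HasSum (fun a => μ.real (E ∩ D ⁻¹' {a})) (μ.real E) := by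
  have h1 : μ E = ∑' a, μ (E ∩ D ⁻¹' {a}) := by
    rw [← measure_iUnion]
    · rw [← Set.inter_iUnion, ← Set.preimage_iUnion, Set.iUnion_of_singleton, Set.preimage_univ,
        Set.inter_univ]
    · intro a b hab
      rw [Function.onFun, Set.disjoint_left]
      rintro ω ⟨-, h⟩ ⟨-, h'⟩
      exact hab (h.symm.trans h')
    · exact fun a => hE.inter (hD (measurableSet_singleton a))
  rw [measureReal_def, h1, ENNReal.tsum_toReal_eq fun _ => measure_ne_top _ _]
  exact ENNReal.hasSum_toReal (h1 ▸ measure_ne_top μ E)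

/-! ### Law of the successive successes: Markov property and number of rounds -/

section Transmissions

variable {Ω : Type*} [mΩ : MeasurableSpace Ω] {S : ℕ → Ω → ℝ} {X : ℕ → Ω → Bool}
  {N K : ℕ} [NeZero K] {P : Fin K → Fin N} {ν : Fin N → Measure ℝ} {p : Fin N → ℝ}
  {μ : Measure Ω} {n : Fin N}

/-- The number of the `k`-th success, as a function of the sequence of successes. -/
noncomputable def successOf (P : Fin K → Fin N) (n : Fin N) (k : ℕ) (x : ℕ → Bool) : ℕ :=
  Nat.nth (fun l => src P l = n ∧ x l = true) k

theorem measurable_successOf (k : ℕ) : Measurable (successOf P n k) := by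
  refine measurable_nth (fun l => ?_) k
  have hm : Measurable fun x : ℕ → Bool => x l := measurable_pi_apply l
  have h : MeasurableSet {x : ℕ → Bool | x l = true} := hm (measurableSet_singleton true)
  exact (MeasurableSet.const (src P l = n)).inter h

theorem cycleRounds_mul_eq {ω : Ω} (hR : {k | Received P n X ω k}.Infinite) {k : ℕ}
    {i j : Fin (alpha P n)} {M : ℕ} (hi : successIndex P n X k ω % K = inst P n i) :
    (successIndex P n X (k + 1) ω % K = inst P n j ∧ cycleRounds P n X k ω = M) ↔
      successIndex P n X (k + 1) ω = successIndex P n X k ω + windowLength P n i j + M * K := by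
  have hlt : successIndex P n X k ω < successIndex P n X (k + 1) ω := nth_lt_nth_succ hR k
  constructor
  · rintro ⟨h1, h2⟩
    have := exists_rounds hi h1 hlt
    unfold cycleRounds at h2
    rwa [h2] at this
  · intro h
    unfold cycleRounds
    rw [h]
    exact ⟨add_window_mod hi j M, rounds_eq i j _ M⟩

namespace IsTransmissionProcess

variable [IsProbabilityMeasure μ]

theorem measurable_successIndex (h : IsTransmissionProcess P ν p μ S X) (k : ℕ) :
    Measurable (successIndex P n X k) :=
  (measurable_successOf (P := P) (n := n) k).comp h.measurable_successes

theorem measurable_cycleRounds (h : IsTransmissionProcess P ν p μ S X) (k : ℕ) :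
    Measurable (cycleRounds P n X k) :=
  (((h.measurable_successIndex (k + 1)).sub (h.measurable_successIndex k)).sub_const 1).div_const K

theorem measurableSet_inState (h : IsTransmissionProcess P ν p μ S X) (k : ℕ)
    (y : Fin (alpha P n) × Fin (alpha P n)) : MeasurableSet {ω | InState P n X k y ω} :=
  (h.measurable_successIndex k (MeasurableSet.of_discrete (s := {c | c % K = inst P n y.1}))).inter
    (h.measurable_successIndex (k + 1)
      (MeasurableSet.of_discrete (s := {c | c % K = inst P n y.2})))

theorem measurableSet_history (h : IsTransmissionProcess P ν p μ S X) (Q : ℕ → ℕ → Prop) (k : ℕ) :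
    MeasurableSet {ω | ∀ l ≤ k, Q l (successIndex P n X l ω)} := by
  have e : {ω | ∀ l ≤ k, Q l (successIndex P n X l ω)} =
      ⋂ l, ⋂ _ : l ≤ k, successIndex P n X l ⁻¹' {c | Q l c} := by
    ext ω; simp
  rw [e]
  exact MeasurableSet.iInter fun l => MeasurableSet.iInter fun _ =>
    h.measurable_successIndex l MeasurableSet.of_discrete

/-- The joint law of the successes up to the `k`-th and of the next one. -/
theorem prob_history_next (h : IsTransmissionProcess P ν p μ S X) (hn : ∃ k, P k = n)
    (hp : p n < 1) (Q : ℕ → ℕ → Prop) (k a m : ℕ) :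
    μ.real {ω | (∀ l ≤ k, Q l (successIndex P n X l ω)) ∧ successIndex P n X k ω = a ∧
      successIndex P n X (k + 1) ω = a + 1 + m} =
    μ.real {ω | (∀ l ≤ k, Q l (successIndex P n X l ω)) ∧ successIndex P n X k ω = a} *
      hitProb P n (p n) (a + 1) m := by
  classical
  -- The history is rephrased through counts of receptions among the transmissions up to a, which
  -- makes it an event of `past S X (a + 1)`. It agrees with the intended event whenever there are
  -- infinitely many successes, hence almost surely.
  let E : Set Ω := {ω | (Received P n X ω a ∧ Nat.count (Received P n X ω) a = k) ∧
    ∀ l ≤ k, ∃ c ≤ a, (Received P n X ω c ∧ Nat.count (Received P n X ω) c = l) ∧ Q l c}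
  have hrec (c : ℕ) (hc : c ≤ a) (l : ℕ) : MeasurableSet[past S X (a + 1)]
      {ω | Received P n X ω c ∧ Nat.count (Received P n X ω) c = l} :=
    MeasurableSet.inter (measurableSet_past_received n (Nat.lt_succ_of_le hc))
      (@measurableSet_count_eq _ (past S X (a + 1)) _ _
        (fun j hj => measurableSet_past_received n (by omega)) l)
  have hE : MeasurableSet[past S X (a + 1)] E := by
    refine MeasurableSet.inter (hrec a le_rfl k) ?_
    have e : {ω | ∀ l ≤ k, ∃ c ≤ a, (Received P n X ω c ∧ Nat.count (Received P n X ω) c = l) ∧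
        Q l c} = ⋂ l, ⋂ _ : l ≤ k, ⋃ c, ⋃ _ : c ≤ a ∧ Q l c,
          {ω | Received P n X ω c ∧ Nat.count (Received P n X ω) c = l} := by
      ext ω
      simp only [Set.mem_iInter, Set.mem_iUnion, Set.mem_ofPred_eq, exists_prop]
      refine forall_congr' fun l => imp_congr_right fun _ => exists_congr fun c => ?_
      tauto
    refine (congrArg (MeasurableSet[past S X (a + 1)]) e).mpr ?_
    exact MeasurableSet.iInter fun l => MeasurableSet.iInter fun _ => MeasurableSet.iUnion fun c =>
      MeasurableSet.iUnion fun hc => hrec c hc.1 l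
  have hEiff : ∀ ω, {k | Received P n X ω k}.Infinite →
      (ω ∈ E ↔ (∀ l ≤ k, Q l (successIndex P n X l ω)) ∧ successIndex P n X k ω = a) := by
    intro ω hω
    simp only [E, Set.mem_ofPred_eq, ← nth_eq_iff hω]
    unfold successIndex
    constructor
    · rintro ⟨h1, h2⟩
      refine ⟨fun l hl => ?_, h1⟩
      obtain ⟨c, -, hc, hQ⟩ := h2 l hl
      rw [hc]; exact hQ
    · rintro ⟨h1, h2⟩
      refine ⟨h2, fun l hl => ⟨_, ?_, rfl, h1 l hl⟩⟩
      rw [← h2]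
      exact Nat.nth_monotone hω hl
  have hinf := h.ae_infinite_received hn hp
  have e1 : μ.real {ω | (∀ l ≤ k, Q l (successIndex P n X l ω)) ∧ successIndex P n X k ω = a} =
      μ.real E := by
    refine measureReal_congr ?_
    filter_upwards [hinf] with ω hω
    exact propext (hEiff ω hω).symm
  rw [e1, ← h.prob_first_reception n hE m]
  refine measureReal_congr ?_
  filter_upwards [hinf] with ω hω
  refine propext ?_
  have h1 := hEiff ω hω
  have h2 := nth_succ_eq_iff hω (k := k) (m := m)
  change _ ↔ (ω ∈ E ∧ _)
  rw [h1]
  change ((∀ l ≤ k, Q l (successIndex P n X l ω)) ∧ successIndex P n X k ω = a ∧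
      successIndex P n X (k + 1) ω = a + 1 + m) ↔ ((∀ l ≤ k, Q l (successIndex P n X l ω)) ∧
      successIndex P n X k ω = a) ∧ ((∀ j < m, ¬ Received P n X ω (a + 1 + j)) ∧
      Received P n X ω (a + 1 + m))
  rw [and_assoc]
  refine and_congr_right fun _ => and_congr_right fun h3 => ?_
  change Nat.nth (Received P n X ω) (k + 1) = a + 1 + m ↔ _
  have h4 : Nat.nth (Received P n X ω) k = a := h3
  rw [h4] at h2
  exact h2

/-- The joint law of the successes up to the `k`-th, the instance of the next one and the number
of complete rounds between them. -/
theorem prob_history_window (h : IsTransmissionProcess P ν p μ S X) (hn : ∃ k, P k = n)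
    (hp : p n < 1) (Q : ℕ → ℕ → Prop) (k : ℕ) (i j : Fin (alpha P n)) (M : ℕ)
    (hQ : ∀ c, Q k c → c % K = inst P n i) :
    μ.real {ω | (∀ l ≤ k, Q l (successIndex P n X l ω)) ∧ successIndex P n X (k + 1) ω =
      successIndex P n X k ω + windowLength P n i j + M * K} =
    μ.real {ω | ∀ l ≤ k, Q l (successIndex P n X l ω)} *
      (transProb (alpha P n) (p n) i j * roundsProb (alpha P n) (p n) M) := by
  have hp0 := h.prob_nonneg hn
  have hw := windowLength_pos i j
  have hα : p n ^ alpha P n ≠ 1 := (pow_lt_one₀ hp0 hp i.pos.ne').ne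
  have hB := h.measurableSet_history (n := n) Q k
  have hC : MeasurableSet {ω | successIndex P n X (k + 1) ω =
      successIndex P n X k ω + windowLength P n i j + M * K} :=
    measurableSet_eq_fun (h.measurable_successIndex _)
      (((h.measurable_successIndex k).add_const _).add_const _)
  -- Both sides are decomposed by the position a of the k-th success. Only positions at instance i
  -- contribute, and there the weight of the next success does not depend on a.
  have s1 := hasSum_measureReal_fiber (μ := μ) (hB.inter hC) (h.measurable_successIndex (n := n) k)
  have s2 := (hasSum_measureReal_fiber (μ := μ) hB (h.measurable_successIndex (n := n) k)).mul_right
    (transProb (alpha P n) (p n) i j * roundsProb (alpha P n) (p n) M)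
  refine s1.unique (hasSum_of_eq s2 (fun a => ?_) rfl)
  by_cases ha : a % K = inst P n i
  · rw [← hitProb_window hα ha]
    have h1 := h.prob_history_next hn hp Q k a (windowLength P n i j - 1 + M * K)
    refine Eq.trans ?_ h1
    congr 1
    ext ω
    change ((_ ∧ _) ∧ _) ↔ (_ ∧ _)
    simp only [Set.mem_ofPred_eq, Set.mem_preimage, Set.mem_singleton_iff, and_assoc]
    refine and_congr_right fun _ => ?_
    constructor
    · rintro ⟨h2, h3⟩
      exact ⟨h3, by omega⟩
    · rintro ⟨h3, h2⟩
      exact ⟨by omega, h3⟩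
  · have h0 : {ω | ∀ l ≤ k, Q l (successIndex P n X l ω)} ∩ successIndex P n X k ⁻¹' {a} = ∅ := by
      ext ω
      simp only [Set.mem_inter_iff, Set.mem_ofPred_eq, Set.mem_preimage, Set.mem_singleton_iff,
        Set.mem_empty_iff_false, iff_false, not_and]
      rintro h1 rfl
      exact ha (hQ _ (h1 k le_rfl))
    have h0' : ({ω | ∀ l ≤ k, Q l (successIndex P n X l ω)} ∩ {ω | successIndex P n X (k + 1) ω =
        successIndex P n X k ω + windowLength P n i j + M * K}) ∩ successIndex P n X k ⁻¹' {a}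
        = ∅ := by
      rw [Set.inter_right_comm, h0, Set.empty_inter]
    rw [h0, h0']
    simp

/-- Summation over the number of rounds, whose law has total mass one. -/
theorem prob_history_inst (h : IsTransmissionProcess P ν p μ S X) (hn : ∃ k, P k = n)
    (hp : p n < 1) (Q : ℕ → ℕ → Prop) (k : ℕ) (i j : Fin (alpha P n))
    (hQ : ∀ c, Q k c → c % K = inst P n i) :
    μ.real {ω | (∀ l ≤ k, Q l (successIndex P n X l ω)) ∧
      successIndex P n X (k + 1) ω % K = inst P n j} =
    μ.real {ω | ∀ l ≤ k, Q l (successIndex P n X l ω)} * transProb (alpha P n) (p n) i j := by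
  have hp0 := h.prob_nonneg hn
  have hB := h.measurableSet_history (n := n) Q k
  have hC : MeasurableSet {ω | successIndex P n X (k + 1) ω % K = inst P n j} :=
    h.measurable_successIndex (k + 1) (MeasurableSet.of_discrete (s := {c | c % K = inst P n j}))
  have s1 := hasSum_measureReal_fiber (μ := μ) (hB.inter hC) (h.measurable_cycleRounds (n := n) k)
  have s2 := (hasSum_roundsProb hp0 hp i.pos).mul_left
    (μ.real {ω | ∀ l ≤ k, Q l (successIndex P n X l ω)} * transProb (alpha P n) (p n) i j)
  rw [mul_one] at s2
  refine s1.unique (hasSum_of_eq s2 (fun M => ?_) rfl)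
  have h1 := h.prob_history_window hn hp Q k i j M hQ
  rw [mul_assoc, ← h1]
  refine measureReal_congr ?_
  filter_upwards [h.ae_infinite_received hn hp] with ω hω
  refine propext ?_
  change ((_ ∧ _) ∧ _) ↔ (_ ∧ _)
  rw [and_assoc]
  refine and_congr_right fun hB => ?_
  exact cycleRounds_mul_eq hω (hQ _ (hB k le_rfl))

theorem ae_inState (h : IsTransmissionProcess P ν p μ S X) (hn : ∃ k, P k = n)
    (hp : p n < 1) (k : ℕ) : ∀ᵐ ω ∂μ, ∃ y, InState P n X k y ω := by
  filter_upwards [h.ae_infinite_received hn hp] with ω hω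
  have h1 (k : ℕ) : src P (successIndex P n X k ω) = n := (Nat.nth_mem_of_infinite hω k).1
  obtain ⟨i, hi⟩ := exists_inst (h1 k)
  obtain ⟨j, hj⟩ := exists_inst (h1 (k + 1))
  exact ⟨(i, j), hi, hj⟩

theorem prob_chain (h : IsTransmissionProcess P ν p μ S X) (hn : ∃ k, P k = n)
    (hp : p n < 1) (k : ℕ) (y : ℕ → Fin (alpha P n) × Fin (alpha P n)) :
    μ.real {ω | ∀ l ≤ k + 1, InState P n X l (y l) ω} =
      μ.real {ω | ∀ l ≤ k, InState P n X l (y l) ω} *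
        chainMatrix (alpha P n) (p n) (y k) (y (k + 1)) := by
  -- Consecutive cycles share a success: success l starts cycle l and ends cycle l - 1. The states
  -- of cycles 0, …, k are thus a condition on successes 0, …, k + 1, and the last of these is
  -- constrained only as the end of cycle k.
  let Q : ℕ → ℕ → Prop := fun l c => (l ≤ k → c % K = inst P n (y l).1) ∧
    ∀ m, l = m + 1 → c % K = inst P n (y m).2
  have hQ (ω : Ω) : (∀ l ≤ k + 1, Q l (successIndex P n X l ω)) ↔
      ∀ l ≤ k, InState P n X l (y l) ω := by
    constructor
    · intro H l hl
      exact ⟨(H l (by omega)).1 hl, (H (l + 1) (by omega)).2 l rfl⟩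
    · intro H l hl
      refine ⟨fun hl' => (H l hl').1, ?_⟩
      rintro m rfl
      exact (H m (by omega)).2
  have hsplit (ω : Ω) : (∀ l ≤ k + 1, InState P n X l (y l) ω) ↔
      (∀ l ≤ k, InState P n X l (y l) ω) ∧ InState P n X (k + 1) (y (k + 1)) ω := by
    constructor
    · exact fun H => ⟨fun l hl => H l (by omega), H _ le_rfl⟩
    · rintro ⟨H1, H2⟩ l hl
      rcases Nat.le_succ_iff.1 hl with hl | rfl
      · exact H1 l hl
      · exact H2
  by_cases hy : (y (k + 1)).1 = (y k).2
  · have h1 := h.prob_history_inst hn hp Q (k + 1) (y k).2 (y (k + 1)).2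
      (fun c hc => hc.2 k rfl)
    simp only [hQ] at h1
    rw [chainMatrix, if_pos hy, hy, ← h1]
    congr 1
    ext ω
    simp only [Set.mem_ofPred_eq, hsplit]
    refine and_congr_right fun H => ?_
    unfold InState
    rw [hy]
    exact and_iff_right (H k le_rfl).2
  · rw [chainMatrix, if_neg hy, mul_zero]
    have : {ω | ∀ l ≤ k + 1, InState P n X l (y l) ω} = ∅ := by
      ext ω
      simp only [Set.mem_ofPred_eq, Set.mem_empty_iff_false, iff_false]
      intro H
      exact hy (inst_injective P n ((H (k + 1) le_rfl).1.symm.trans (H k (by omega)).2))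
    rw [this, measureReal_empty]

theorem prob_inState_rounds (h : IsTransmissionProcess P ν p μ S X) (hn : ∃ k, P k = n)
    (hp : p n < 1) (k : ℕ) (i j : Fin (alpha P n)) (M : ℕ) :
    μ.real ({ω | InState P n X k (i, j) ω} ∩ {ω | cycleRounds P n X k ω = M}) =
      μ.real {ω | InState P n X k (i, j) ω} * roundsProb (alpha P n) (p n) M := by
  let Q : ℕ → ℕ → Prop := fun l c => l = k → c % K = inst P n i
  have hQ (ω : Ω) : (∀ l ≤ k, Q l (successIndex P n X l ω)) ↔
      successIndex P n X k ω % K = inst P n i :=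
    ⟨fun H => H k le_rfl rfl, by rintro H l - rfl; exact H⟩
  have h1 := h.prob_history_window hn hp Q k i j M (fun c hc => hc rfl)
  have h2 := h.prob_history_inst hn hp Q k i j (fun c hc => hc rfl)
  simp only [hQ] at h1 h2
  have e2 : {ω | InState P n X k (i, j) ω} = {ω | successIndex P n X k ω % K = inst P n i ∧
      successIndex P n X (k + 1) ω % K = inst P n j} := rfl
  rw [e2, h2, mul_assoc, ← h1]
  refine measureReal_congr ?_
  filter_upwards [h.ae_infinite_received hn hp] with ω hω
  refine propext ?_
  change ((_ ∧ _) ∧ _) ↔ (_ ∧ _)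
  rw [and_assoc]
  refine and_congr_right fun hB => ?_
  exact cycleRounds_mul_eq hω hB

end IsTransmissionProcess

end Transmissions

/-! ### The age along a sample path -/

section Path

variable {Ω : Type*} {S : ℕ → Ω → ℝ} {X : ℕ → Ω → Bool} {N K : ℕ} [NeZero K]
  {P : Fin K → Fin N} {n : Fin N} {δ₀ : Ω → ℝ} {ω : Ω}

theorem startTime_succ (S : ℕ → Ω → ℝ) (l : ℕ) (ω : Ω) :
    startTime S (l + 1) ω = startTime S l ω + S l ω :=
  Finset.sum_range_succ _ _

theorem startTime_zero (S : ℕ → Ω → ℝ) (ω : Ω) : startTime S 0 ω = 0 := rfl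

theorem startTime_add (S : ℕ → Ω → ℝ) (l k : ℕ) (ω : Ω) :
    startTime S (l + k) ω = startTime S l ω + windowSum (fun j => S j ω) l k :=
  Finset.sum_range_add _ _ _

theorem startTime_mono (hS : ∀ l, 0 ≤ S l ω) : Monotone fun l => startTime S l ω :=
  monotone_nat_of_le_succ fun l => by rw [startTime_succ]; linarith [hS l]

open scoped Classical in
/-- The generation time of the freshest update of source `n` among the first `l` transmissions. -/
noncomputable def lastGen (P : Fin K → Fin N) (n : Fin N) (S : ℕ → Ω → ℝ) (X : ℕ → Ω → Bool)
    (ω : Ω) (δ : ℝ) : ℕ → ℝ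
  | 0 => -δ
  | l + 1 => if Received P n X ω l then startTime S l ω else lastGen P n S X ω δ l

/-- Start times increase with the number of the transmission, so the latest reception is the
freshest. A non-negative initial age keeps the initial generation time below all of them. -/
theorem lastGen_isGreatest (hS : ∀ l, 0 ≤ S l ω) {δ : ℝ} (hδ : 0 ≤ δ) (l : ℕ) :
    IsGreatest {g | g = -δ ∨ ∃ k < l, Received P n X ω k ∧ g = startTime S k ω}
      (lastGen P n S X ω δ l) := by
  induction l with
  | zero => simp [lastGen, IsGreatest, upperBounds]
  | succ l ih =>
    have h0 (k : ℕ) : 0 ≤ startTime S k ω := startTime_mono hS (Nat.zero_le k)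
    by_cases hR : Received P n X ω l
    · simp only [lastGen, if_pos hR]
      refine ⟨Or.inr ⟨l, Nat.lt_succ_self l, hR, rfl⟩, ?_⟩
      rintro g (rfl | ⟨k, hk, -, rfl⟩)
      · linarith [h0 l]
      · exact startTime_mono hS (Nat.le_of_lt_succ hk)
    · simp only [lastGen, if_neg hR]
      refine ⟨?_, ?_⟩
      · rcases ih.1 with h | ⟨k, hk, h⟩
        · exact Or.inl h
        · exact Or.inr ⟨k, by omega, h⟩
      · rintro g (rfl | ⟨k, hk, hk', rfl⟩)
        · exact ih.2 (Or.inl rfl)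
        · refine ih.2 (Or.inr ⟨k, ?_, hk', rfl⟩)
          rcases Nat.lt_succ_iff_lt_or_eq.1 hk with h | rfl
          · exact h
          · exact absurd hk' hR

theorem freshest_eq (hS : ∀ l, 0 ≤ S l ω) (hδ : 0 ≤ δ₀ ω) {l : ℕ} {t : ℝ}
    (h1 : startTime S l ω ≤ t) (h2 : t < startTime S (l + 1) ω) :
    freshest P n S X δ₀ ω t = lastGen P n S X ω (δ₀ ω) l := by
  rw [← (lastGen_isGreatest hS hδ l).csSup_eq]
  unfold freshest
  congr 1
  ext g
  refine or_congr_right (exists_congr fun k => ?_)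
  constructor
  · rintro ⟨hR, hk, rfl⟩
    refine ⟨?_, hR, rfl⟩
    by_contra hlk
    have : startTime S (l + 1) ω ≤ startTime S (k + 1) ω := startTime_mono hS (by omega)
    linarith
  · rintro ⟨hk, hR, rfl⟩
    have : startTime S (k + 1) ω ≤ startTime S l ω := startTime_mono hS hk
    exact ⟨hR, by linarith, rfl⟩

theorem freshest_bddAbove (hS : ∀ l, 0 ≤ S l ω) (t : ℝ) :
    ∀ g ∈ {g | g = -δ₀ ω ∨ ∃ k, Received P n X ω k ∧ startTime S (k + 1) ω ≤ t ∧
      g = startTime S k ω}, g ≤ max (-δ₀ ω) t := by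
  rintro g (rfl | ⟨k, -, hk, rfl⟩)
  · exact le_max_left _ _
  · rw [startTime_succ] at hk
    exact le_max_of_le_right (by linarith [hS k])

theorem freshest_mono (hS : ∀ l, 0 ≤ S l ω) : Monotone (freshest P n S X δ₀ ω) := by
  intro t u htu
  refine csSup_le_csSup ⟨_, freshest_bddAbove hS u⟩ ⟨_, Or.inl rfl⟩ ?_
  rintro g (rfl | ⟨k, hR, hk, rfl⟩)
  · exact Or.inl rfl
  · exact Or.inr ⟨k, hR, hk.trans htu, rfl⟩

theorem age_nonneg (hS : ∀ l, 0 ≤ S l ω) (hδ : 0 ≤ δ₀ ω) {t : ℝ} (ht : 0 ≤ t) :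
    0 ≤ age P n S X δ₀ ω t := by
  have : freshest P n S X δ₀ ω t ≤ max (-δ₀ ω) t :=
    csSup_le ⟨_, Or.inl rfl⟩ (freshest_bddAbove hS t)
  rw [max_eq_right (by linarith)] at this
  unfold age
  linarith

theorem intervalIntegrable_age (hS : ∀ l, 0 ≤ S l ω) (a b : ℝ) :
    IntervalIntegrable (age P n S X δ₀ ω) volume a b :=
  intervalIntegral.intervalIntegrable_id.sub (freshest_mono hS).intervalIntegrable

/-- During a transmission the set of delivered updates does not change. A possible drop of the age
at the right endpoint is invisible to the integral. -/
theorem integral_age_transmission (hS : ∀ l, 0 ≤ S l ω) (hδ : 0 ≤ δ₀ ω) (l : ℕ) :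
    ∫ t in (startTime S l ω)..(startTime S (l + 1) ω), age P n S X δ₀ ω t =
      ∫ t in (startTime S l ω)..(startTime S (l + 1) ω), (t - lastGen P n S X ω (δ₀ ω) l) := by
  have hle : startTime S l ω ≤ startTime S (l + 1) ω := startTime_mono hS (Nat.le_succ l)
  rw [intervalIntegral.integral_of_le hle, intervalIntegral.integral_of_le hle,
    integral_Ioc_eq_integral_Ioo, integral_Ioc_eq_integral_Ioo]
  refine setIntegral_congr_fun measurableSet_Ioo fun t ht => ?_
  unfold age
  rw [freshest_eq hS hδ ht.1.le ht.2]

open scoped Classical in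
/-- The age at the start of transmission `l`, if the age at time `0` is `δ`. -/
noncomputable def ageAt (P : Fin K → Fin N) (n : Fin N) (S : ℕ → Ω → ℝ) (X : ℕ → Ω → Bool)
    (δ : ℝ) : ℕ → Ω → ℝ
  | 0, _ => δ
  | l + 1, ω => if Received P n X ω l then S l ω else ageAt P n S X δ l ω + S l ω

theorem ageAt_eq (δ : ℝ) (l : ℕ) :
    ageAt P n S X δ l ω = startTime S l ω - lastGen P n S X ω δ l := by
  induction l with
  | zero => simp [ageAt, lastGen, startTime_zero]
  | succ l ih =>
    simp only [ageAt, lastGen, startTime_succ]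
    split_ifs
    · ring
    · rw [ih]; ring

theorem integral_age_startTime (hS : ∀ l, 0 ≤ S l ω) (hδ : 0 ≤ δ₀ ω) (L : ℕ) :
    ∫ t in (0 : ℝ)..(startTime S L ω), age P n S X δ₀ ω t =
      ∑ l ∈ Finset.range L, (ageAt P n S X (δ₀ ω) l ω * S l ω + S l ω ^ 2 / 2) := by
  have h := intervalIntegral.sum_integral_adjacent_intervals (μ := volume)
    (f := age P n S X δ₀ ω) (a := fun l => startTime S l ω) (n := L)
    (fun k _ => intervalIntegrable_age hS _ _)
  rw [startTime_zero] at h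
  rw [← h]
  refine Finset.sum_congr rfl fun l _ => ?_
  rw [integral_age_transmission hS hδ, intervalIntegral.integral_sub
    intervalIntegral.intervalIntegrable_id intervalIntegrable_const, integral_id,
    intervalIntegral.integral_const, ageAt_eq, startTime_succ, smul_eq_mul]
  ring

/-- Until the cycle ends, the freshest update is the one whose delivery started it, so the age grows
linearly from the service time of that update. The area is that of a trapezoid. -/
theorem cycleArea_eq (hS : ∀ l, 0 ≤ S l ω) (hδ : 0 ≤ δ₀ ω)
    (hR : {k | Received P n X ω k}.Infinite) (k : ℕ) :
    cycleArea P n S X δ₀ k ω =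
      cycleTime P n S X k ω ^ 2 / 2 + cycleTime P n S X k ω * S (successIndex P n X k ω) ω := by
  set a := successIndex P n X k ω with ha
  set b := successIndex P n X (k + 1) ω with hb
  have hab : a < b := nth_lt_nth_succ hR k
  have hRa : Received P n X ω a := Nat.nth_mem_of_infinite hR k
  have hgen (m : ℕ) (hm : a + 1 + m ≤ b) :
      lastGen P n S X ω (δ₀ ω) (a + 1 + m) = startTime S a ω := by
    induction m with
    | zero => simp [lastGen, hRa]
    | succ m ih =>
      have : ¬ Received P n X ω (a + 1 + m) :=
        not_of_nth_lt_lt (R := Received P n X ω) hR (k := k) (show a < _ by omega)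
          (show _ < b by omega)
      rw [← add_assoc, lastGen, if_neg this, ih (by omega)]
  have h1 := intervalIntegral.sum_integral_adjacent_intervals_Ico (μ := volume)
    (f := age P n S X δ₀ ω) (a := fun l => startTime S l ω) (m := a + 1) (n := b + 1) (by omega)
    (fun k _ => intervalIntegrable_age hS _ _)
  have h2 := intervalIntegral.sum_integral_adjacent_intervals_Ico (μ := volume)
    (f := fun t => t - startTime S a ω) (a := fun l => startTime S l ω) (m := a + 1) (n := b + 1)
    (by omega) (fun k _ => intervalIntegral.intervalIntegrable_id.sub intervalIntegrable_const)
  have h3 : cycleArea P n S X δ₀ k ω =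
      ∫ t in (startTime S (a + 1) ω)..(startTime S (b + 1) ω), (t - startTime S a ω) := by
    unfold cycleArea
    rw [← ha, ← hb, ← h1, ← h2]
    refine Finset.sum_congr rfl fun l hl => ?_
    rw [Finset.mem_Ico] at hl
    have := hgen (l - (a + 1)) (by omega)
    rw [Nat.add_sub_cancel' hl.1] at this
    rw [integral_age_transmission hS hδ, this]
  rw [h3, intervalIntegral.integral_sub intervalIntegral.intervalIntegrable_id
    intervalIntegrable_const, integral_id, intervalIntegral.integral_const, smul_eq_mul]
  unfold cycleTime
  rw [← ha, ← hb, startTime_succ S a]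
  ring

end Path

/-! ### Moments of the service times and of sums over windows -/

section Moments

variable {Ω : Type*} [mΩ : MeasurableSpace Ω] {S : ℕ → Ω → ℝ} {X : ℕ → Ω → Bool}
  {N K : ℕ} [NeZero K] {P : Fin K → Fin N} {ν : Fin N → Measure ℝ} {p : Fin N → ℝ}
  {μ : Measure Ω} {n : Fin N}

/-- The mean service time of transmission `l`. -/
noncomputable def meanAt (P : Fin K → Fin N) (ν : Fin N → Measure ℝ) (l : ℕ) : ℝ :=
  serviceMean ν (src P l)

/-- The variance of the service time of transmission `l`. -/
noncomputable def varAt (P : Fin K → Fin N) (ν : Fin N → Measure ℝ) (l : ℕ) : ℝ :=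
  serviceVar ν (src P l)

theorem meanAt_period (l : ℕ) : meanAt P ν (l + K) = meanAt P ν l := by
  simp [meanAt, src_add_period]

theorem varAt_period (l : ℕ) : varAt P ν (l + K) = varAt P ν l := by
  simp [varAt, src_add_period]

theorem sum_meanAt : ∑ l ∈ Finset.range K, meanAt P ν l = patternMean P ν := by
  simp [meanAt, patternMean, sum_range_src P (serviceMean ν)]

theorem sum_varAt : ∑ l ∈ Finset.range K, varAt P ν l = patternVar P ν := by
  simp [varAt, patternVar, sum_range_src P (serviceVar ν)]

namespace IsTransmissionProcess

variable [IsProbabilityMeasure μ]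

theorem memLp_service (h : IsTransmissionProcess P ν p μ S X)
    (hν : ∀ m, MemLp (fun x : ℝ => x) 2 (ν m)) (l : ℕ) : MemLp (S l) 2 μ := by
  have := hν (src P l)
  rw [← h.law_service l] at this
  exact (memLp_map_measure_iff aestronglyMeasurable_id (h.measurable_service l).aemeasurable).1 this

theorem integrable_service (h : IsTransmissionProcess P ν p μ S X)
    (hν : ∀ m, MemLp (fun x : ℝ => x) 2 (ν m)) (l : ℕ) : Integrable (S l) μ :=
  (h.memLp_service hν l).integrable one_le_two

theorem integral_comp_service (h : IsTransmissionProcess P ν p μ S X) (l : ℕ) {φ : ℝ → ℝ}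
    (hφ : Measurable φ) : ∫ ω, φ (S l ω) ∂μ = ∫ x, φ x ∂(ν (src P l)) := by
  rw [← h.law_service l, integral_map (h.measurable_service l).aemeasurable
    hφ.aestronglyMeasurable]

theorem integral_service (h : IsTransmissionProcess P ν p μ S X) (l : ℕ) :
    ∫ ω, S l ω ∂μ = meanAt P ν l :=
  h.integral_comp_service l measurable_id

theorem integral_service_sq (h : IsTransmissionProcess P ν p μ S X) (l : ℕ) :
    ∫ ω, S l ω ^ 2 ∂μ = varAt P ν l + meanAt P ν l ^ 2 := by
  rw [h.integral_comp_service l (φ := fun x => x ^ 2) (measurable_id.pow_const 2), varAt,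
    serviceVar, meanAt]
  ring

theorem variance_service (h : IsTransmissionProcess P ν p μ S X)
    (hν : ∀ m, MemLp (fun x : ℝ => x) 2 (ν m)) (l : ℕ) : variance (S l) μ = varAt P ν l := by
  rw [variance_eq_sub (h.memLp_service hν l)]
  have := h.integral_service_sq l
  simp only [Pi.pow_apply]
  rw [this, h.integral_service]
  ring

theorem ae_service_nonneg (h : IsTransmissionProcess P ν p μ S X)
    (hν : ∀ m, ∀ᵐ x ∂(ν m), 0 ≤ x) : ∀ᵐ ω ∂μ, ∀ l, 0 ≤ S l ω := by
  rw [ae_all_iff]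
  intro l
  have := hν (src P l)
  rw [← h.law_service l] at this
  exact ae_of_ae_map (h.measurable_service l).aemeasurable this

theorem memLp_windowSum (h : IsTransmissionProcess P ν p μ S X)
    (hν : ∀ m, MemLp (fun x : ℝ => x) 2 (ν m)) (l k : ℕ) :
    MemLp (fun ω => windowSum (fun j => S j ω) l k) 2 μ :=
  memLp_finsetSum _ fun _ _ => h.memLp_service hν _

theorem integral_windowSum (h : IsTransmissionProcess P ν p μ S X)
    (hν : ∀ m, MemLp (fun x : ℝ => x) 2 (ν m)) (l k : ℕ) :
    ∫ ω, windowSum (fun j => S j ω) l k ∂μ = windowSum (meanAt P ν) l k := by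
  unfold windowSum
  rw [integral_finsetSum _ fun _ _ => h.integrable_service hν _]
  simp only [h.integral_service]

theorem variance_windowSum (h : IsTransmissionProcess P ν p μ S X)
    (hν : ∀ m, MemLp (fun x : ℝ => x) 2 (ν m)) (l k : ℕ) :
    variance (fun ω => windowSum (fun j => S j ω) l k) μ = windowSum (varAt P ν) l k := by
  have := IndepFun.variance_sum (μ := μ) (X := fun j => S (l + j)) (s := Finset.range k)
    (fun j _ => h.memLp_service hν _)
    (fun i _ j _ hij => h.indep_service.indepFun (by omega))
  simp only [h.variance_service hν] at this
  unfold windowSum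
  rw [← this]
  congr 1
  funext ω
  simp

theorem integral_windowSum_sq (h : IsTransmissionProcess P ν p μ S X)
    (hν : ∀ m, MemLp (fun x : ℝ => x) 2 (ν m)) (l k : ℕ) :
    ∫ ω, windowSum (fun j => S j ω) l k ^ 2 ∂μ =
      windowSum (varAt P ν) l k + windowSum (meanAt P ν) l k ^ 2 := by
  have h1 := variance_eq_sub (h.memLp_windowSum hν l k)
  rw [h.variance_windowSum hν, h.integral_windowSum hν] at h1
  simp only [Pi.pow_apply] at h1
  linarith

theorem integrable_windowSum_mul (h : IsTransmissionProcess P ν p μ S X)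
    (hν : ∀ m, MemLp (fun x : ℝ => x) 2 (ν m)) (a l k : ℕ) :
    Integrable (fun ω => windowSum (fun j => S j ω) l k * S a ω) μ :=
  (h.memLp_windowSum hν l k).integrable_mul (h.memLp_service hν a)

theorem integral_windowSum_mul (h : IsTransmissionProcess P ν p μ S X)
    (hν : ∀ m, MemLp (fun x : ℝ => x) 2 (ν m)) {a l : ℕ} (hal : a < l) (k : ℕ) :
    ∫ ω, windowSum (fun j => S j ω) l k * S a ω ∂μ =
      windowSum (meanAt P ν) l k * meanAt P ν a := by
  unfold windowSum
  simp only [Finset.sum_mul]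
  have hint (j : ℕ) : Integrable (fun ω => S (l + j) ω * S a ω) μ :=
    (h.memLp_service hν (l + j)).integrable_mul (h.memLp_service hν a)
  rw [integral_finsetSum _ fun j _ => hint j]
  refine Finset.sum_congr rfl fun j _ => ?_
  have := (h.indep_service.indepFun (i := l + j) (j := a) (by omega)).integral_mul_eq_mul_integral
    (h.measurable_service _).aestronglyMeasurable (h.measurable_service _).aestronglyMeasurable
  rw [h.integral_service, h.integral_service] at this
  exact this

theorem round_moments (h : IsTransmissionProcess P ν p μ S X)
    (hν : ∀ m, MemLp (fun x : ℝ => x) 2 (ν m)) (q : ℕ) :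
    ∫ ω, (∑ l ∈ Finset.Ico q (q + K), S l ω) ∂μ = patternMean P ν ∧
      variance (fun ω => ∑ l ∈ Finset.Ico q (q + K), S l ω) μ = patternVar P ν := by
  have e (ω : Ω) := sum_Ico_eq_windowSum (fun l => S l ω) q K
  simp only [e]
  rw [h.integral_windowSum hν, h.variance_windowSum hν, ← sum_meanAt, ← sum_varAt]
  exact ⟨sum_range_period _ meanAt_period q, sum_range_period _ varAt_period q⟩

theorem partialDuration_eq (i j : Fin (alpha P n)) (ω : Ω) : partialDuration P n S i j ω =
    windowSum (fun l => S l ω) (inst P n i + 1) (windowLength P n i j) := by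
  rw [← sum_Ico_eq_windowSum]
  unfold partialDuration
  refine Finset.sum_congr ?_ fun _ _ => rfl
  ext l
  simp only [Finset.mem_Ioc, Finset.mem_Ico]
  omega

theorem partialMean_eq (h : IsTransmissionProcess P ν p μ S X)
    (hν : ∀ m, MemLp (fun x : ℝ => x) 2 (ν m)) (i j : Fin (alpha P n)) :
    partialMean P n μ S i j =
      windowSum (meanAt P ν) (inst P n i + 1) (windowLength P n i j) := by
  unfold partialMean
  simp only [partialDuration_eq]
  exact h.integral_windowSum hν _ _

theorem partialSecond_eq (h : IsTransmissionProcess P ν p μ S X)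
    (hν : ∀ m, MemLp (fun x : ℝ => x) 2 (ν m)) (i j : Fin (alpha P n)) :
    partialSecond P n μ S i j =
      windowSum (varAt P ν) (inst P n i + 1) (windowLength P n i j) +
      windowSum (meanAt P ν) (inst P n i + 1) (windowLength P n i j) ^ 2 := by
  unfold partialSecond
  simp only [partialDuration_eq]
  exact h.integral_windowSum_sq hν _ _

end IsTransmissionProcess

end Moments

/-- Summability of real series is absolute here, so the sum provides integrability as well as the
value of the integral. -/
theorem integrable_of_hasSum_law {ρ : Measure ℕ} [IsFiniteMeasure ρ] {φ : ℕ → ℝ} {c : ℝ}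
    (h : HasSum (fun m => ρ.real {m} * φ m) c) : Integrable φ ρ ∧ ∫ m, φ m ∂ρ = c := by
  have hint : Integrable φ ρ := by
    refine ⟨(measurable_of_countable φ).aestronglyMeasurable, ?_⟩
    rw [HasFiniteIntegral, lintegral_countable']
    have h1 : Summable fun m => ρ.real {m} * |φ m| := by
      refine h.summable.abs.congr fun m => ?_
      rw [abs_mul, abs_of_nonneg measureReal_nonneg]
    have h2 (m : ℕ) : ‖φ m‖ₑ * ρ {m} = ENNReal.ofReal (ρ.real {m} * |φ m|) := by
      rw [ENNReal.ofReal_mul measureReal_nonneg, ofReal_measureReal, mul_comm,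
        ← ofReal_norm, Real.norm_eq_abs]
    simp only [h2]
    rw [← ENNReal.ofReal_tsum_of_nonneg
      (fun m => mul_nonneg measureReal_nonneg (abs_nonneg _)) h1]
    exact ENNReal.ofReal_lt_top
  refine ⟨hint, ?_⟩
  rw [integral_countable hint]
  simpa using h.tsum_eq

/-! ### Cycles conditioned on their state -/

section Conditional

variable {Ω : Type*} [mΩ : MeasurableSpace Ω] {S : ℕ → Ω → ℝ} {X : ℕ → Ω → Bool}
  {N K : ℕ} [NeZero K] {P : Fin K → Fin N} {ν : Fin N → Measure ℝ} {p : Fin N → ℝ}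
  {μ : Measure Ω} {n : Fin N} [IsProbabilityMeasure μ]

namespace IsTransmissionProcess

/-- State, starting position and number of rounds are functions of the drops. Conditioning on the
state therefore neither changes the law of the service times nor couples them to the position and
the rounds. -/
theorem map_cond_inState (h : IsTransmissionProcess P ν p μ S X) {k : ℕ} {i j : Fin (alpha P n)}
    (h0 : μ {ω | InState P n X k (i, j) ω} ≠ 0) :
    (cond μ {ω | InState P n X k (i, j) ω}).map
      (fun ω => ((successIndex P n X k ω, cycleRounds P n X k ω), fun l => S l ω)) =
    ((cond μ {ω | InState P n X k (i, j) ω}).map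
      (fun ω => (successIndex P n X k ω, cycleRounds P n X k ω))).prod
      (μ.map fun ω l => S l ω) := by
  have hD : Measurable fun ω => (successIndex P n X k ω, cycleRounds P n X k ω) :=
    (h.measurable_successIndex k).prodMk (h.measurable_cycleRounds k)
  have hI := h.measurableSet_inState (n := n) k (i, j)
  have := cond_isProbabilityMeasure h0
  have : IsProbabilityMeasure (μ.map fun ω l => S l ω) :=
    Measure.isProbabilityMeasure_map h.measurable_services.aemeasurable
  symm
  refine Measure.prod_eq fun A B hA hB => ?_
  rw [Measure.map_apply (hD.prodMk h.measurable_services) (hA.prod hB), Measure.map_apply hD hA,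
    Measure.map_apply h.measurable_services hB, cond_apply hI, cond_apply hI, mul_assoc]
  congr 1
  let s := fun (k : ℕ) (x : ℕ → Bool) => successOf P n k x
  have hs (k : ℕ) : Measurable (s k) := measurable_successOf k
  -- The event expressed through the sequence of drops alone, to which independence from the
  -- services applies.
  let C : Set (ℕ → Bool) := {x | (s k x % K = inst P n i ∧ s (k + 1) x % K = inst P n j) ∧
    (s k x, (s (k + 1) x - s k x - 1) / K) ∈ A}
  have hC : MeasurableSet C := by
    refine MeasurableSet.inter (MeasurableSet.inter ?_ ?_) ?_
    · exact hs k (MeasurableSet.of_discrete (s := {c | c % K = inst P n i}))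
    · exact hs (k + 1) (MeasurableSet.of_discrete (s := {c | c % K = inst P n j}))
    · exact ((hs k).prodMk ((((hs (k + 1)).sub (hs k)).sub_const 1).div_const K)) hA
  have := (indepFun_iff_measure_inter_preimage_eq_mul.1 h.indep_service_success) B C hB hC
  rw [Set.inter_comm, mul_comm] at this
  refine Eq.trans ?_ this
  congr 1
  ext ω
  change (_ ∧ (_ ∧ _)) ↔ ((_ ∧ _) ∧ _)
  rw [and_assoc]
  rfl

theorem ae_cond_inState (h : IsTransmissionProcess P ν p μ S X) (hn : ∃ k, P k = n)
    (hp : p n < 1) (k : ℕ) (i j : Fin (alpha P n)) :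
    ∀ᵐ ω ∂(cond μ {ω | InState P n X k (i, j) ω}), successIndex P n X k ω % K = inst P n i ∧
      successIndex P n X (k + 1) ω =
        successIndex P n X k ω + windowLength P n i j + cycleRounds P n X k ω * K := by
  have h1 := ae_cond_mem (μ := μ) (h.measurableSet_inState (n := n) k (i, j))
  have h2 : ∀ᵐ ω ∂(cond μ {ω | InState P n X k (i, j) ω}), {k | Received P n X ω k}.Infinite :=
    cond_absolutelyContinuous.ae_le (h.ae_infinite_received hn hp)
  filter_upwards [h1, h2] with ω hω hω'
  exact ⟨hω.1, (cycleRounds_mul_eq hω' hω.1).1 ⟨hω.2, rfl⟩⟩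

theorem cond_rounds (h : IsTransmissionProcess P ν p μ S X) (hn : ∃ k, P k = n)
    (hp : p n < 1) {k : ℕ} {i j : Fin (alpha P n)}
    (h0 : μ {ω | InState P n X k (i, j) ω} ≠ 0) (M : ℕ) :
    (cond μ {ω | InState P n X k (i, j) ω}).real {ω | cycleRounds P n X k ω = M} =
      roundsProb (alpha P n) (p n) M := by
  have hI := h.measurableSet_inState (n := n) k (i, j)
  rw [measureReal_def, cond_apply hI, ENNReal.toReal_mul, ENNReal.toReal_inv]
  have h1 := h.prob_inState_rounds hn hp k i j M
  rw [measureReal_def, measureReal_def] at h1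
  rw [h1]
  have : (μ {ω | InState P n X k (i, j) ω}).toReal ≠ 0 :=
    ENNReal.toReal_ne_zero.2 ⟨h0, measure_ne_top _ _⟩
  field_simp

/-- Conditional expectation, given the state of a cycle, of a function of the start of the cycle,
the number of rounds and the service times. -/
theorem integral_cond_inState (h : IsTransmissionProcess P ν p μ S X) (hn : ∃ k, P k = n)
    (hp : p n < 1) {k : ℕ} {i j : Fin (alpha P n)}
    (h0 : μ {ω | InState P n X k (i, j) ω} ≠ 0) (f : ℕ → ℕ → (ℕ → ℝ) → ℝ)
    (hf : ∀ a M, Measurable (f a M)) (φ : ℕ → ℝ) (c : ℝ)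
    (hfint : ∀ a M, a % K = inst P n i → Integrable (fun ω => f a M fun l => S l ω) μ)
    (hfpos : ∀ a M, ∀ᵐ ω ∂μ, 0 ≤ f a M fun l => S l ω)
    (hφ : ∀ a M, a % K = inst P n i → ∫ ω, f a M (fun l => S l ω) ∂μ = φ M)
    (hc : HasSum (fun M => roundsProb (alpha P n) (p n) M * φ M) c) (g : Ω → ℝ)
    (hg : ∀ᵐ ω ∂(cond μ {ω | InState P n X k (i, j) ω}),
      g ω = f (successIndex P n X k ω) (cycleRounds P n X k ω) fun l => S l ω) :
    Integrable g (cond μ {ω | InState P n X k (i, j) ω}) ∧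
      ∫ ω, g ω ∂(cond μ {ω | InState P n X k (i, j) ω}) = c := by
  set μ' := cond μ {ω | InState P n X k (i, j) ω} with hμ'
  have : IsProbabilityMeasure μ' := cond_isProbabilityMeasure h0
  have hD : Measurable fun ω => (successIndex P n X k ω, cycleRounds P n X k ω) :=
    (h.measurable_successIndex k).prodMk (h.measurable_cycleRounds k)
  let F : (ℕ × ℕ) × (ℕ → ℝ) → ℝ := fun z => f z.1.1 z.1.2 z.2
  have hF : Measurable F := measurable_from_prod_countable_right fun d => hf d.1 d.2
  have hS := h.measurable_services
  have hmap := h.map_cond_inState h0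
  have hDS := hD.prodMk hS
  have hae : ∀ᵐ d ∂(μ'.map fun ω => (successIndex P n X k ω, cycleRounds P n X k ω)),
      d.1 % K = inst P n i := by
    rw [ae_map_iff hD.aemeasurable (MeasurableSet.of_discrete)]
    filter_upwards [h.ae_cond_inState hn hp k i j] with ω hω using hω.1
  have hrounds := integrable_of_hasSum_law (ρ := μ'.map (cycleRounds P n X k)) (φ := φ) (c := c) (by
    refine hasSum_of_eq hc (fun M => ?_) rfl
    rw [map_measureReal_apply (h.measurable_cycleRounds k) (measurableSet_singleton M),
      ← h.cond_rounds hn hp h0 M]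
    rfl)
  -- By non-negativity the integral of the norm is again φ(M), so Fubini integrability reduces to
  -- integrability of φ under the law of M.
  have hnorm (d : ℕ × ℕ) : ∫ x, ‖F (d, x)‖ ∂(μ.map fun ω l => S l ω) =
      ∫ ω, f d.1 d.2 (fun l => S l ω) ∂μ := by
    rw [integral_map hS.aemeasurable (hf d.1 d.2).norm.aestronglyMeasurable]
    refine integral_congr_ae ?_
    filter_upwards [hfpos d.1 d.2] with ω hω
    exact Real.norm_of_nonneg hω
  have hval (d : ℕ × ℕ) : ∫ x, F (d, x) ∂(μ.map fun ω l => S l ω) =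
      ∫ ω, f d.1 d.2 (fun l => S l ω) ∂μ :=
    integral_map hS.aemeasurable (hf d.1 d.2).aestronglyMeasurable
  have hφD : Integrable (fun d : ℕ × ℕ => φ d.2)
      (μ'.map fun ω => (successIndex P n X k ω, cycleRounds P n X k ω)) := by
    rw [integrable_map_measure (measurable_of_countable _).aestronglyMeasurable hD.aemeasurable]
    exact (integrable_map_measure (measurable_of_countable _).aestronglyMeasurable
      (h.measurable_cycleRounds k).aemeasurable).1 hrounds.1
  have : IsProbabilityMeasure (μ.map fun ω l => S l ω) :=
    Measure.isProbabilityMeasure_map hS.aemeasurable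
  have : IsProbabilityMeasure
      (μ'.map fun ω => (successIndex P n X k ω, cycleRounds P n X k ω)) :=
    Measure.isProbabilityMeasure_map hD.aemeasurable
  have hFint : Integrable F ((μ'.map fun ω => (successIndex P n X k ω, cycleRounds P n X k ω)).prod
      (μ.map fun ω l => S l ω)) := by
    rw [integrable_prod_iff hF.aestronglyMeasurable]
    refine ⟨?_, ?_⟩
    · filter_upwards [hae] with d hd
      exact (integrable_map_measure (hf d.1 d.2).aestronglyMeasurable hS.aemeasurable).2
        (hfint d.1 d.2 hd)
    · refine hφD.congr ?_
      filter_upwards [hae] with d hd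
      rw [hnorm, hφ _ _ hd]
  have hFint' := hFint
  rw [← hmap, integrable_map_measure hF.aestronglyMeasurable hDS.aemeasurable] at hFint'
  refine ⟨hFint'.congr ?_, ?_⟩
  · filter_upwards [hg] with ω hω using hω.symm
  · have h1 : ∫ ω, g ω ∂μ' = ∫ z, F z ∂(μ'.map
        (fun ω => ((successIndex P n X k ω, cycleRounds P n X k ω), fun l => S l ω))) := by
      rw [integral_map hDS.aemeasurable hF.aestronglyMeasurable]
      exact integral_congr_ae hg
    rw [h1, hmap, integral_prod _ hFint]
    have h2 : ∫ d, ∫ x, F (d, x) ∂(μ.map fun ω l => S l ω)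
        ∂(μ'.map fun ω => (successIndex P n X k ω, cycleRounds P n X k ω)) =
        ∫ d, φ d.2 ∂(μ'.map fun ω => (successIndex P n X k ω, cycleRounds P n X k ω)) := by
      refine integral_congr_ae ?_
      filter_upwards [hae] with d hd
      rw [hval, hφ _ _ hd]
    rw [h2, integral_map hD.aemeasurable (measurable_of_countable _).aestronglyMeasurable,
      ← hrounds.2, integral_map (h.measurable_cycleRounds k).aemeasurable
        (measurable_of_countable _).aestronglyMeasurable]

theorem measurable_windowSum (l k : ℕ) : Measurable fun x : ℕ → ℝ => windowSum x l k :=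
  Finset.measurable_sum _ fun _ _ => measurable_pi_apply _

theorem ae_windowSum_nonneg (h : IsTransmissionProcess P ν p μ S X)
    (hν0 : ∀ m, ∀ᵐ x ∂(ν m), 0 ≤ x) (l k : ℕ) :
    ∀ᵐ ω ∂μ, 0 ≤ windowSum (fun j => S j ω) l k := by
  filter_upwards [h.ae_service_nonneg hν0] with ω hω
  exact Finset.sum_nonneg fun _ _ => hω _

theorem windowSum_period_mod {f : ℕ → ℝ} (hf : ∀ l, f (l + K) = f l) {a : ℕ}
    {i : Fin (alpha P n)} (ha : a % K = inst P n i) (M k : ℕ) :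
    windowSum f (a + 1 + M * K) k = windowSum f (inst P n i + 1) k := by
  rw [show a + 1 + M * K = (a + M * K) + 1 by ring, windowSum_mod hf, Nat.add_mul_mod_self_right,
    ha]

/-- After the M rounds there remains a window of fixed length whose moments depend only on its
starting place modulo K. They are constant in M, so averaging over M has no effect. -/
theorem cond_partial (h : IsTransmissionProcess P ν p μ S X) (hn : ∃ k, P k = n)
    (hp : p n < 1) (hν0 : ∀ m, ∀ᵐ x ∂(ν m), 0 ≤ x) (hν : ∀ m, MemLp (fun x : ℝ => x) 2 (ν m))
    {k : ℕ} {i j : Fin (alpha P n)} (h0 : μ {ω | InState P n X k (i, j) ω} ≠ 0) :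
    MemLp (cyclePartial P n S X k) 2 (cond μ {ω | InState P n X k (i, j) ω}) ∧
      ∫ ω, cyclePartial P n S X k ω ∂(cond μ {ω | InState P n X k (i, j) ω}) =
        partialMean P n μ S i j ∧
      ∫ ω, cyclePartial P n S X k ω ^ 2 ∂(cond μ {ω | InState P n X k (i, j) ω}) =
        partialSecond P n μ S i j := by
  have hp0 := h.prob_nonneg hn
  have hcp : ∀ᵐ ω ∂(cond μ {ω | InState P n X k (i, j) ω}), cyclePartial P n S X k ω =
      windowSum (fun l => S l ω) (successIndex P n X k ω + 1 + cycleRounds P n X k ω * K)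
        (windowLength P n i j) := by
    filter_upwards [h.ae_cond_inState hn hp k i j] with ω hω
    unfold cyclePartial
    rw [hω.2, show successIndex P n X k ω + windowLength P n i j + cycleRounds P n X k ω * K + 1 =
      (successIndex P n X k ω + 1 + cycleRounds P n X k ω * K) + windowLength P n i j by ring,
      startTime_add, add_sub_cancel_left]
  have hconst (c : ℝ) : HasSum (fun M => roundsProb (alpha P n) (p n) M * c) c := by
    simpa using (hasSum_roundsProb hp0 hp i.pos).mul_right c
  have h1 := h.integral_cond_inState hn hp h0
    (fun a M x => windowSum x (a + 1 + M * K) (windowLength P n i j))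
    (fun a M => measurable_windowSum _ _) (fun _ => partialMean P n μ S i j) _
    (fun a M _ => (h.memLp_windowSum hν _ _).integrable one_le_two)
    (fun a M => h.ae_windowSum_nonneg hν0 _ _)
    (fun a M ha => by
      rw [h.integral_windowSum hν, h.partialMean_eq hν, windowSum_period_mod meanAt_period ha])
    (hconst _) _ hcp
  have h2 := h.integral_cond_inState hn hp h0
    (fun a M x => windowSum x (a + 1 + M * K) (windowLength P n i j) ^ 2)
    (fun a M => (measurable_windowSum _ _).pow_const 2) (fun _ => partialSecond P n μ S i j) _
    (fun a M _ => (h.memLp_windowSum hν _ _).integrable_sq)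
    (fun a M => Eventually.of_forall fun _ => sq_nonneg _)
    (fun a M ha => by
      rw [h.integral_windowSum_sq hν, h.partialSecond_eq hν, windowSum_period_mod meanAt_period ha,
        windowSum_period_mod varAt_period ha])
    (hconst _) (fun ω => cyclePartial P n S X k ω ^ 2)
    (by filter_upwards [hcp] with ω hω; rw [hω])
  exact ⟨(memLp_two_iff_integrable_sq h1.1.1).2 h2.1, h1.2, h2.2⟩

theorem ae_cycleTime (h : IsTransmissionProcess P ν p μ S X) (hn : ∃ k, P k = n)
    (hp : p n < 1) (k : ℕ) (i j : Fin (alpha P n)) :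
    ∀ᵐ ω ∂(cond μ {ω | InState P n X k (i, j) ω}), cycleTime P n S X k ω =
      windowSum (fun l => S l ω) (successIndex P n X k ω + 1)
        (windowLength P n i j + cycleRounds P n X k ω * K) := by
  filter_upwards [h.ae_cond_inState hn hp k i j] with ω hω
  unfold cycleTime
  rw [hω.2, show successIndex P n X k ω + windowLength P n i j + cycleRounds P n X k ω * K + 1 =
    (successIndex P n X k ω + 1) + (windowLength P n i j + cycleRounds P n X k ω * K) by ring,
    startTime_add, add_sub_cancel_left]

theorem windowSum_rounds {f : ℕ → ℝ} (hf : ∀ l, f (l + K) = f l) {a : ℕ}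
    {i : Fin (alpha P n)} (ha : a % K = inst P n i) (k M : ℕ) :
    windowSum f (a + 1) (k + M * K) =
      windowSum f (inst P n i + 1) k + M * ∑ l ∈ Finset.range K, f l := by
  rw [windowSum_add_period hf, windowSum_mod hf, ha]

theorem cond_cycleTime (h : IsTransmissionProcess P ν p μ S X) (hn : ∃ k, P k = n)
    (hp : p n < 1) (hν0 : ∀ m, ∀ᵐ x ∂(ν m), 0 ≤ x) (hν : ∀ m, MemLp (fun x : ℝ => x) 2 (ν m))
    {k : ℕ} {i j : Fin (alpha P n)} (h0 : μ {ω | InState P n X k (i, j) ω} ≠ 0) :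
    Integrable (cycleTime P n S X k) (cond μ {ω | InState P n X k (i, j) ω}) ∧
      ∫ ω, cycleTime P n S X k ω ∂(cond μ {ω | InState P n X k (i, j) ω}) =
        roundsMean (alpha P n) (p n) * patternMean P ν + partialMean P n μ S i j := by
  have hp0 := h.prob_nonneg hn
  refine h.integral_cond_inState hn hp h0
    (fun a M x => windowSum x (a + 1) (windowLength P n i j + M * K))
    (fun a M => measurable_windowSum _ _)
    (fun M => partialMean P n μ S i j + M * patternMean P ν) _
    (fun a M _ => (h.memLp_windowSum hν _ _).integrable one_le_two)
    (fun a M => h.ae_windowSum_nonneg hν0 _ _)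
    (fun a M ha => by
      rw [h.integral_windowSum hν, h.partialMean_eq hν, windowSum_rounds meanAt_period ha,
        sum_meanAt])
    ?_ _ (h.ae_cycleTime hn hp k i j)
  exact hasSum_of_eq (hasSum_roundsProb_quadratic hp0 hp i.pos (partialMean P n μ S i j)
    (patternMean P ν) 0) (fun M => by ring) (by ring)

theorem cond_cycleArea (h : IsTransmissionProcess P ν p μ S X) (hn : ∃ k, P k = n)
    (hp : p n < 1) (hν0 : ∀ m, ∀ᵐ x ∂(ν m), 0 ≤ x) (hν : ∀ m, MemLp (fun x : ℝ => x) 2 (ν m))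
    {δ₀ : Ω → ℝ} (hδ : ∀ ω, 0 ≤ δ₀ ω)
    {k : ℕ} {i j : Fin (alpha P n)} (h0 : μ {ω | InState P n X k (i, j) ω} ≠ 0) :
    Integrable (cycleArea P n S X δ₀ k) (cond μ {ω | InState P n X k (i, j) ω}) ∧
      ∫ ω, cycleArea P n S X δ₀ k ω ∂(cond μ {ω | InState P n X k (i, j) ω}) =
        (roundsSecond (alpha P n) (p n) * patternMean P ν ^ 2 +
          roundsMean (alpha P n) (p n) *
            (2 * serviceMean ν n * patternMean P ν + patternVar P ν) +
          partialSecond P n μ S i j +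
          2 * partialMean P n μ S i j *
            (roundsMean (alpha P n) (p n) * patternMean P ν + serviceMean ν n)) / 2 := by
  have hp0 := h.prob_nonneg hn
  refine h.integral_cond_inState hn hp h0
    (fun a M x => windowSum x (a + 1) (windowLength P n i j + M * K) ^ 2 / 2 +
      windowSum x (a + 1) (windowLength P n i j + M * K) * x a)
    (fun a M => (((measurable_windowSum _ _).pow_const 2).div_const 2).add
      ((measurable_windowSum _ _).mul (measurable_pi_apply a)))
    -- Expectation of T²/2 + T s for fixed M. Adding M rounds adds M times the round variance to the
    -- variance of T and M times the round mean to its mean. The last product uses that the starting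
    -- success lies before the window, hence is independent of T.
    (fun M => (partialSecond P n μ S i j + M * (patternVar P ν +
      2 * partialMean P n μ S i j * patternMean P ν) + M ^ 2 * patternMean P ν ^ 2) / 2 +
      (partialMean P n μ S i j + M * patternMean P ν) * serviceMean ν n) _
    (fun a M _ => ((h.memLp_windowSum hν _ _).integrable_sq.div_const 2).add
      (h.integrable_windowSum_mul hν _ _ _))
    (fun a M => ?_) (fun a M ha => ?_) ?_ _ ?_
  · filter_upwards [h.ae_windowSum_nonneg hν0 (a + 1) (windowLength P n i j + M * K),
      h.ae_service_nonneg hν0] with ω h1 h2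
    exact add_nonneg (by positivity) (mul_nonneg h1 (h2 a))
  · rw [integral_add ((h.memLp_windowSum hν _ _).integrable_sq.div_const 2)
      (h.integrable_windowSum_mul hν _ _ _), integral_div, h.integral_windowSum_sq hν,
      h.integral_windowSum_mul hν (Nat.lt_succ_self a), h.partialMean_eq hν,
      h.partialSecond_eq hν, windowSum_rounds meanAt_period ha, windowSum_rounds varAt_period ha,
      sum_meanAt, sum_varAt]
    have : meanAt P ν a = serviceMean ν n := by rw [meanAt, src_eq_of_mod ha]
    rw [this]
    ring
  · exact hasSum_of_eq (hasSum_roundsProb_quadratic hp0 hp i.pos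
      (partialSecond P n μ S i j / 2 + partialMean P n μ S i j * serviceMean ν n)
      ((patternVar P ν + 2 * partialMean P n μ S i j * patternMean P ν) / 2 +
        patternMean P ν * serviceMean ν n) (patternMean P ν ^ 2 / 2))
      (fun M => by ring) (by ring)
  · filter_upwards [h.ae_cycleTime hn hp k i j,
      cond_absolutelyContinuous.ae_le (h.ae_infinite_received hn hp),
      cond_absolutelyContinuous.ae_le (h.ae_service_nonneg hν0)] with ω h1 h2 h3
    rw [cycleArea_eq h3 (hδ ω) h2, h1]

end IsTransmissionProcess

end Conditional

/-! ### A strong law for uncorrelated variables -/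

section LLN

variable {Ω : Type*} [mΩ : MeasurableSpace Ω] {μ : Measure Ω}

/-- By Tonelli the sum of the `f q` has finite integral, so it converges almost surely and its terms
tend to zero. -/
theorem ae_tendsto_zero_of_integral_le {f : ℕ → Ω → ℝ} {a : ℕ → ℝ}
    (hf : ∀ q, Integrable (f q) μ) (hf0 : ∀ q ω, 0 ≤ f q ω) (hfa : ∀ q, ∫ ω, f q ω ∂μ ≤ a q)
    (ha : Summable a) : ∀ᵐ ω ∂μ, Tendsto (fun q => f q ω) atTop (𝓝 0) := by
  have hsum : Summable fun q => ∫ ω, f q ω ∂μ :=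
    Summable.of_nonneg_of_le (fun q => integral_nonneg (hf0 q)) hfa ha
  have h1 : ∫⁻ ω, ∑' q, ENNReal.ofReal (f q ω) ∂μ ≠ ⊤ := by
    rw [lintegral_tsum fun q => (hf q).1.aemeasurable.ennreal_ofReal]
    simp only [← ofReal_integral_eq_lintegral_ofReal (hf _) (Eventually.of_forall (hf0 _))]
    rw [← ENNReal.ofReal_tsum_of_nonneg (fun q => integral_nonneg (hf0 q)) hsum]
    exact ENNReal.ofReal_ne_top
  have h2 := ae_lt_top' (AEMeasurable.tsum
    fun q => (hf q).1.aemeasurable.ennreal_ofReal) h1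
  filter_upwards [h2] with ω hω
  have h3 := ENNReal.tendsto_atTop_zero_of_tsum_ne_top hω.ne
  have h4 := (ENNReal.tendsto_toReal ENNReal.zero_ne_top).comp h3
  refine h4.congr fun q => ?_
  simp [ENNReal.toReal_ofReal (hf0 q ω)]

variable {Z : ℕ → Ω → ℝ} {C : ℝ}

theorem integral_sq_windowSum_le (hZ : ∀ l, MemLp (Z l) 2 μ) (hC : ∀ l, ∫ ω, Z l ω ^ 2 ∂μ ≤ C)
    (horth : ∀ l m, l < m → ∫ ω, Z l ω * Z m ω ∂μ = 0) (l k : ℕ) :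
    ∫ ω, windowSum (fun j => Z j ω) l k ^ 2 ∂μ ≤ C * k := by
  induction k with
  | zero => simp [windowSum]
  | succ k ih =>
    have hW : MemLp (fun ω => windowSum (fun j => Z j ω) l k) 2 μ :=
      memLp_finsetSum _ fun _ _ => hZ _
    have hcross : ∫ ω, windowSum (fun j => Z j ω) l k * Z (l + k) ω ∂μ = 0 := by
      unfold windowSum
      simp only [Finset.sum_mul]
      have hint (j : ℕ) : Integrable (fun ω => Z (l + j) ω * Z (l + k) ω) μ :=
        (hZ (l + j)).integrable_mul (hZ (l + k))
      rw [integral_finsetSum _ fun j _ => hint j]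
      refine Finset.sum_eq_zero fun j hj => horth _ _ ?_
      have := Finset.mem_range.1 hj
      omega
    have hintc : Integrable (fun ω => windowSum (fun j => Z j ω) l k * Z (l + k) ω) μ :=
      hW.integrable_mul (hZ (l + k))
    have e (ω : Ω) : windowSum (fun j => Z j ω) l (k + 1) ^ 2 =
        windowSum (fun j => Z j ω) l k ^ 2 +
          2 * (windowSum (fun j => Z j ω) l k * Z (l + k) ω) + Z (l + k) ω ^ 2 := by
      unfold windowSum
      rw [Finset.sum_range_succ]
      ring
    have hadd : Integrable (fun ω => windowSum (fun j => Z j ω) l k ^ 2 +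
        2 * (windowSum (fun j => Z j ω) l k * Z (l + k) ω)) μ :=
      hW.integrable_sq.add (hintc.const_mul 2)
    simp only [e]
    rw [integral_add hadd (hZ _).integrable_sq,
      integral_add hW.integrable_sq (hintc.const_mul 2), integral_const_mul, hcross]
    have := hC (l + k)
    push_cast
    linarith

/-- Rajchman's strong law: averages of uncorrelated variables with bounded second moments. -/
theorem ae_tendsto_average_of_uncorrelated (hZ : ∀ l, MemLp (Z l) 2 μ)
    (hC : ∀ l, ∫ ω, Z l ω ^ 2 ∂μ ≤ C) (horth : ∀ l m, l < m → ∫ ω, Z l ω * Z m ω ∂μ = 0) :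
    ∀ᵐ ω ∂μ, Tendsto (fun L : ℕ => (∑ l ∈ Finset.range L, Z l ω) / L) atTop (𝓝 0) := by
  have hC0 : 0 ≤ C := (integral_nonneg fun ω => sq_nonneg (Z 0 ω)).trans (hC 0)
  have hW (l k : ℕ) : MemLp (fun ω => windowSum (fun j => Z j ω) l k) 2 μ :=
    memLp_finsetSum _ fun _ _ => hZ _
  -- The partial sum up to q² is controlled together with all partial sums over the gap from q² to
  -- (q + 1)². Adding the squares over the gap takes the place of a maximal inequality.
  let f : ℕ → Ω → ℝ := fun q ω => (windowSum (fun j => Z j ω) 0 (q ^ 2) ^ 2 +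
    ∑ k ∈ Finset.range (2 * q + 1), windowSum (fun j => Z j ω) (q ^ 2) k ^ 2) / (q : ℝ) ^ 4
  have hfint (q : ℕ) : Integrable (f q) μ :=
    ((hW _ _).integrable_sq.add (integrable_finsetSum _ fun k _ => (hW _ _).integrable_sq)).div_const
      _
  have hf0 (q : ℕ) (ω : Ω) : 0 ≤ f q ω :=
    div_nonneg (add_nonneg (sq_nonneg _) (Finset.sum_nonneg fun _ _ => sq_nonneg _)) (by positivity)
  -- For q ≥ 1 one has q² + (2q + 1)² ≤ 10 q², because 2q + 1 ≤ 3q. For q = 0 both sides vanish by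
  -- division by zero.
  have hfa (q : ℕ) : ∫ ω, f q ω ∂μ ≤ (10 * C) * (1 / (q : ℝ) ^ 2) := by
    simp only [f]
    rw [integral_div, integral_add (hW _ _).integrable_sq
      (integrable_finsetSum _ fun k _ => (hW _ _).integrable_sq),
      integral_finsetSum _ fun k _ => (hW _ _).integrable_sq]
    have h1 := integral_sq_windowSum_le hZ hC horth 0 (q ^ 2)
    have h2 : ∑ k ∈ Finset.range (2 * q + 1), ∫ ω, windowSum (fun j => Z j ω) (q ^ 2) k ^ 2 ∂μ ≤
        ∑ k ∈ Finset.range (2 * q + 1), C * (2 * q + 1 : ℝ) := by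
      refine Finset.sum_le_sum fun k hk => (integral_sq_windowSum_le hZ hC horth _ k).trans ?_
      refine mul_le_mul_of_nonneg_left ?_ hC0
      have : k ≤ 2 * q + 1 := (Finset.mem_range.1 hk).le
      exact_mod_cast this
    rw [Finset.sum_const, Finset.card_range, nsmul_eq_mul] at h2
    rcases Nat.eq_zero_or_pos q with rfl | hq
    · simp
    · have hq' : (1 : ℝ) ≤ q := by exact_mod_cast hq
      rw [div_le_iff₀ (by positivity)]
      have e : 10 * C * (1 / (q : ℝ) ^ 2) * (q : ℝ) ^ 4 = 10 * C * (q : ℝ) ^ 2 := by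
        field_simp
      rw [e]
      push_cast at h1 h2
      nlinarith [mul_le_mul_of_nonneg_left hq' (mul_nonneg hC0 (by linarith : (0 : ℝ) ≤ q)),
        mul_le_mul_of_nonneg_left hq' hC0]
  have ha : Summable fun q : ℕ => (10 * C) * (1 / (q : ℝ) ^ 2) :=
    (Real.summable_one_div_nat_pow.2 (by norm_num)).mul_left _
  filter_upwards [ae_tendsto_zero_of_integral_le hfint hf0 hfa ha] with ω hω
  have hsqrt : Tendsto Nat.sqrt atTop atTop := by
    refine tendsto_atTop_atTop.2 fun b => ⟨b ^ 2, fun a hab => ?_⟩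
    rw [Nat.le_sqrt']
    exact hab
  -- With q the integer square root of L, the sum up to L is the sum up to q² plus a gap sum. The
  -- factor 2 comes from (x + y)² ≤ 2 (x² + y²), and q⁴ ≤ L².
  have h1 : Tendsto (fun L : ℕ => √(2 * f (Nat.sqrt L) ω)) atTop (𝓝 0) := by
    have := ((hω.comp hsqrt).const_mul 2).sqrt
    simpa using this
  refine squeeze_zero_norm' ?_ h1
  filter_upwards [eventually_ge_atTop 1] with L hL
  refine Real.le_sqrt_of_sq_le ?_
  rw [Real.norm_eq_abs, sq_abs]
  have hq1 : 1 ≤ Nat.sqrt L := by rw [Nat.le_sqrt']; simpa using hL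
  have hqL : Nat.sqrt L ^ 2 ≤ L := Nat.sqrt_le' L
  have hLq : L ≤ Nat.sqrt L ^ 2 + 2 * Nat.sqrt L := by
    have := Nat.sqrt_le_add L
    nlinarith
  generalize Nat.sqrt L = q at hq1 hqL hLq ⊢
  obtain ⟨k, rfl⟩ : ∃ k, L = q ^ 2 + k := ⟨L - q ^ 2, by omega⟩
  have hk : k ∈ Finset.range (2 * q + 1) := Finset.mem_range.2 (by omega)
  have e : ∑ l ∈ Finset.range (q ^ 2 + k), Z l ω =
      windowSum (fun j => Z j ω) 0 (q ^ 2) + windowSum (fun j => Z j ω) (q ^ 2) k := by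
    unfold windowSum
    rw [Finset.sum_range_add]
    simp
  have hle := Finset.single_le_sum
    (f := fun k => windowSum (fun j => Z j ω) (q ^ 2) k ^ 2) (fun _ _ => sq_nonneg _) hk
  have hq0 : (0 : ℝ) < q := by exact_mod_cast hq1
  have hN : (q : ℝ) ^ 2 ≤ ((q ^ 2 + k : ℕ) : ℝ) := by exact_mod_cast hqL
  have hq4 : (q : ℝ) ^ 4 ≤ ((q ^ 2 + k : ℕ) : ℝ) ^ 2 := by
    calc (q : ℝ) ^ 4 = ((q : ℝ) ^ 2) ^ 2 := by ring
      _ ≤ _ := pow_le_pow_left₀ (by positivity) hN 2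
  rw [e, div_pow]
  calc (windowSum (fun j => Z j ω) 0 (q ^ 2) + windowSum (fun j => Z j ω) (q ^ 2) k) ^ 2 /
        ((q ^ 2 + k : ℕ) : ℝ) ^ 2
      ≤ (windowSum (fun j => Z j ω) 0 (q ^ 2) + windowSum (fun j => Z j ω) (q ^ 2) k) ^ 2 /
        (q : ℝ) ^ 4 := by gcongr
    _ ≤ 2 * f q ω := by
        simp only [f]
        rw [← mul_div_assoc]
        gcongr
        nlinarith [sq_nonneg (windowSum (fun j => Z j ω) 0 (q ^ 2) -
          windowSum (fun j => Z j ω) (q ^ 2) k)]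

end LLN

/-! ### Cesàro averages and passage to continuous time -/

section Averages

variable {K : ℕ} [NeZero K]

theorem sum_range_mul_period (x : ℕ → ℝ) (M : ℕ) : ∑ l ∈ Finset.range (M * K), x l =
    ∑ r ∈ Finset.range K, ∑ m ∈ Finset.range M, x (r + m * K) := by
  induction M with
  | zero => simp
  | succ M ih =>
    rw [add_mul, one_mul, Finset.sum_range_add, ih, ← Finset.sum_add_distrib]
    refine Finset.sum_congr rfl fun r _ => ?_
    rw [Finset.sum_range_succ, add_comm r]

/-- Non-negativity makes the partial sums monotone, so it suffices to follow them along the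
multiples of K, where they split by residue class. -/
theorem tendsto_average_of_residues {x w : ℕ → ℝ} (hx : ∀ l, 0 ≤ x l)
    (h : ∀ r < K, Tendsto (fun M : ℕ => (∑ m ∈ Finset.range M, x (r + m * K)) / M) atTop
      (𝓝 (w r))) :
    Tendsto (fun L : ℕ => (∑ l ∈ Finset.range L, x l) / L) atTop
      (𝓝 ((∑ r ∈ Finset.range K, w r) / K)) := by
  have hK : 0 < K := Nat.pos_of_ne_zero (NeZero.ne K)
  have hK' : (0 : ℝ) < K := by exact_mod_cast hK
  refine tendsto_div_of_monotone_of_exists_subseq_tendsto_div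
    (fun L => ∑ l ∈ Finset.range L, x l) _ ?_ fun a ha => ⟨fun M => M * K, ?_, ?_, ?_⟩
  · exact monotone_nat_of_le_succ fun L => by rw [Finset.sum_range_succ]; linarith [hx L]
  -- The ratio (M + 1)/M of consecutive subsequence indices is at most a as soon as M ≥ 1/(a - 1).
  · filter_upwards [eventually_ge_atTop ⌈1 / (a - 1)⌉₊] with M hM
    have h1 : 1 / (a - 1) ≤ M := Nat.ceil_le.1 hM
    rw [div_le_iff₀ (by linarith)] at h1
    push_cast
    nlinarith
  · exact tendsto_id.atTop_mul_const' hK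
  · have h1 := (tendsto_finsetSum (Finset.range K)
      fun r hr => h r (Finset.mem_range.1 hr)).div_const (K : ℝ)
    refine h1.congr fun M => ?_
    rw [sum_range_mul_period, ← Finset.sum_div]
    push_cast
    rw [div_div]

theorem tendsto_average_const (c : ℝ) :
    Tendsto (fun M : ℕ => (∑ _m ∈ Finset.range M, c) / M) atTop (𝓝 c) := by
  refine tendsto_const_nhds.congr' ?_
  filter_upwards [eventually_gt_atTop 0] with M hM
  have : (M : ℝ) ≠ 0 := by positivity
  rw [Finset.sum_const, Finset.card_range, nsmul_eq_mul]
  field_simp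

theorem tendsto_average_of_period {g : ℕ → ℝ} (hg : ∀ l, g (l + K) = g l) :
    Tendsto (fun L : ℕ => (∑ l ∈ Finset.range L, g l) / L) atTop
      (𝓝 ((∑ r ∈ Finset.range K, g r) / K)) := by
  obtain ⟨C, -, hC⟩ := exists_bound_of_period hg
  have hper (r m : ℕ) : g (r + m * K) = g r := by
    induction m with
    | zero => simp
    | succ m ih => rw [add_mul, one_mul, ← add_assoc, hg, ih]
  -- Adding the bound C makes the sequence non-negative; its average is subtracted afterwards.
  have h1 := tendsto_average_of_residues (K := K) (x := fun l => g l + C) (w := fun l => g l + C)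
    (fun l => by linarith [(abs_le.1 (hC l)).1])
    (fun r _ => by simp only [hper]; exact tendsto_average_const _)
  have h2 := h1.sub (tendsto_average_const C)
  have hK : (K : ℝ) ≠ 0 := Nat.cast_ne_zero.2 (NeZero.ne K)
  convert h2 using 2 with L
  · rw [Finset.sum_add_distrib]
    ring
  · rw [Finset.sum_add_distrib, Finset.sum_const, Finset.card_range, nsmul_eq_mul]
    field_simp
    ring

theorem tendsto_average_of_eventually_eq {x y : ℕ → ℝ} {c : ℝ} {L₀ : ℕ}
    (hxy : ∀ l ≥ L₀, x l = y l)
    (h : Tendsto (fun L : ℕ => (∑ l ∈ Finset.range L, x l) / L) atTop (𝓝 c)) :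
    Tendsto (fun L : ℕ => (∑ l ∈ Finset.range L, y l) / L) atTop (𝓝 c) := by
  have h1 : Tendsto (fun L : ℕ => (∑ l ∈ Finset.range L₀, (y l - x l)) / (L : ℝ)) atTop (𝓝 0) :=
    tendsto_const_div_atTop_nhds_zero_nat _
  have h2 := h.add h1
  rw [add_zero] at h2
  refine h2.congr' ?_
  filter_upwards [eventually_ge_atTop L₀] with L hL
  rw [← add_div]
  congr 1
  have h3 : ∑ l ∈ Finset.range L₀, (y l - x l) = ∑ l ∈ Finset.range L, (y l - x l) := by
    refine Finset.sum_subset (Finset.range_mono hL) fun l _ hl => ?_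
    rw [hxy l (by simpa using hl), sub_self]
  rw [h3, ← Finset.sum_add_distrib]
  exact Finset.sum_congr rfl fun l _ => by ring

/-- Passing from averages along a renewal-like sequence of times to averages over real time. -/
theorem tendsto_div_of_sequence {F : ℝ → ℝ} {D : ℕ → ℝ} {c d : ℝ} (hF : MonotoneOn F (Set.Ici 0))
    (hF0 : ∀ t, 0 ≤ t → 0 ≤ F t) (hD0 : D 0 = 0) (hD : Monotone D) (hd : 0 < d)
    (h1 : Tendsto (fun L : ℕ => D L / L) atTop (𝓝 d))
    (h2 : Tendsto (fun L : ℕ => F (D L) / L) atTop (𝓝 c)) :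
    Tendsto (fun T : ℝ => F T / T) atTop (𝓝 (c / d)) := by
  have hDnonneg (L : ℕ) : 0 ≤ D L := hD0 ▸ hD (Nat.zero_le L)
  have hDtop : Tendsto D atTop atTop := by
    have h3 := (tendsto_natCast_atTop_atTop (R := ℝ)).atTop_mul_pos hd h1
    refine h3.congr' ?_
    filter_upwards [eventually_gt_atTop 0] with L hL
    have : (L : ℝ) ≠ 0 := by positivity
    field_simp
  have hex (T : ℝ) : ∃ L, T < D (L + 1) := by
    obtain ⟨L, hL⟩ := ((tendsto_add_atTop_iff_nat 1).2 hDtop).eventually_gt_atTop T |>.exists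
    exact ⟨L, hL⟩
  classical
  -- The index of the interval containing T: D (I T) ≤ T < D (I T + 1).
  let I : ℝ → ℕ := fun T => Nat.find (hex T)
  have hI1 (T : ℝ) : T < D (I T + 1) := Nat.find_spec (hex T)
  have hI2 (T : ℝ) (hT : 0 ≤ T) : D (I T) ≤ T := by
    by_cases h0 : I T = 0
    · rw [h0, hD0]; exact hT
    · have := Nat.find_min (hex T) (m := I T - 1) (Nat.sub_lt (Nat.pos_of_ne_zero h0) one_pos)
      rw [show I T - 1 + 1 = I T by omega] at this
      exact not_lt.1 this
  have hItop : Tendsto I atTop atTop := by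
    refine tendsto_atTop_atTop.2 fun b => ⟨D b, fun T hT => ?_⟩
    by_contra hb
    have : D (I T + 1) ≤ D b := hD (by omega)
    linarith [hI1 T]
  have hshift : Tendsto (fun L : ℕ => ((L + 1 : ℕ) : ℝ) / L) atTop (𝓝 1) := by
    have h3 := (tendsto_const_div_atTop_nhds_zero_nat (1 : ℝ)).const_add 1
    rw [add_zero] at h3
    refine h3.congr' ?_
    filter_upwards [eventually_gt_atTop 0] with L hL
    have : (L : ℝ) ≠ 0 := by positivity
    push_cast
    field_simp
  -- Monotonicity places F T / T between F (D I) / D (I + 1) and F (D (I + 1)) / D I. Both bounds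
  -- have the same limit, because shifting the index by one is harmless.
  have hlow : Tendsto (fun L : ℕ => F (D L) / D (L + 1)) atTop (𝓝 (c / d)) := by
    have h3 := h2.div (((tendsto_add_atTop_iff_nat 1).2 h1).mul hshift) (by simpa using hd.ne')
    rw [mul_one] at h3
    refine h3.congr' ?_
    filter_upwards [eventually_gt_atTop 0] with L hL
    have : (L : ℝ) ≠ 0 := by positivity
    have : ((L + 1 : ℕ) : ℝ) ≠ 0 := by positivity
    simp only [Pi.div_apply]
    field_simp
  have hup : Tendsto (fun L : ℕ => F (D (L + 1)) / D L) atTop (𝓝 (c / d)) := by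
    have h3 := (((tendsto_add_atTop_iff_nat 1).2 h2).mul hshift).div h1 hd.ne'
    rw [mul_one] at h3
    refine h3.congr' ?_
    filter_upwards [eventually_gt_atTop 0] with L hL
    have : (L : ℝ) ≠ 0 := by positivity
    have : ((L + 1 : ℕ) : ℝ) ≠ 0 := by positivity
    simp only [Pi.div_apply]
    field_simp
  have hpos : ∀ᶠ T in atTop, 0 < D (I T) := (hDtop.comp hItop).eventually_gt_atTop 0
  refine tendsto_of_tendsto_of_tendsto_of_le_of_le' (hlow.comp hItop) (hup.comp hItop) ?_ ?_
  · filter_upwards [eventually_gt_atTop 0] with T hT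
    have h3 := hI2 T hT.le
    exact div_le_div₀ (hF0 T hT.le) (hF (hDnonneg _) hT.le h3) hT (hI1 T).le
  · filter_upwards [eventually_gt_atTop 0, hpos] with T hT hT'
    have h3 := hI2 T hT.le
    exact div_le_div₀ (hF0 _ (hDnonneg _)) (hF hT.le (hDnonneg _) (hI1 T).le) hT' h3

end Averages

/-! ### Contraction over a period -/

section Recursion

variable {N K : ℕ} [NeZero K] {P : Fin K → Fin N} {n : Fin N} {p : ℝ}

theorem le_of_recursion (hp : 0 ≤ p) (hp' : p ≤ 1) {x : ℕ → ℝ} {C : ℝ}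
    (hC : 0 ≤ C) (h : ∀ l, x (l + 1) ≤ failProb P n p l * x l + C) (l k : ℕ) :
    x (l + k) ≤ (∏ j ∈ Finset.range k, failProb P n p (l + j)) * x l + k * C := by
  induction k with
  | zero => simp
  | succ k ih =>
    have h1 := h (l + k)
    have h2 := mul_le_mul_of_nonneg_left ih (failProb_nonneg (P := P) (n := n) hp (l + k))
    have h3 : failProb P n p (l + k) * (k * C) ≤ k * C :=
      mul_le_of_le_one_left (by positivity) (failProb_le_one hp' _)
    rw [Finset.prod_range_succ]
    push_cast
    rw [← add_assoc]
    nlinarith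

/-- Sequences contracted by the failure probabilities are bounded. -/
theorem exists_bound_of_recursion (hn : ∃ k, P k = n) (hp : 0 ≤ p) (hp' : p < 1) {x : ℕ → ℝ}
    {C : ℝ} (hx0 : x 0 = 0) (hC : 0 ≤ C)
    (h : ∀ l, x (l + 1) ≤ failProb P n p l * x l + C) : ∃ B, 0 ≤ B ∧ ∀ l, x l ≤ B := by
  have hr := one_sub_pow_pos hp hp' (alpha_pos hn)
  have hrn : 0 ≤ p ^ alpha P n := pow_nonneg hp _
  set r := p ^ alpha P n with hrdef
  have hKC : 0 ≤ K * C := by positivity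
  have hB : K * C ≤ K * C / (1 - r) := by
    rw [le_div_iff₀ hr]
    nlinarith
  -- The bound is the fixed point of x ↦ r x + K C, which dominates the effect of one whole period
  -- with contraction factor r = p^α.
  refine ⟨K * C / (1 - r), by positivity, fun l => ?_⟩
  induction l using Nat.strong_induction_on with
  | _ l ih =>
    rcases lt_or_ge l K with hl | hl
    · have h1 := le_of_recursion hp hp'.le hC h 0 l
      rw [hx0, mul_zero, zero_add, zero_add] at h1
      have h2 : (l : ℝ) * C ≤ K * C := by gcongr
      linarith
    · have hK : 0 < K := Nat.pos_of_ne_zero (NeZero.ne K)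
      obtain ⟨m, rfl⟩ : ∃ m, l = m + K := ⟨l - K, by omega⟩
      have h1 := le_of_recursion hp hp'.le hC h m K
      rw [prod_failProb, slotCount_add_period, add_tsub_cancel_left, ← hrdef] at h1
      have h2 := mul_le_mul_of_nonneg_left (ih m (by omega)) hrn
      have h3 : r * (K * C / (1 - r)) + K * C = K * C / (1 - r) := by field_simp; ring
      linarith

end Recursion

/-! ### Martingale decomposition of the area under the age -/

section Age

variable {Ω : Type*} [mΩ : MeasurableSpace Ω] {S : ℕ → Ω → ℝ} {X : ℕ → Ω → Bool}
  {N K : ℕ} [NeZero K] {P : Fin K → Fin N} {ν : Fin N → Measure ℝ} {p : Fin N → ℝ}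
  {μ : Measure Ω} {n : Fin N}

open scoped Classical in
/-- The indicator that transmission `l` does not deliver an update of source `n`. -/
noncomputable def failInd (P : Fin K → Fin N) (n : Fin N) (X : ℕ → Ω → Bool) (l : ℕ) (ω : Ω) : ℝ :=
  if Received P n X ω l then 0 else 1

theorem failInd_eq_or (l : ℕ) (ω : Ω) : failInd P n X l ω = 0 ∨ failInd P n X l ω = 1 := by
  unfold failInd; split_ifs <;> simp

theorem failInd_nonneg (l : ℕ) (ω : Ω) : 0 ≤ failInd P n X l ω := by
  rcases failInd_eq_or (P := P) (n := n) (X := X) l ω with h | h <;> simp [h]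

theorem failInd_le_one (l : ℕ) (ω : Ω) : failInd P n X l ω ≤ 1 := by
  rcases failInd_eq_or (P := P) (n := n) (X := X) l ω with h | h <;> simp [h]

theorem failInd_sq (l : ℕ) (ω : Ω) : failInd P n X l ω ^ 2 = failInd P n X l ω := by
  rcases failInd_eq_or (P := P) (n := n) (X := X) l ω with h | h <;> simp [h]

theorem ageAt_succ (δ : ℝ) (l : ℕ) (ω : Ω) : ageAt P n S X δ (l + 1) ω =
    failInd P n X l ω * ageAt P n S X δ l ω + S l ω := by
  simp only [ageAt, failInd]
  split_ifs <;> ring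

theorem ageAt_nonneg {ω : Ω} (hS : ∀ l, 0 ≤ S l ω) {δ : ℝ} (hδ : 0 ≤ δ) (l : ℕ) :
    0 ≤ ageAt P n S X δ l ω := by
  induction l with
  | zero => exact hδ
  | succ l ih =>
    rw [ageAt_succ]
    exact add_nonneg (mul_nonneg (failInd_nonneg _ _) ih) (hS l)

/-- A reception erases the initial age. Moment estimates can thus be made for initial age 0,
although `δ₀` need be neither measurable nor integrable. -/
theorem ageAt_eventually_eq {ω : Ω} {m : ℕ} (hm : Received P n X ω m) (δ δ' : ℝ) :
    ∀ l ≥ m + 1, ageAt P n S X δ l ω = ageAt P n S X δ' l ω := by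
  intro l hl
  induction l, hl using Nat.le_induction with
  | base => simp [ageAt, hm]
  | succ l _ ih => rw [ageAt_succ, ageAt_succ, ih]

theorem measurable_failInd_past {j l : ℕ} (h : j < l) :
    Measurable[past S X l] (failInd P n X j) := by
  classical
  unfold failInd
  exact Measurable.ite (IsTransmissionProcess.measurableSet_past_received n h) measurable_const
    measurable_const

theorem measurable_ageAt_past (l : ℕ) : Measurable[past S X l] (ageAt P n S X 0 l) := by
  induction l with
  | zero => exact @measurable_const _ _ _ (past S X 0) _
  | succ l ih =>
    have e : ageAt P n S X 0 (l + 1) =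
        fun ω => failInd P n X l ω * ageAt P n S X 0 l ω + S l ω := by
      funext ω; exact ageAt_succ 0 l ω
    rw [e]
    exact ((measurable_failInd_past (Nat.lt_succ_self l)).mul
      (ih.mono (past_mono (Nat.le_succ l)) le_rfl)).add
      (measurable_past_service (Nat.lt_succ_self l))

/-- The centred variable that multiplies the age. -/
noncomputable def ageFactor (P : Fin K → Fin N) (n : Fin N) (ν : Fin N → Measure ℝ) (q : ℝ)
    (S : ℕ → Ω → ℝ) (X : ℕ → Ω → Bool) (l : ℕ) (ω : Ω) : ℝ :=
  (S l ω - meanAt P ν l) + (failInd P n X l ω - failProb P n q l) *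
    timePotential P n q (meanAt P ν) (l + 1)

/-- The martingale differences in the decomposition of the area under the age. -/
noncomputable def ageNoise (P : Fin K → Fin N) (n : Fin N) (ν : Fin N → Measure ℝ) (q : ℝ)
    (S : ℕ → Ω → ℝ) (X : ℕ → Ω → Bool) (l : ℕ) (ω : Ω) : ℝ :=
  ageAt P n S X 0 l ω * ageFactor P n ν q S X l ω +
    (S l ω - meanAt P ν l) * timePotential P n q (meanAt P ν) (l + 1)

/-- A discrete Poisson equation. The potential a_l + A_l τ_l satisfies the one-step recursions of
`timePotential` and `areaPotential` in conditional mean, up to the fresh cycle that begins at a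
reception; this contributes the last sum. Squared service times are kept apart from the noise
because they are only integrable, so the second-moment strong law does not apply to them. -/
theorem sum_area_eq (hn : ∃ k, P k = n) {q : ℝ} (hq : 0 ≤ q) (hq' : q < 1) (ω : Ω) (L : ℕ) :
    ∑ l ∈ Finset.range L, (ageAt P n S X 0 l ω * S l ω + S l ω ^ 2 / 2) =
      ∑ l ∈ Finset.range L, ageNoise P n ν q S X l ω +
      (∑ l ∈ Finset.range L, S l ω ^ 2 -
        ∑ l ∈ Finset.range L, (varAt P ν l + meanAt P ν l ^ 2)) / 2 +
      areaPotential P n q (meanAt P ν) (varAt P ν) 0 -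
      areaPotential P n q (meanAt P ν) (varAt P ν) L -
      ageAt P n S X 0 L ω * timePotential P n q (meanAt P ν) L +
      ∑ l ∈ Finset.range L, (1 - failProb P n q l) *
        (areaPotential P n q (meanAt P ν) (varAt P ν) (l + 1) +
          meanAt P ν l * timePotential P n q (meanAt P ν) (l + 1)) := by
  induction L with
  | zero => simp [ageAt]
  | succ L ih =>
    simp only [Finset.sum_range_succ]
    rw [ih]
    have h1 := timePotential_rec (P := P) (n := n) hn hq hq' (meanAt_period (P := P) (ν := ν)) L
    have h2 := areaPotential_rec (P := P) (n := n) hn hq hq' (meanAt_period (P := P) (ν := ν))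
      (varAt_period (P := P) (ν := ν)) L
    rw [h1, h2, ageAt_succ, ageNoise, ageFactor]
    ring

namespace IsTransmissionProcess

variable [IsProbabilityMeasure μ]

theorem measurable_failInd_present (h : IsTransmissionProcess P ν p μ S X) (l : ℕ) :
    Measurable[present S X l] (failInd P n X l) := by
  unfold failInd
  exact Measurable.ite (h.measurableSet_received n l) measurable_const measurable_const

theorem measurable_failInd (h : IsTransmissionProcess P ν p μ S X) (l : ℕ) :
    Measurable (failInd P n X l) :=
  (h.measurable_failInd_present l).mono (h.present_le l) le_rfl

theorem measurable_ageAt (h : IsTransmissionProcess P ν p μ S X) (l : ℕ) :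
    Measurable (ageAt P n S X 0 l) :=
  (measurable_ageAt_past l).mono (h.past_le l) le_rfl

theorem memLp_failInd (h : IsTransmissionProcess P ν p μ S X) (l : ℕ) :
    MemLp (failInd P n X l) 2 μ :=
  MemLp.of_bound (h.measurable_failInd l).aestronglyMeasurable 1 (Eventually.of_forall fun ω => by
    rw [Real.norm_of_nonneg (failInd_nonneg l ω)]; exact failInd_le_one l ω)

theorem integral_failInd (h : IsTransmissionProcess P ν p μ S X) (l : ℕ) :
    ∫ ω, failInd P n X l ω ∂μ = failProb P n (p n) l := by
  rw [← h.prob_not_received n l]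
  have hm : MeasurableSet {ω | ¬ Received P n X ω l} :=
    (h.present_le l _ (h.measurableSet_received n l)).compl
  rw [← integral_indicator_one hm]
  refine integral_congr_ae (Eventually.of_forall fun ω => ?_)
  by_cases hR : Received P n X ω l <;> simp [failInd, hR]

theorem memLp_ageAt (h : IsTransmissionProcess P ν p μ S X)
    (hν : ∀ m, MemLp (fun x : ℝ => x) 2 (ν m)) (l : ℕ) : MemLp (ageAt P n S X 0 l) 2 μ := by
  induction l with
  | zero => exact memLp_const 0
  | succ l ih =>
    have e : ageAt P n S X 0 (l + 1) =
        (fun ω => failInd P n X l ω * ageAt P n S X 0 l ω) + S l := by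
      funext ω; exact ageAt_succ 0 l ω
    rw [e]
    refine MemLp.add (ih.mono ((h.measurable_failInd l).mul
      (h.measurable_ageAt l)).aestronglyMeasurable (Eventually.of_forall fun ω => ?_))
      (h.memLp_service hν l)
    rw [norm_mul, Real.norm_of_nonneg (failInd_nonneg l ω)]
    exact mul_le_of_le_one_left (norm_nonneg _) (failInd_le_one l ω)

theorem integral_past_mul_present (h : IsTransmissionProcess P ν p μ S X) {l : ℕ} {f g : Ω → ℝ}
    (hf : Measurable[past S X l] f) (hg : Measurable[present S X l] g) :
    ∫ ω, f ω * g ω ∂μ = (∫ ω, f ω ∂μ) * ∫ ω, g ω ∂μ :=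
  (h.indepFun_past_present hf hg).integral_mul_eq_mul_integral
    (hf.mono (h.past_le l) le_rfl).aestronglyMeasurable
    (hg.mono (h.present_le l) le_rfl).aestronglyMeasurable

theorem integrable_past_mul_present (h : IsTransmissionProcess P ν p μ S X) {l : ℕ} {f g : Ω → ℝ}
    (hf : Measurable[past S X l] f) (hg : Measurable[present S X l] g) (hf' : Integrable f μ)
    (hg' : Integrable g μ) : Integrable (fun ω => f ω * g ω) μ :=
  (h.indepFun_past_present hf hg).integrable_mul hf' hg'

/-- The age before transmission l is independent of its outcome, so the mean age obeys the recursion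
contracted by `failProb`. -/
theorem exists_bound_integral_ageAt (h : IsTransmissionProcess P ν p μ S X)
    (hn : ∃ k, P k = n) (hp : p n < 1)
    (hν : ∀ m, MemLp (fun x : ℝ => x) 2 (ν m)) :
    ∃ B, 0 ≤ B ∧ ∀ l, ∫ ω, ageAt P n S X 0 l ω ∂μ ≤ B := by
  obtain ⟨C, hC, hC'⟩ := exists_bound_of_period (meanAt_period (P := P) (ν := ν))
  refine exists_bound_of_recursion hn (h.prob_nonneg hn) hp (C := C) ?_ hC
    fun l => ?_
  · simp [ageAt]
  · have h1 := h.integral_past_mul_present (measurable_ageAt_past (n := n) (P := P) l)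
      (h.measurable_failInd_present (n := n) l)
    have h2 := h.integrable_past_mul_present (measurable_ageAt_past (n := n) (P := P) l)
      (h.measurable_failInd_present (n := n) l) ((h.memLp_ageAt hν l).integrable one_le_two)
      ((h.memLp_failInd l).integrable one_le_two)
    simp only [ageAt_succ, mul_comm (failInd P n X l _)]
    rw [integral_add h2 (h.integrable_service hν l), h1, h.integral_failInd, h.integral_service,
      mul_comm]
    linarith [(abs_le.1 (hC' l)).2]

theorem exists_bound_integral_ageAt_sq (h : IsTransmissionProcess P ν p μ S X)
    (hn : ∃ k, P k = n) (hp : p n < 1) (hν0 : ∀ m, ∀ᵐ x ∂(ν m), 0 ≤ x)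
    (hν : ∀ m, MemLp (fun x : ℝ => x) 2 (ν m)) :
    ∃ B, 0 ≤ B ∧ ∀ l, ∫ ω, ageAt P n S X 0 l ω ^ 2 ∂μ ≤ B := by
  obtain ⟨C, hC, hC'⟩ := exists_bound_of_period (meanAt_period (P := P) (ν := ν))
  obtain ⟨V, hV, hV'⟩ := exists_bound_of_period (varAt_period (P := P) (ν := ν))
  obtain ⟨B, hB, hB'⟩ := h.exists_bound_integral_ageAt hn hp hν
  -- The terms of the constant bound twice the cross moment of age and service time, which factors
  -- by independence, and the second moment of the service time. A squared failure indicator equals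
  -- itself, so the contraction factor is again `failProb`.
  refine exists_bound_of_recursion hn (h.prob_nonneg hn) hp (C := 2 * (B * C) + (V + C ^ 2))
    (by simp [ageAt]) (by positivity) fun l => ?_
  have m1 := measurable_ageAt_past (S := S) (X := X) (n := n) (P := P) l
  have m2 := h.measurable_failInd_present (n := n) l
  have m3 := measurable_present_service (S := S) (X := X) l
  have i1 := (h.memLp_ageAt (n := n) hν l).integrable one_le_two
  have i1' := (h.memLp_ageAt (n := n) hν l).integrable_sq
  have i2 := (h.memLp_failInd (n := n) l).integrable one_le_two
  have i3 := h.integrable_service hν l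
  have j1 := h.integrable_past_mul_present (m1.pow_const 2) m2 i1' i2
  have j2 := h.integrable_past_mul_present m1 m3 i1 i3
  have e1 := h.integral_past_mul_present (m1.pow_const 2) m2
  have e2 := h.integral_past_mul_present m1 m3
  rw [h.integral_failInd] at e1
  rw [h.integral_service] at e2
  have hle : ∫ ω, ageAt P n S X 0 (l + 1) ω ^ 2 ∂μ ≤
      ∫ ω, (ageAt P n S X 0 l ω ^ 2 * failInd P n X l ω +
        2 * (ageAt P n S X 0 l ω * S l ω) + S l ω ^ 2) ∂μ := by
    refine integral_mono_ae (h.memLp_ageAt hν (l + 1)).integrable_sq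
      ((j1.add (j2.const_mul 2)).add (h.memLp_service hν l).integrable_sq) ?_
    filter_upwards [h.ae_service_nonneg hν0] with ω hω
    have h1 : 0 ≤ ageAt P n S X 0 l ω * S l ω := mul_nonneg (ageAt_nonneg hω le_rfl l) (hω l)
    have h2 := mul_le_of_le_one_left h1 (failInd_le_one (P := P) (n := n) (X := X) l ω)
    have h3 := failInd_sq (P := P) (n := n) (X := X) l ω
    simp only [ageAt_succ]
    have h4 : (failInd P n X l ω * ageAt P n S X 0 l ω + S l ω) ^ 2 =
      ageAt P n S X 0 l ω ^ 2 * failInd P n X l ω ^ 2 +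
        2 * (failInd P n X l ω * (ageAt P n S X 0 l ω * S l ω)) + S l ω ^ 2 := by ring
    rw [h4, h3]
    linarith
  have j12 : Integrable (fun ω => ageAt P n S X 0 l ω ^ 2 * failInd P n X l ω +
        2 * (ageAt P n S X 0 l ω * S l ω)) μ := j1.add (j2.const_mul 2)
  rw [integral_add j12 (h.memLp_service hν l).integrable_sq, integral_add j1 (j2.const_mul 2),
    integral_const_mul, e1, e2, h.integral_service_sq] at hle
  have b1 := (abs_le.1 (hC' l)).2
  have b2 := (abs_le.1 (hV' l)).2
  have b3 : meanAt P ν l ^ 2 ≤ C ^ 2 := sq_le_sq' (by linarith [(abs_le.1 (hC' l)).1]) b1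
  have b4 : (∫ ω, ageAt P n S X 0 l ω ∂μ) * meanAt P ν l ≤ B * C := by
    have h0 : 0 ≤ ∫ ω, ageAt P n S X 0 l ω ∂μ := by
      refine integral_nonneg_of_ae ?_
      filter_upwards [h.ae_service_nonneg hν0] with ω hω
      exact ageAt_nonneg hω le_rfl l
    exact (mul_le_mul_of_nonneg_left b1 h0).trans (mul_le_mul_of_nonneg_right (hB' l) hC)
  linarith

theorem measurable_ageFactor (h : IsTransmissionProcess P ν p μ S X) (q : ℝ) (l : ℕ) :
    Measurable[present S X l] (ageFactor P n ν q S X l) :=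
  ((measurable_present_service l).sub_const _).add
    (((h.measurable_failInd_present l).sub_const _).mul_const _)

theorem memLp_centred (h : IsTransmissionProcess P ν p μ S X)
    (hν : ∀ m, MemLp (fun x : ℝ => x) 2 (ν m)) (l : ℕ) :
    MemLp (fun ω => S l ω - meanAt P ν l) 2 μ :=
  (h.memLp_service hν l).sub (memLp_const _)

theorem integral_centred (h : IsTransmissionProcess P ν p μ S X)
    (hν : ∀ m, MemLp (fun x : ℝ => x) 2 (ν m)) (l : ℕ) :
    ∫ ω, (S l ω - meanAt P ν l) ∂μ = 0 := by
  rw [integral_sub (h.integrable_service hν l) (integrable_const _), h.integral_service]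
  simp

theorem integral_centred_sq (h : IsTransmissionProcess P ν p μ S X)
    (hν : ∀ m, MemLp (fun x : ℝ => x) 2 (ν m)) (l : ℕ) :
    ∫ ω, (S l ω - meanAt P ν l) ^ 2 ∂μ = varAt P ν l := by
  rw [← h.variance_service hν l, variance_eq_integral (h.measurable_service l).aemeasurable,
    h.integral_service]

theorem memLp_ageFactor (h : IsTransmissionProcess P ν p μ S X)
    (hν : ∀ m, MemLp (fun x : ℝ => x) 2 (ν m)) (q : ℝ) (l : ℕ) :
    MemLp (ageFactor P n ν q S X l) 2 μ :=
  (h.memLp_centred hν l).add (((h.memLp_failInd l).sub (memLp_const _)).mul_const _)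

theorem integral_ageFactor (h : IsTransmissionProcess P ν p μ S X)
    (hν : ∀ m, MemLp (fun x : ℝ => x) 2 (ν m)) (l : ℕ) :
    ∫ ω, ageFactor P n ν (p n) S X l ω ∂μ = 0 := by
  have i2 := (h.memLp_failInd (n := n) l).integrable one_le_two
  have i3 : Integrable (fun ω => failInd P n X l ω - failProb P n (p n) l) μ :=
    i2.sub (integrable_const _)
  unfold ageFactor
  rw [integral_add ((h.memLp_centred hν l).integrable one_le_two) (i3.mul_const _),
    h.integral_centred hν, integral_mul_const, integral_sub i2 (integrable_const _),
    h.integral_failInd]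
  simp

theorem measurable_ageNoise (_ : IsTransmissionProcess P ν p μ S X) (q : ℝ) {l m : ℕ}
    (hlm : l < m) : Measurable[past S X m] (ageNoise P n ν q S X l) := by
  have hA : Measurable[past S X m] (ageAt P n S X 0 l) :=
    (measurable_ageAt_past l).mono (past_mono hlm.le) le_rfl
  have hS : Measurable[past S X m] fun ω => S l ω - meanAt P ν l :=
    (measurable_past_service hlm).sub_const _
  have hF : Measurable[past S X m] fun ω => (failInd P n X l ω - failProb P n q l) *
      timePotential P n q (meanAt P ν) (l + 1) :=
    ((measurable_failInd_past hlm).sub_const _).mul_const _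
  exact (hA.mul (hS.add hF)).add (hS.mul_const _)

/-- Only second moments are available. The product is nevertheless square integrable, because age
and factor are independent and the second moment of the product factors. -/
theorem memLp_age_mul_factor (h : IsTransmissionProcess P ν p μ S X)
    (hν : ∀ m, MemLp (fun x : ℝ => x) 2 (ν m)) (q : ℝ) (l : ℕ) :
    MemLp (fun ω => ageAt P n S X 0 l ω * ageFactor P n ν q S X l ω) 2 μ := by
  have m1 := measurable_ageAt_past (S := S) (X := X) (n := n) (P := P) l
  have m2 := h.measurable_ageFactor (n := n) q l
  refine (memLp_two_iff_integrable_sq ((h.measurable_ageAt l).mul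
    (m2.mono (h.present_le l) le_rfl)).aestronglyMeasurable).2 ?_
  have := h.integrable_past_mul_present (m1.pow_const 2) (m2.pow_const 2)
    (h.memLp_ageAt (n := n) hν l).integrable_sq (h.memLp_ageFactor (n := n) hν q l).integrable_sq
  exact this.congr (Eventually.of_forall fun ω => (mul_pow _ _ 2).symm)

theorem memLp_ageNoise (h : IsTransmissionProcess P ν p μ S X)
    (hν : ∀ m, MemLp (fun x : ℝ => x) 2 (ν m)) (q : ℝ) (l : ℕ) :
    MemLp (ageNoise P n ν q S X l) 2 μ :=
  (h.memLp_age_mul_factor hν q l).add ((h.memLp_centred hν l).mul_const _)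

/-- At the later index m the noise is a combination of centred variables of the present with
coefficients from the past, and the earlier noise also belongs to the past. -/
theorem integral_ageNoise_mul (h : IsTransmissionProcess P ν p μ S X)
    (hν : ∀ m, MemLp (fun x : ℝ => x) 2 (ν m)) {l m : ℕ} (hlm : l < m) :
    ∫ ω, ageNoise P n ν (p n) S X l ω * ageNoise P n ν (p n) S X m ω ∂μ = 0 := by
  have m1 := h.measurable_ageNoise (n := n) (p n) hlm
  have m2 := measurable_ageAt_past (S := S) (X := X) (n := n) (P := P) m
  have m3 := h.measurable_ageFactor (n := n) (p n) m
  have m4 : Measurable[present S X m] fun ω => S m ω - meanAt P ν m :=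
    (measurable_present_service m).sub_const _
  have l1 := h.memLp_ageNoise (n := n) hν (p n) l
  have i12 : Integrable (fun ω => ageNoise P n ν (p n) S X l ω * ageAt P n S X 0 m ω) μ :=
    l1.integrable_mul (h.memLp_ageAt hν m)
  have i1 := h.integrable_past_mul_present (m1.mul m2) m3 i12
    ((h.memLp_ageFactor hν (p n) m).integrable one_le_two)
  have i2 := h.integrable_past_mul_present m1 m4 (l1.integrable one_le_two)
    ((h.memLp_centred hν m).integrable one_le_two)
  have e1 := h.integral_past_mul_present (m1.mul m2) m3
  have e2 := h.integral_past_mul_present m1 m4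
  rw [h.integral_ageFactor hν, mul_zero] at e1
  rw [h.integral_centred hν, mul_zero] at e2
  have e (ω : Ω) : ageNoise P n ν (p n) S X l ω * ageNoise P n ν (p n) S X m ω =
      (ageNoise P n ν (p n) S X l ω * ageAt P n S X 0 m ω) * ageFactor P n ν (p n) S X m ω +
      (ageNoise P n ν (p n) S X l ω * (S m ω - meanAt P ν m)) *
        timePotential P n (p n) (meanAt P ν) (m + 1) := by
    conv_lhs => rw [ageNoise.eq_def P n ν (p n) S X m]
    ring
  simp only [e]
  refine (integral_add i1 (i2.mul_const _)).trans ?_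
  rw [integral_mul_const, e2]
  refine (add_eq_right.2 ?_).trans (zero_mul _)
  exact e1

theorem exists_bound_ageNoise (h : IsTransmissionProcess P ν p μ S X)
    (hn : ∃ k, P k = n) (hp : p n < 1) (hν0 : ∀ m, ∀ᵐ x ∂(ν m), 0 ≤ x)
    (hν : ∀ m, MemLp (fun x : ℝ => x) 2 (ν m)) :
    ∃ B, ∀ l, ∫ ω, ageNoise P n ν (p n) S X l ω ^ 2 ∂μ ≤ B := by
  have hp0 := h.prob_nonneg hn
  obtain ⟨V, hV, hV'⟩ := exists_bound_of_period (varAt_period (P := P) (ν := ν))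
  obtain ⟨T, hT, hT'⟩ := exists_bound_of_period (timePotential_period (P := P) (n := n)
    (p := p n) (meanAt_period (P := P) (ν := ν)))
  obtain ⟨B, hB, hB'⟩ := h.exists_bound_integral_ageAt_sq hn hp hν0 hν
  have hTsq (l : ℕ) : timePotential P n (p n) (meanAt P ν) l ^ 2 ≤ T ^ 2 :=
    sq_le_sq' (abs_le.1 (hT' l)).1 (abs_le.1 (hT' l)).2
  have hfac (l : ℕ) : ∫ ω, ageFactor P n ν (p n) S X l ω ^ 2 ∂μ ≤ 2 * V + 2 * T ^ 2 := by
    have i1 := (h.memLp_centred hν l).integrable_sq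
    have h1 : ∫ ω, ageFactor P n ν (p n) S X l ω ^ 2 ∂μ ≤
        ∫ ω, (2 * (S l ω - meanAt P ν l) ^ 2 + 2 * T ^ 2) ∂μ := by
      refine integral_mono (h.memLp_ageFactor hν (p n) l).integrable_sq
        ((i1.const_mul 2).add (integrable_const _)) fun ω => ?_
      have a1 := failInd_nonneg (P := P) (n := n) (X := X) l ω
      have a2 := failInd_le_one (P := P) (n := n) (X := X) l ω
      have a3 := failProb_nonneg (P := P) (n := n) hp0 l
      have a4 := failProb_le_one (P := P) (n := n) hp.le l
      have a5 : (failInd P n X l ω - failProb P n (p n) l) ^ 2 ≤ 1 := by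
        rw [sq_le_one_iff_abs_le_one, abs_le]; constructor <;> linarith
      have a6 : ((failInd P n X l ω - failProb P n (p n) l) *
          timePotential P n (p n) (meanAt P ν) (l + 1)) ^ 2 ≤ T ^ 2 := by
        rw [mul_pow]
        exact (mul_le_of_le_one_left (sq_nonneg _) a5).trans (hTsq _)
      simp only [ageFactor]
      nlinarith [sq_nonneg ((S l ω - meanAt P ν l) - (failInd P n X l ω - failProb P n (p n) l) *
          timePotential P n (p n) (meanAt P ν) (l + 1))]
    rw [integral_add (i1.const_mul 2) (integrable_const _), integral_const_mul,
      h.integral_centred_sq hν] at h1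
    simp only [integral_const, probReal_univ, one_smul] at h1
    linarith [(abs_le.1 (hV' l)).2]
  refine ⟨2 * (B * (2 * V + 2 * T ^ 2)) + 2 * (V * T ^ 2), fun l => ?_⟩
  have m1 := measurable_ageAt_past (S := S) (X := X) (n := n) (P := P) l
  have m2 := h.measurable_ageFactor (n := n) (p n) l
  have e1 := h.integral_past_mul_present (m1.pow_const 2) (m2.pow_const 2)
  have i1 := h.integrable_past_mul_present (m1.pow_const 2) (m2.pow_const 2)
    (h.memLp_ageAt (n := n) hν l).integrable_sq
    (h.memLp_ageFactor (n := n) hν (p n) l).integrable_sq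
  have i2 := (h.memLp_centred hν l).integrable_sq
  have h1 : ∫ ω, ageNoise P n ν (p n) S X l ω ^ 2 ∂μ ≤
      ∫ ω, (2 * (ageAt P n S X 0 l ω ^ 2 * ageFactor P n ν (p n) S X l ω ^ 2) +
        2 * ((S l ω - meanAt P ν l) ^ 2 * T ^ 2)) ∂μ := by
    refine integral_mono (h.memLp_ageNoise hν (p n) l).integrable_sq
      ((i1.const_mul 2).add ((i2.mul_const _).const_mul 2)) fun ω => ?_
    have a1 := mul_le_mul_of_nonneg_left (hTsq (l + 1)) (sq_nonneg (S l ω - meanAt P ν l))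
    simp only [ageNoise]
    nlinarith [sq_nonneg (ageAt P n S X 0 l ω * ageFactor P n ν (p n) S X l ω -
      (S l ω - meanAt P ν l) * timePotential P n (p n) (meanAt P ν) (l + 1))]
  rw [integral_add (i1.const_mul 2) ((i2.mul_const _).const_mul 2), integral_const_mul,
    integral_const_mul, integral_mul_const, h.integral_centred_sq hν, e1] at h1
  have b1 : (∫ ω, ageAt P n S X 0 l ω ^ 2 ∂μ) * (∫ ω, ageFactor P n ν (p n) S X l ω ^ 2 ∂μ) ≤
      B * (2 * V + 2 * T ^ 2) :=
    mul_le_mul (hB' l) (hfac l) (integral_nonneg fun ω => sq_nonneg _) hB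
  have b2 : varAt P ν l * T ^ 2 ≤ V * T ^ 2 :=
    mul_le_mul_of_nonneg_right (abs_le.1 (hV' l)).2 (sq_nonneg T)
  linarith

theorem ae_tendsto_average_ageNoise (h : IsTransmissionProcess P ν p μ S X)
    (hn : ∃ k, P k = n) (hp : p n < 1) (hν0 : ∀ m, ∀ᵐ x ∂(ν m), 0 ≤ x)
    (hν : ∀ m, MemLp (fun x : ℝ => x) 2 (ν m)) :
    ∀ᵐ ω ∂μ, Tendsto (fun L : ℕ => (∑ l ∈ Finset.range L, ageNoise P n ν (p n) S X l ω) / L)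
      atTop (𝓝 0) := by
  obtain ⟨B, hB⟩ := h.exists_bound_ageNoise hn hp hν0 hν
  exact ae_tendsto_average_of_uncorrelated (h.memLp_ageNoise hν (p n)) hB
    fun l m hlm => h.integral_ageNoise_mul hν hlm

/-- Bounded second moments make E[A_L²]/L² summable; this disposes of the boundary term in the
decomposition. -/
theorem ae_tendsto_ageAt_div (h : IsTransmissionProcess P ν p μ S X)
    (hn : ∃ k, P k = n) (hp : p n < 1) (hν0 : ∀ m, ∀ᵐ x ∂(ν m), 0 ≤ x)
    (hν : ∀ m, MemLp (fun x : ℝ => x) 2 (ν m)) :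
    ∀ᵐ ω ∂μ, Tendsto (fun L : ℕ => ageAt P n S X 0 L ω / L) atTop (𝓝 0) := by
  obtain ⟨B, hB, hB'⟩ := h.exists_bound_integral_ageAt_sq hn hp hν0 hν
  have := ae_tendsto_zero_of_integral_le (μ := μ)
    (f := fun L ω => ageAt P n S X 0 L ω ^ 2 / (L : ℝ) ^ 2)
    (a := fun L : ℕ => B * (1 / (L : ℝ) ^ 2))
    (fun L => (h.memLp_ageAt hν L).integrable_sq.div_const _) (fun L ω => by positivity)
    (fun L => by
      rw [integral_div, ← div_eq_mul_one_div]
      exact div_le_div_of_nonneg_right (hB' L) (by positivity))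
    ((Real.summable_one_div_nat_pow.2 (by norm_num)).mul_left _)
  filter_upwards [this] with ω hω
  have h1 := hω.sqrt
  rw [Real.sqrt_zero] at h1
  rw [tendsto_zero_iff_abs_tendsto_zero]
  refine h1.congr fun L => ?_
  rw [← div_pow, Real.sqrt_sq_eq_abs]
  rfl

/-- Within a residue class modulo K the service times are identically distributed and pairwise
independent, so the classical strong law applies under mere integrability. This is what squared
service times require. -/
theorem ae_tendsto_average_service (h : IsTransmissionProcess P ν p μ S X)
    (hν0 : ∀ m, ∀ᵐ x ∂(ν m), 0 ≤ x) {φ : ℝ → ℝ} (hφ : Measurable φ) (hφ0 : ∀ x, 0 ≤ x → 0 ≤ φ x)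
    (hφint : ∀ l, Integrable (fun ω => φ (S l ω)) μ) :
    ∀ᵐ ω ∂μ, Tendsto (fun L : ℕ => (∑ l ∈ Finset.range L, φ (S l ω)) / L) atTop
      (𝓝 ((∑ r ∈ Finset.range K, ∫ ω, φ (S r ω) ∂μ) / K)) := by
  have h1 (r : ℕ) : ∀ᵐ ω ∂μ, Tendsto
      (fun M : ℕ => (∑ m ∈ Finset.range M, φ (S (r + m * K) ω)) / M) atTop
      (𝓝 (∫ ω, φ (S r ω) ∂μ)) := by
    have hK : 0 < K := Nat.pos_of_ne_zero (NeZero.ne K)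
    have := strong_law_ae_real (μ := μ) (fun m ω => φ (S (r + m * K) ω)) (hφint _)
      (fun i j hij => (h.indep_service.indepFun (i := r + i * K) (j := r + j * K) (by
        intro e
        exact hij (Nat.eq_of_mul_eq_mul_right hK (Nat.add_left_cancel e)))).comp hφ hφ)
      (fun i => by
        have hid : IdentDistrib (S (r + i * K)) (S (r + 0 * K)) μ μ :=
          ⟨(h.measurable_service _).aemeasurable, (h.measurable_service _).aemeasurable, by
            rw [h.law_service, h.law_service, mul_comm, src_add_mul_period, zero_mul, add_zero]⟩
        exact hid.comp hφ)
    simpa using this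
  filter_upwards [ae_all_iff.2 h1, h.ae_service_nonneg hν0] with ω hω hω0
  exact tendsto_average_of_residues (fun l => hφ0 _ (hω0 l)) fun r _ => hω r

theorem ae_tendsto_startTime_div (h : IsTransmissionProcess P ν p μ S X)
    (hν0 : ∀ m, ∀ᵐ x ∂(ν m), 0 ≤ x) (hν : ∀ m, MemLp (fun x : ℝ => x) 2 (ν m)) :
    ∀ᵐ ω ∂μ, Tendsto (fun L : ℕ => startTime S L ω / L) atTop (𝓝 (patternMean P ν / K)) := by
  have := h.ae_tendsto_average_service hν0 (φ := fun x => x) measurable_id (fun x hx => hx)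
    (fun l => h.integrable_service hν l)
  simp only [h.integral_service, sum_meanAt] at this
  exact this

/-- The long-run area under the age per transmission. -/
theorem ae_tendsto_average_area (h : IsTransmissionProcess P ν p μ S X)
    (hn : ∃ k, P k = n) (hp : p n < 1) (hν0 : ∀ m, ∀ᵐ x ∂(ν m), 0 ≤ x)
    (hν : ∀ m, MemLp (fun x : ℝ => x) 2 (ν m)) :
    ∀ᵐ ω ∂μ, Tendsto (fun L : ℕ => (∑ l ∈ Finset.range L,
        (ageAt P n S X 0 l ω * S l ω + S l ω ^ 2 / 2)) / (L : ℝ)) atTop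
      (𝓝 (((1 - p n) * ∑ i, (areaPotential P n (p n) (meanAt P ν) (varAt P ν) (inst P n i + 1) +
          serviceMean ν n * timePotential P n (p n) (meanAt P ν) (inst P n i + 1))) / K)) := by
  have hp0 := h.prob_nonneg hn
  have hs := meanAt_period (P := P) (ν := ν)
  have hv := varAt_period (P := P) (ν := ν)
  have hsq := h.ae_tendsto_average_service hν0 (φ := fun x => x ^ 2) (measurable_id.pow_const 2)
    (fun x _ => sq_nonneg x) (fun l => (h.memLp_service hν l).integrable_sq)
  simp only [h.integral_service_sq] at hsq
  obtain ⟨T, -, hT⟩ := exists_bound_of_period (timePotential_period (P := P) (n := n)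
    (p := p n) hs)
  obtain ⟨A, -, hA⟩ := exists_bound_of_period (areaPotential_period (P := P) (n := n)
    (p := p n) hs hv)
  have hw := tendsto_average_of_period (K := K) (g := fun l => varAt P ν l + meanAt P ν l ^ 2)
    (fun l => by simp only [hs, hv])
  have hdrift := tendsto_average_of_period (K := K) (g := fun l => (1 - failProb P n (p n) l) *
        (areaPotential P n (p n) (meanAt P ν) (varAt P ν) (l + 1) +
          meanAt P ν l * timePotential P n (p n) (meanAt P ν) (l + 1)))
    (fun l => by
      simp only [hs, failProb_period]
      rw [add_right_comm, areaPotential_period hs hv, timePotential_period hs])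
  rw [sum_range_slots fun l => areaPotential P n (p n) (meanAt P ν) (varAt P ν) (l + 1) +
          meanAt P ν l * timePotential P n (p n) (meanAt P ν) (l + 1)] at hdrift
  have hmean (i : Fin (alpha P n)) : meanAt P ν (inst P n i) = serviceMean ν n := by
    rw [meanAt, src_inst]
  simp only [hmean] at hdrift
  have hzero (c : ℝ) : Tendsto (fun L : ℕ => c / (L : ℝ)) atTop (𝓝 0) :=
    tendsto_const_div_atTop_nhds_zero_nat c
  have hApot : Tendsto (fun L : ℕ => areaPotential P n (p n) (meanAt P ν) (varAt P ν) L / L) atTop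
      (𝓝 0) := by
    refine squeeze_zero_norm (fun L => ?_) (hzero A)
    rw [norm_div, Real.norm_natCast, Real.norm_eq_abs]
    exact div_le_div_of_nonneg_right (hA L) (Nat.cast_nonneg L)
  filter_upwards [h.ae_tendsto_average_ageNoise hn hp hν0 hν, h.ae_tendsto_ageAt_div hn hp hν0 hν,
    hsq] with ω h1 h2 h3
  have hTpot : Tendsto (fun L : ℕ => ageAt P n S X 0 L ω / L *
      timePotential P n (p n) (meanAt P ν) L) atTop (𝓝 0) := by
    have h4 := h2.norm.mul_const T
    rw [norm_zero, zero_mul] at h4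
    refine squeeze_zero_norm (fun L => ?_) h4
    rw [norm_mul]
    exact mul_le_mul_of_nonneg_left (hT L) (norm_nonneg _)
  have hlim := (((((h1.add ((h3.sub hw).div_const 2)).add
    (hzero (areaPotential P n (p n) (meanAt P ν) (varAt P ν) 0))).sub hApot).sub hTpot).add hdrift)
  simp only [sub_self, zero_div, add_zero, zero_add] at hlim
  refine hlim.congr fun L => ?_
  rw [sum_area_eq (ν := ν) hn hp0 hp]
  ring

/-- The time average of the age. -/
theorem ae_hasTimeAverage_age (h : IsTransmissionProcess P ν p μ S X)
    (hn : ∃ k, P k = n) (hp : p n < 1) (hν0 : ∀ m, ∀ᵐ x ∂(ν m), 0 ≤ x)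
    (hν : ∀ m, MemLp (fun x : ℝ => x) 2 (ν m)) (hpos : 0 < patternMean P ν)
    {δ₀ : Ω → ℝ} (hδ : ∀ ω, 0 ≤ δ₀ ω) :
    ∀ᵐ ω ∂μ, HasTimeAverage (age P n S X δ₀ ω)
      (((1 - p n) * ∑ i, (areaPotential P n (p n) (meanAt P ν) (varAt P ν) (inst P n i + 1) +
          serviceMean ν n * timePotential P n (p n) (meanAt P ν) (inst P n i + 1))) /
        patternMean P ν) := by
  have hK : (0 : ℝ) < K := Nat.cast_pos.2 (Nat.pos_of_ne_zero (NeZero.ne K))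
  filter_upwards [h.ae_tendsto_average_area hn hp hν0 hν, h.ae_tendsto_startTime_div hν0 hν,
    h.ae_service_nonneg hν0, h.ae_exists_received hn hp 0] with ω h1 h2 h3 ⟨m, _, hm⟩
  refine ⟨fun T _ => intervalIntegrable_age h3 _ _, ?_⟩
  -- From the first reception on, the ages started from 0 and from `δ₀ ω` coincide, so only finitely
  -- many terms differ.
  have h4 := tendsto_average_of_eventually_eq (L₀ := m + 1)
    (y := fun l => ageAt P n S X (δ₀ ω) l ω * S l ω + S l ω ^ 2 / 2)
    (fun l hl => by rw [ageAt_eventually_eq hm 0 (δ₀ ω) l hl]) h1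
  simp only [← integral_age_startTime h3 (hδ ω)] at h4
  have h5 := tendsto_div_of_sequence (F := fun T => ∫ t in (0 : ℝ)..T, age P n S X δ₀ ω t)
    (D := fun L => startTime S L ω) ?_ ?_ (startTime_zero S ω) (startTime_mono h3)
    (div_pos hpos hK) h2 h4
  · rwa [div_div_div_cancel_right₀ hK.ne'] at h5
  · intro a ha b _ hab
    refine intervalIntegral.integral_mono_interval le_rfl ha hab ?_ (intervalIntegrable_age h3 _ _)
    refine (ae_restrict_iff' measurableSet_Ioc).2 (Eventually.of_forall fun t ht => ?_)
    exact age_nonneg h3 (hδ ω) ht.1.le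
  · intro t ht
    exact intervalIntegral.integral_nonneg ht fun u hu => age_nonneg h3 (hδ ω) hu.1

end IsTransmissionProcess

end Age

/-! ### The value as a ratio of stationary means -/

section Final

variable {Ω : Type*} [mΩ : MeasurableSpace Ω] {S : ℕ → Ω → ℝ} {X : ℕ → Ω → Bool}
  {N K : ℕ} [NeZero K] {P : Fin K → Fin N} {ν : Fin N → Measure ℝ} {p : Fin N → ℝ}
  {μ : Measure Ω} {n : Fin N} [IsProbabilityMeasure μ]

theorem patternMean_pos (hn : ∃ k, P k = n) (hν_pos : ∀ m, 0 < serviceMean ν m) :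
    0 < patternMean P ν := by
  refine Finset.sum_pos' (fun m _ => mul_nonneg (Nat.cast_nonneg _) (hν_pos m).le)
    ⟨n, Finset.mem_univ _, mul_pos (Nat.cast_pos.2 (alpha_pos hn)) (hν_pos n)⟩

namespace IsTransmissionProcess

/-- The series over the next reception is evaluated twice, as the potential and grouped by final
instance and number of rounds. -/
theorem sum_transProb_time (h : IsTransmissionProcess P ν p μ S X) (hn : ∃ k, P k = n)
    (hp : p n < 1) (hν : ∀ m, MemLp (fun x : ℝ => x) 2 (ν m)) (i : Fin (alpha P n)) :
    ∑ j, transProb (alpha P n) (p n) i j *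
        (roundsMean (alpha P n) (p n) * patternMean P ν + partialMean P n μ S i j) =
      timePotential P n (p n) (meanAt P ν) (inst P n i + 1) := by
  have h1 := hasSum_time_of_slot (h.prob_nonneg hn) hp (meanAt_period (P := P) (ν := ν))
    (inst_mod P n i)
  have h2 := hasSum_timePotential hn (h.prob_nonneg hn) hp (meanAt_period (P := P) (ν := ν))
    (inst P n i + 1)
  rw [← h1.unique h2, sum_meanAt]
  simp only [h.partialMean_eq hν]

/-- The area potential starts from age 0, whereas a cycle starts with the age left by its first
success, of mean s_n. That age lasts for the whole cycle and accounts for the additional term s_n τ.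
-/
theorem sum_transProb_area (h : IsTransmissionProcess P ν p μ S X) (hn : ∃ k, P k = n)
    (hp : p n < 1) (hν : ∀ m, MemLp (fun x : ℝ => x) 2 (ν m)) (i : Fin (alpha P n)) :
    ∑ j, transProb (alpha P n) (p n) i j *
        ((roundsSecond (alpha P n) (p n) * patternMean P ν ^ 2 +
          roundsMean (alpha P n) (p n) *
            (2 * serviceMean ν n * patternMean P ν + patternVar P ν) +
          partialSecond P n μ S i j +
          2 * partialMean P n μ S i j *
            (roundsMean (alpha P n) (p n) * patternMean P ν + serviceMean ν n)) / 2) =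
      areaPotential P n (p n) (meanAt P ν) (varAt P ν) (inst P n i + 1) +
        serviceMean ν n * timePotential P n (p n) (meanAt P ν) (inst P n i + 1) := by
  have h1 := hasSum_area_of_slot (h.prob_nonneg hn) hp (meanAt_period (P := P) (ν := ν))
    (varAt_period (P := P) (ν := ν)) (inst_mod P n i)
  have h2 := hasSum_areaPotential hn (h.prob_nonneg hn) hp (meanAt_period (P := P) (ν := ν))
    (varAt_period (P := P) (ν := ν)) (inst P n i + 1)
  rw [← h1.unique h2, ← h.sum_transProb_time hn hp hν, sum_meanAt, sum_varAt, Finset.mul_sum,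
    ← Finset.sum_add_distrib]
  refine Finset.sum_congr rfl fun j _ => ?_
  rw [h.partialMean_eq hν, h.partialSecond_eq hν]
  ring

theorem sum_statDist_time (h : IsTransmissionProcess P ν p μ S X) (hn : ∃ k, P k = n)
    (hp : p n < 1) (hν : ∀ m, MemLp (fun x : ℝ => x) 2 (ν m)) :
    ∑ i, ∑ j, statDist (alpha P n) (p n) (i, j) *
        (roundsMean (alpha P n) (p n) * patternMean P ν + partialMean P n μ S i j) =
      patternMean P ν / ((1 - p n) * alpha P n) := by
  rw [sum_statDist_mul]
  simp only [h.sum_transProb_time hn hp hν]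
  have h1 := sum_timePotential hn (h.prob_nonneg hn) hp (meanAt_period (P := P) (ν := ν))
  rw [sum_meanAt] at h1
  rw [← h1]
  have h2 : 1 - p n ≠ 0 := by linarith
  have h3 : (alpha P n : ℝ) ≠ 0 := by exact_mod_cast (alpha_pos hn).ne'
  field_simp

theorem sum_statDist_area (h : IsTransmissionProcess P ν p μ S X) (hn : ∃ k, P k = n)
    (hp : p n < 1) (hν : ∀ m, MemLp (fun x : ℝ => x) 2 (ν m)) :
    ∑ i, ∑ j, statDist (alpha P n) (p n) (i, j) *
        ((roundsSecond (alpha P n) (p n) * patternMean P ν ^ 2 +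
          roundsMean (alpha P n) (p n) *
            (2 * serviceMean ν n * patternMean P ν + patternVar P ν) +
          partialSecond P n μ S i j +
          2 * partialMean P n μ S i j *
            (roundsMean (alpha P n) (p n) * patternMean P ν + serviceMean ν n)) / 2) =
      (∑ i, (areaPotential P n (p n) (meanAt P ν) (varAt P ν) (inst P n i + 1) +
        serviceMean ν n * timePotential P n (p n) (meanAt P ν) (inst P n i + 1))) / alpha P n := by
  rw [sum_statDist_mul]
  simp only [h.sum_transProb_area hn hp hν]

end IsTransmissionProcess

theorem sum_statDist_affine (hn : ∃ k, P k = n) {q : ℝ} (hq : 0 ≤ q) (hq' : q < 1) (c : ℝ)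
    (f : Fin (alpha P n) → Fin (alpha P n) → ℝ) :
    ∑ i, ∑ j, statDist (alpha P n) q (i, j) * (c + f i j) =
      c + ∑ i, ∑ j, statDist (alpha P n) q (i, j) * f i j := by
  have h := sum_statDist hq hq' (alpha_pos hn)
  rw [Fintype.sum_prod_type] at h
  simp only [mul_add, Finset.sum_add_distrib, ← Finset.sum_mul, h, one_mul]

end Final

end CyclicAoI

open CyclicAoI in
theorem mainTheorem2 {N K : ℕ} [NeZero K] {Ω : Type*} [MeasurableSpace Ω]
    (μ : Measure Ω) [IsProbabilityMeasure μ]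
    (P : Fin K → Fin N) (n : Fin N) (hn : ∃ k, P k = n)
    (ν : Fin N → Measure ℝ) (p : Fin N → ℝ)
    (hν_nonneg : ∀ m, ∀ᵐ x ∂(ν m), 0 ≤ x)
    (hν_sq : ∀ m, MemLp (fun x : ℝ => x) 2 (ν m))
    (hν_pos : ∀ m, 0 < serviceMean ν m)
    (hp : p n < 1)
    (S : ℕ → Ω → ℝ) (X : ℕ → Ω → Bool) (hSX : IsTransmissionProcess P ν p μ S X)
    (δ₀ : Ω → ℝ) (hδ₀ : ∀ ω, 0 ≤ δ₀ ω) :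
    -- there are infinitely many successes, and the states of the successive cycles form a
    -- Markov chain with the stated transition probabilities
    (∀ᵐ ω ∂μ, {k | Received P n X ω k}.Infinite) ∧
    (∀ k : ℕ, ∀ᵐ ω ∂μ, ∃ y, InState P n X k y ω) ∧
    chainMatrix (alpha P n) (p n) ∈ rowStochastic ℝ (Fin (alpha P n) × Fin (alpha P n)) ∧
    (∀ (k : ℕ) (y : ℕ → Fin (alpha P n) × Fin (alpha P n)),
      μ.real {ω | ∀ l ≤ k + 1, InState P n X l (y l) ω} =
        μ.real {ω | ∀ l ≤ k, InState P n X l (y l) ω} *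
          chainMatrix (alpha P n) (p n) (y k) (y (k + 1))) ∧
    -- the chain is ergodic (irreducible and aperiodic) when packets can be dropped
    (0 < p n → (chainMatrix (alpha P n) (p n)).IsPrimitive) ∧
    -- its unique stationary distribution
    (∀ y, 0 ≤ statDist (alpha P n) (p n) y) ∧
    ∑ y, statDist (alpha P n) (p n) y = 1 ∧
    statDist (alpha P n) (p n) ᵥ* chainMatrix (alpha P n) (p n) = statDist (alpha P n) (p n) ∧
    (∀ ρ : Fin (alpha P n) × Fin (alpha P n) → ℝ, (∀ y, 0 ≤ ρ y) → ∑ y, ρ y = 1 →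
      ρ ᵥ* chainMatrix (alpha P n) (p n) = ρ → ρ = statDist (alpha P n) (p n)) ∧
    -- mean and variance of the duration of a round
    (∀ q : ℕ, ∫ ω, (∑ l ∈ Finset.Ico q (q + K), S l ω) ∂μ = patternMean P ν ∧
      variance (fun ω => ∑ l ∈ Finset.Ico q (q + K), S l ω) μ = patternVar P ν) ∧
    -- given the state of a cycle: the law of the number of complete rounds, the moments of the
    -- partial duration
    (∀ (k : ℕ) (i j : Fin (alpha P n)), μ {ω | InState P n X k (i, j) ω} ≠ 0 →
      (∀ m : ℕ, (cond μ {ω | InState P n X k (i, j) ω}).real {ω | cycleRounds P n X k ω = m} =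
        roundsProb (alpha P n) (p n) m) ∧
      MemLp (cyclePartial P n S X k) 2 (cond μ {ω | InState P n X k (i, j) ω}) ∧
      ∫ ω, cyclePartial P n S X k ω ∂(cond μ {ω | InState P n X k (i, j) ω}) =
        partialMean P n μ S i j ∧
      ∫ ω, cyclePartial P n S X k ω ^ 2 ∂(cond μ {ω | InState P n X k (i, j) ω}) =
        partialSecond P n μ S i j) ∧
    -- the expected areas and times, given the state of the cycle, and the mean age
    ∃ EA ET : Fin (alpha P n) → Fin (alpha P n) → ℝ,
      (∀ (k : ℕ) (i j : Fin (alpha P n)), μ {ω | InState P n X k (i, j) ω} ≠ 0 →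
        Integrable (cycleArea P n S X δ₀ k) (cond μ {ω | InState P n X k (i, j) ω}) ∧
        ∫ ω, cycleArea P n S X δ₀ k ω ∂(cond μ {ω | InState P n X k (i, j) ω}) = EA i j ∧
        Integrable (cycleTime P n S X k) (cond μ {ω | InState P n X k (i, j) ω}) ∧
        ∫ ω, cycleTime P n S X k ω ∂(cond μ {ω | InState P n X k (i, j) ω}) = ET i j) ∧
      (∀ i j, EA i j =
        (roundsSecond (alpha P n) (p n) * patternMean P ν ^ 2 +
          roundsMean (alpha P n) (p n) *
            (2 * serviceMean ν n * patternMean P ν + patternVar P ν) +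
          partialSecond P n μ S i j +
          2 * partialMean P n μ S i j *
            (roundsMean (alpha P n) (p n) * patternMean P ν + serviceMean ν n)) / 2) ∧
      (∀ i j, ET i j =
        roundsMean (alpha P n) (p n) * patternMean P ν + partialMean P n μ S i j) ∧
      0 < ∑ i, ∑ j, statDist (alpha P n) (p n) (i, j) * ET i j ∧
      (∀ᵐ ω ∂μ, HasTimeAverage (age P n S X δ₀ ω)
        ((∑ i, ∑ j, statDist (alpha P n) (p n) (i, j) * EA i j) /
          (∑ i, ∑ j, statDist (alpha P n) (p n) (i, j) * ET i j))) ∧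
      (∀ᵐ ω ∂μ, HasTimeAverage (age P n S X δ₀ ω)
        ((roundsSecond (alpha P n) (p n) * patternMean P ν ^ 2 +
            roundsMean (alpha P n) (p n) *
              (2 * serviceMean ν n * patternMean P ν + patternVar P ν) +
            ∑ i, ∑ j, statDist (alpha P n) (p n) (i, j) * partialSecond P n μ S i j) /
          (2 * (roundsMean (alpha P n) (p n) * patternMean P ν +
            ∑ i, ∑ j, statDist (alpha P n) (p n) (i, j) * partialMean P n μ S i j)) +
        (roundsMean (alpha P n) (p n) * patternMean P ν + serviceMean ν n) *
            (∑ i, ∑ j, statDist (alpha P n) (p n) (i, j) * partialMean P n μ S i j) /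
          (roundsMean (alpha P n) (p n) * patternMean P ν +
            ∑ i, ∑ j, statDist (alpha P n) (p n) (i, j) * partialMean P n μ S i j))) := by
  have hp0 := hSX.prob_nonneg hn
  have hα := alpha_pos hn
  have hpm := patternMean_pos hn hν_pos
  have hET := hSX.sum_statDist_time hn hp hν_sq
  have hEA := hSX.sum_statDist_area hn hp hν_sq
  have hα' : (0 : ℝ) < alpha P n := by exact_mod_cast hα
  have hq : 0 < 1 - p n := by linarith
  have hETpos : 0 < patternMean P ν / ((1 - p n) * alpha P n) := by positivity
  have havg := hSX.ae_hasTimeAverage_age hn hp hν_nonneg hν_sq hpm hδ₀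
  -- Both the numerator and the denominator of the stationary ratio contain 1/α, and the factor 1 -
  -- p comes from `sum_statDist_time`.
  have hvalue : ((1 - p n) * ∑ i, (areaPotential P n (p n) (meanAt P ν) (varAt P ν)
      (inst P n i + 1) + serviceMean ν n *
        timePotential P n (p n) (meanAt P ν) (inst P n i + 1))) / patternMean P ν =
      ((∑ i, (areaPotential P n (p n) (meanAt P ν) (varAt P ν) (inst P n i + 1) +
        serviceMean ν n * timePotential P n (p n) (meanAt P ν) (inst P n i + 1))) / alpha P n) /
      (patternMean P ν / ((1 - p n) * alpha P n)) := by
    field_simp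
  rw [hvalue, ← hEA, ← hET] at havg
  refine ⟨hSX.ae_infinite_received hn hp, hSX.ae_inState hn hp,
    chainMatrix_mem_rowStochastic hp0 hp, hSX.prob_chain hn hp,
    fun h => chainMatrix_isPrimitive h hp, statDist_nonneg hp0 hp, sum_statDist hp0 hp hα,
    statDist_vecMul hp0 hp, fun ρ _ h1 h2 => statDist_unique hp0 hp ρ h1 h2,
    hSX.round_moments hν_sq,
    fun k i j h0 => ⟨hSX.cond_rounds hn hp h0, hSX.cond_partial hn hp hν_nonneg hν_sq h0⟩,
    _, _, fun k i j h0 => ?_, fun i j => rfl, fun i j => rfl, ?_, havg, ?_⟩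
  · have h1 := hSX.cond_cycleArea hn hp hν_nonneg hν_sq hδ₀ h0
    have h2 := hSX.cond_cycleTime hn hp hν_nonneg hν_sq h0
    exact ⟨h1.1, h1.2, h2.1, h2.2⟩
  · rw [hET]; exact hETpos
  · have e1 := sum_statDist_affine hn hp0 hp
      (roundsMean (alpha P n) (p n) * patternMean P ν) (partialMean P n μ S)
    -- The stationary law has total mass one, so the terms of E[A_{i,j}] that do not depend on (i,
    -- j) come out of the average unchanged.
    have e2 : ∑ i, ∑ j, statDist (alpha P n) (p n) (i, j) *
        ((roundsSecond (alpha P n) (p n) * patternMean P ν ^ 2 +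
          roundsMean (alpha P n) (p n) *
            (2 * serviceMean ν n * patternMean P ν + patternVar P ν) +
          partialSecond P n μ S i j +
          2 * partialMean P n μ S i j *
            (roundsMean (alpha P n) (p n) * patternMean P ν + serviceMean ν n)) / 2) =
        (roundsSecond (alpha P n) (p n) * patternMean P ν ^ 2 +
          roundsMean (alpha P n) (p n) *
            (2 * serviceMean ν n * patternMean P ν + patternVar P ν)) / 2 +
        (∑ i, ∑ j, statDist (alpha P n) (p n) (i, j) * partialSecond P n μ S i j) / 2 +
        (roundsMean (alpha P n) (p n) * patternMean P ν + serviceMean ν n) *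
          ∑ i, ∑ j, statDist (alpha P n) (p n) (i, j) * partialMean P n μ S i j := by
      have e3 := sum_statDist_affine hn hp0 hp
        ((roundsSecond (alpha P n) (p n) * patternMean P ν ^ 2 +
          roundsMean (alpha P n) (p n) *
            (2 * serviceMean ν n * patternMean P ν + patternVar P ν)) / 2)
        (fun i j => partialSecond P n μ S i j / 2 +
          (roundsMean (alpha P n) (p n) * patternMean P ν + serviceMean ν n) *
            partialMean P n μ S i j)
      simp only [Finset.sum_div, Finset.mul_sum]
      rw [add_assoc, ← Finset.sum_add_distrib]
      simp only [← Finset.sum_add_distrib]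
      refine Eq.trans ?_ (e3.trans ?_)
      · refine Finset.sum_congr rfl fun i _ => Finset.sum_congr rfl fun j _ => ?_
        ring
      · congr 1
        refine Finset.sum_congr rfl fun i _ => Finset.sum_congr rfl fun j _ => ?_
        ring
    have hpos := hETpos
    rw [← hET, e1] at hpos
    rw [e1, e2] at havg
    convert havg using 3
    field_simp
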